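/- Let $\Bbbk$ be a field, $G$ a group, and let $(H,g)$ be a pivotal Hopf $G$-coalgebra of finite type over $\Bbbk$: a family of finite-dimensional $\Bbbk$-algebras $H_x$ ($x\in G$) with algebra maps $\Delta_{x,y}\colon H_{xy}\to H_x\otimes H_y$ and $\varepsilon\colon H_1\to\Bbbk$ and linear maps $S_x\colon H_x\to H_{x^{-1}}$ satisfying coassociativity, counitality and the antipode axioms, together with a $G$-group-like element $g=(g_x)_{x\in G}$ (that is, $\Delta_{x,y}(g_{xy})=g_x\otimes g_y$ and $\varepsilon(g_1)=1$) such that $S_{x^{-1}}S_x(a)=g_x\,a\,g_x^{-1}$ for $a\in H_x$. Let $H\text{-mod}$ be the pivotal $\Bbbk$-linear monoidal category of finite direct sums $V=\bigoplus_x V_x$ of finite-dimensional left $H_x$-modules $V_x$ (there are no non-zero morphisms between different degrees), where $H_{xy}$ acts on $V_x\otimes W_y$ through $\Delta_{x,y}$, the unit is $\Bbbk$ with the action of $H_1$ by $\varepsilon$, $V^*$ is the dual space with the action through $S$, $\mathrm{ev}_V(f\otimes v)=f(v)$, $\mathrm{coev}_V(1)=\sum_i v_i\otimes v_i^*$, $\widetilde{\mathrm{ev}}_V(v\otimes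 f)=f(g v)$ and $\widetilde{\mathrm{coev}}_V(1)=\sum_i v_i^*\otimes g^{-1}v_i$. Let $H\text{-pmod}$ be its full subcategory of projective objects, a right and left module category over $H\text{-mod}$ by the tensor product. For a group-like $\nu\in H_1^*$ (an algebra map $H_1\to\Bbbk$), let $R(\nu)(a)=(\nu\otimes\mathrm{id})\Delta_{1,x}(a)$ and $L(\nu)(a)=(\mathrm{id}\otimes\nu)\Delta_{x,1}(a)$ for $a\in H_x$. Twisting the action by these algebra automorphisms, $a\cdot v=R(\nu)(a)v$ resp. $a\cdot v=L(\nu)(a)v$, gives endofunctors $R(\nu)_*$ and $L(\nu)_*$ of $H\text{-pmod}$; the identity maps $\sigma_{P,V}\colon R(\nu)_*(P\otimes V)=R(\nu)_*P\otimes V$ and $\sigma_{V,P}\colon L(\nu)_*(V\otimes P)=V\otimes L(\nu)_*P$ make them a right, respectively left, module endofunctor. For an endofunctor $\Sigma$ of $H\text{-pmod}$, a trace map on $(H\text{-pmod},\Sigma)$ is a family of linear maps $t_P\colon\mathrm{Hom}(P,\Sigma P)\to\Bbbk$, $P\in H\text{-pmod}$, with $t_P(f\circ h)=t_Q(\Sigma(h)\circ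 f)$ for all $h\colon P\to Q$, $f\colon Q\to\Sigma P$. If $\Sigma$ is a right module endofunctor, a right module trace is a trace map such that, for all $P$, $V\in H\text{-mod}$ and $f\colon P\otimes V\to\Sigma(P\otimes V)$, $$t_{P\otimes V}(f)=t_P\bigl((\mathrm{id}_{\Sigma P}\otimes\widetilde{\mathrm{ev}}_V)\circ((\sigma_{P,V}\circ f)\otimes\mathrm{id}_{V^*})\circ(\mathrm{id}_P\otimes\mathrm{coev}_V)\bigr);$$ if $\Sigma$ is a left module endofunctor, a left module trace is a trace map such that, for all $f\colon V\otimes P\to\Sigma(V\otimes P)$, $$t_{V\otimes P}(f)=t_P\bigl((\mathrm{ev}_V\otimes\mathrm{id}_{\Sigma P})\circ(\mathrm{id}_{V^*}\otimes(\sigma_{V,P}\circ f))\circ(\widetilde{\mathrm{coev}}_V\otimes\mathrm{id}_P)\bigr).$$ A right (left) modified trace on $H\text{-pmod}$ is a right (left) module trace for $\Sigma=\mathrm{Id}$. A trace map is non-degenerate if for all $P,Q$ the pairing $\mathrm{Hom}(Q,\Sigma P)\times\mathrm{Hom}(P,Q)\to\Bbbk$, $(f,h)\mapsto t_P(f\circ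 h)$, is non-degenerate. Then $H_1$ has a modulus: there are a non-zero left cointegral in $H_1$ (an element $c$ with $ac=\varepsilon(a)c$ for all $a\in H_1$) and a (necessarily unique) algebra map $\alpha\colon H_1\to\Bbbk$ with $ca=\alpha(a)c$ for all $a\in H_1$ and all left cointegrals $c$. Moreover, for every group-like $\nu\in H_1^*$: 1. $(H\text{-pmod},R(\nu)_*)$ has a non-zero right module trace if and only if $\nu=\alpha$. 2. $(H\text{-pmod},L(\nu)_*)$ has a non-zero left module trace if and only if $\nu=\alpha$. 3. Every non-zero right module trace on $(H\text{-pmod},R(\nu)_*)$ and every non-zero left module trace on $(H\text{-pmod},L(\nu)_*)$ is non-degenerate. In particular, $H\text{-pmod}$ has a non-zero right modified trace if and only if $H_1$ is unimodular (that is, $\alpha=\varepsilon$), and it has a non-zero left modified trace if and only if $H_1$ is unimodular. -/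

import Mathlib

set_option linter.unusedSectionVars false

open CategoryTheory MonoidalCategory TensorProduct

universe v u v₁ u₁ v₂ u₂

noncomputable section

namespace ModTrace

section Generic

open MonoidalLeftAction MonoidalRightAction

/-- The duality data of a pivotal category that enter the definition of module traces: every
object `V` has a chosen object `V* = dual V` which is both a right and a left dual of `V`, with
`coev : 𝟙 ⟶ V ⊗ V*`, `ev : V* ⊗ V ⟶ 𝟙` (first pairing) and
`tcoev : 𝟙 ⟶ V* ⊗ V`, `tev : V ⊗ V* ⟶ 𝟙` (second pairing), both satisfying the zig-zag
identities. -/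
class TwoSidedDuals (C : Type u₁) [Category.{v₁} C] [MonoidalCategory C] where
  dual : C → C
  pairing (V : C) : ExactPairing V (dual V)
  pairing' (V : C) : ExactPairing (dual V) V

namespace TwoSidedDuals

variable {C : Type u₁} [Category.{v₁} C] [MonoidalCategory C] [TwoSidedDuals C]

def coev (V : C) : 𝟙_ C ⟶ V ⊗ dual V := (pairing V).coevaluation'

def ev (V : C) : dual V ⊗ V ⟶ 𝟙_ C := (pairing V).evaluation'

def tcoev (V : C) : 𝟙_ C ⟶ dual V ⊗ V := (pairing' V).coevaluation'

def tev (V : C) : V ⊗ dual V ⟶ 𝟙_ C := (pairing' V).evaluation'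

end TwoSidedDuals

open TwoSidedDuals

variable (k : Type u) [Field k]
variable {C : Type u₁} [Category.{v₁} C] [MonoidalCategory C] [TwoSidedDuals C]
variable {M : Type u₂} [Category.{v₂} M]

/-- The right partial `F`-trace of `f : P ⊙ V ⟶ F (P ⊙ V)`, a morphism `P ⟶ F P`, namely
`(id_{F P} ⊙ tev_V) ∘ ((σ_{P,V} ∘ f) ⊙ id_{V*}) ∘ (id_P ⊙ coev_V)`, where
`σ_{P,V} : F (P ⊙ V) ⟶ F P ⊙ V` is the module structure of `F`. -/
def rightPartialTrace [MonoidalRightAction C M] (F : M ⥤ M) [F.RightLinear C] (P : M) (V : C)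
    (f : P ⊙ᵣ V ⟶ F.obj (P ⊙ᵣ V)) : P ⟶ F.obj P :=
  (ρᵣ[C] P).inv ≫ P ⊴ᵣ coev V ≫ (αᵣ P V (dual V)).hom ≫
    (f ≫ Functor.OplaxRightLinear.δᵣ F P V) ⊵ᵣ dual V ≫
    (αᵣ (F.obj P) V (dual V)).inv ≫ F.obj P ⊴ᵣ tev V ≫ (ρᵣ[C] (F.obj P)).hom

/-- The left partial `F`-trace of `f : V ⊙ P ⟶ F (V ⊙ P)`, namely
`(ev_V ⊙ id_{F P}) ∘ (id_{V*} ⊙ (σ_{V,P} ∘ f)) ∘ (tcoev_V ⊙ id_P)`. -/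
def leftPartialTrace [MonoidalLeftAction C M] (F : M ⥤ M) [F.LeftLinear C] (V : C) (P : M)
    (f : V ⊙ₗ P ⟶ F.obj (V ⊙ₗ P)) : P ⟶ F.obj P :=
  (λₗ[C] P).inv ≫ tcoev V ⊵ₗ P ≫ (αₗ (dual V) V P).hom ≫
    dual V ⊴ₗ (f ≫ Functor.OplaxLeftLinear.δₗ F V P) ≫
    (αₗ (dual V) V (F.obj P)).inv ≫ ev V ⊵ₗ F.obj P ≫ (λₗ[C] (F.obj P)).hom

variable [Preadditive M] [Linear k M]

/-- A trace map on the `k`-linear endocategory `(M, F)`: a family of `k`-linear maps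
`t_P : M(P, F P) → k` with `t_P (f ∘ g) = t_Q (F g ∘ f)` for `g : P ⟶ Q`, `f : Q ⟶ F P`. -/
structure TraceMap (F : M ⥤ M) where
  tr : ∀ P : M, (P ⟶ F.obj P) →ₗ[k] k
  cyclic : ∀ {P Q : M} (g : P ⟶ Q) (f : Q ⟶ F.obj P), tr P (g ≫ f) = tr Q (f ≫ F.map g)

variable {k}

namespace TraceMap

variable {F : M ⥤ M}

def IsNonzero (t : TraceMap k F) : Prop := ∃ (P : M) (f : P ⟶ F.obj P), t.tr P f ≠ 0

/-- All pairings `M(Q, F P) × M(P, Q) → k`, `(f, g) ↦ t_P (f ∘ g)`, are non-degenerate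
(in both arguments). -/
def Nondegenerate (t : TraceMap k F) : Prop :=
  ∀ P Q : M,
    (∀ f : Q ⟶ F.obj P, (∀ g : P ⟶ Q, t.tr P (g ≫ f) = 0) → f = 0) ∧
    (∀ g : P ⟶ Q, (∀ f : Q ⟶ F.obj P, t.tr P (g ≫ f) = 0) → g = 0)

variable (C)

/-- Right module traces: trace maps with the right partial trace property. -/
def IsRightModuleTrace [MonoidalRightAction C M] [F.RightLinear C] (t : TraceMap k F) : Prop :=
  ∀ (P : M) (V : C) (f : P ⊙ᵣ V ⟶ F.obj (P ⊙ᵣ V)),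
    t.tr (P ⊙ᵣ V) f = t.tr P (rightPartialTrace F P V f)

/-- Left module traces: trace maps with the left partial trace property. -/
def IsLeftModuleTrace [MonoidalLeftAction C M] [F.LeftLinear C] (t : TraceMap k F) : Prop :=
  ∀ (V : C) (P : M) (f : V ⊙ₗ P ⟶ F.obj (V ⊙ₗ P)),
    t.tr (V ⊙ₗ P) f = t.tr P (leftPartialTrace F V P f)

end TraceMap

/-- The identity functor as a module functor, with identity structure maps. -/
instance idRightLinear (C : Type u₁) [Category.{v₁} C] [MonoidalCategory C]
    (M : Type u₂) [Category.{v₂} M] [MonoidalRightAction C M] :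
    (𝟭 M).RightLinear C where
  μᵣ P V := 𝟙 (P ⊙ᵣ V)
  δᵣ P V := 𝟙 (P ⊙ᵣ V)
  μᵣ_naturality_right := by intros; simp
  μᵣ_naturality_left := by intros; simp
  μᵣ_associativity := by intros; simp
  μᵣ_unitality := by intros; simp
  δᵣ_naturality_right := by intros; simp
  δᵣ_naturality_left := by intros; simp
  δᵣ_associativity := by intros; simp
  δᵣ_unitality_inv := by intros; simp
  μᵣ_comp_δᵣ := by intros; simp
  δᵣ_comp_μᵣ := by intros; simp

instance idLeftLinear (C : Type u₁) [Category.{v₁} C] [MonoidalCategory C]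
    (M : Type u₂) [Category.{v₂} M] [MonoidalLeftAction C M] :
    (𝟭 M).LeftLinear C where
  μₗ V P := 𝟙 (V ⊙ₗ P)
  δₗ V P := 𝟙 (V ⊙ₗ P)
  μₗ_naturality_right := by intros; simp
  μₗ_naturality_left := by intros; simp
  μₗ_associativity := by intros; simp
  μₗ_unitality := by intros; simp
  δₗ_naturality_right := by intros; simp
  δₗ_naturality_left := by intros; simp
  δₗ_associativity := by intros; simp
  δₗ_unitality_inv := by intros; simp
  μₗ_comp_δₗ := by intros; simp
  δₗ_comp_μₗ := by intros; simp

end Generic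

section Ideal

variable (C : Type u₁) [Category.{v₁} C] [MonoidalCategory C]

/-- The full subcategory of projective objects. -/
abbrev Proj := (isProjective C).FullSubcategory

variable {C} [TwoSidedDuals C]

theorem projective_tensor_right (P V : C) (hP : Projective P) : Projective (P ⊗ V) := by
  let := TwoSidedDuals.pairing V
  let := TwoSidedDuals.pairing' V
  have : (tensorRight (TwoSidedDuals.dual V)).IsLeftAdjoint :=
    (tensorRightAdjunction (TwoSidedDuals.dual V) V).isLeftAdjoint
  exact (tensorRightAdjunction V (TwoSidedDuals.dual V)).map_projective P hP

theorem projective_tensor_left (V P : C) (hP : Projective P) : Projective (V ⊗ P) := by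
  let := TwoSidedDuals.pairing V
  let := TwoSidedDuals.pairing' V
  have : (tensorLeft (TwoSidedDuals.dual V)).IsLeftAdjoint :=
    (tensorLeftAdjunction V (TwoSidedDuals.dual V)).isLeftAdjoint
  exact (tensorLeftAdjunction (TwoSidedDuals.dual V) V).map_projective P hP

/-- The projective objects form a right module category by `P ⊙ V = P ⊗ V`. -/
instance projRightAction : MonoidalRightAction C (Proj C) where
  actionObj P V := ⟨P.obj ⊗ V, projective_tensor_right P.obj V P.property⟩
  actionHomLeft f V := ObjectProperty.homMk (f.hom ▷ V)
  actionHomRight P _ _ g := ObjectProperty.homMk (P.obj ◁ g)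
  actionHom f g := ObjectProperty.homMk (f.hom ⊗ₘ g)
  actionAssocIso P V W := ObjectProperty.isoMk _ (α_ P.obj V W).symm
  actionUnitIso P := ObjectProperty.isoMk _ (ρ_ P.obj)
  actionHom_def := by intros; ext; simp [MonoidalCategory.tensorHom_def]
  actionHomRight_id := by intros; ext; simp
  id_actionHomLeft := by intros; ext; simp
  actionHom_comp := by intros; ext; simp
  actionAssocIso_hom_naturality := by intros; ext; simp
  actionUnitIso_hom_naturality := by intros; ext; simp
  actionHomRight_whiskerRight := by intros; ext; simp
  whiskerRight_actionHomLeft := by intros; ext; simp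
  actionHom_associator := by intros; ext; simp
  actionHom_leftUnitor := by intros; ext; simp
  actionHom_rightUnitor := by intros; ext; simp

/-- The projective objects form a left module category by `V ⊙ P = V ⊗ P`. -/
instance projLeftAction : MonoidalLeftAction C (Proj C) where
  actionObj V P := ⟨V ⊗ P.obj, projective_tensor_left V P.obj P.property⟩
  actionHomLeft f P := ObjectProperty.homMk (f ▷ P.obj)
  actionHomRight V _ _ g := ObjectProperty.homMk (V ◁ g.hom)
  actionHom f g := ObjectProperty.homMk (f ⊗ₘ g.hom)
  actionAssocIso V W P := ObjectProperty.isoMk _ (α_ V W P.obj)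
  actionUnitIso P := ObjectProperty.isoMk _ (λ_ P.obj)
  actionHom_def := by intros; ext; simp [MonoidalCategory.tensorHom_def]
  actionHomRight_id := by intros; ext; simp
  id_actionHomLeft := by intros; ext; simp
  actionHom_comp := by intros; ext; simp
  actionAssocIso_hom_naturality := by intros; ext; simp
  actionUnitIso_hom_naturality := by intros; ext; simp
  whiskerLeft_actionHomLeft := by intros; ext; simp
  whiskerRight_actionHomLeft := by intros; ext; simp
  associator_actionHom := by intros; ext; simp
  leftUnitor_actionHom := by intros; ext; simp
  rightUnitor_actionHom := by intros; ext; simp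

end Ideal

section Hopf

/-- A Hopf `G`-coalgebra over `k`: a family of algebras `H x`, `x ∈ G`, with algebra maps
`Δ_{x,y} : H (xy) → H x ⊗ H y`, `ε : H 1 → k` and linear maps `S_x : H x → H x⁻¹`.
To avoid transporting elements along equalities in `G`, the comultiplication is indexed by
equations `x * y = z` (so that `comul (rfl : x * y = x * y)` is `Δ_{x,y}`), and the antipode by
equations `x * y = 1`, i.e. `y = x⁻¹`. -/
class HopfGroupCoalgebra (k : Type u) [Field k] {G : Type v} [Group G] (H : G → Type u)
    [∀ x, Ring (H x)] [∀ x, Algebra k (H x)] where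
  comul {x y z : G} (h : x * y = z) : H z →ₐ[k] H x ⊗[k] H y
  counit : H 1 →ₐ[k] k
  antipode {x y : G} (h : x * y = 1) : H x →ₗ[k] H y
  /-- `(Δ_{x,y} ⊗ id) ∘ Δ_{xy,z} = (id ⊗ Δ_{y,z}) ∘ Δ_{x,yz}` -/
  coassoc {x y z xy yz w : G} (h₁ : x * y = xy) (h₂ : xy * z = w) (h₃ : y * z = yz)
    (h₄ : x * yz = w) (a : H w) :
    TensorProduct.assoc k (H x) (H y) (H z)
        (TensorProduct.map (comul h₁).toLinearMap LinearMap.id (comul h₂ a)) =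
      TensorProduct.map LinearMap.id (comul h₃).toLinearMap (comul h₄ a)
  /-- `(ε ⊗ id) ∘ Δ_{1,x} = id` -/
  counit_left {x : G} (a : H x) :
    TensorProduct.lid k (H x)
      (TensorProduct.map counit.toLinearMap LinearMap.id (comul (one_mul x) a)) = a
  /-- `(id ⊗ ε) ∘ Δ_{x,1} = id` -/
  counit_right {x : G} (a : H x) :
    TensorProduct.rid k (H x)
      (TensorProduct.map LinearMap.id counit.toLinearMap (comul (mul_one x) a)) = a
  /-- `m_x ∘ (S_{x⁻¹} ⊗ id) ∘ Δ_{x⁻¹,x} = ε 1_x`, with `y = x⁻¹` -/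
  antipode_left {x y : G} (h : y * x = 1) (a : H 1) :
    LinearMap.mul' k (H x)
      (TensorProduct.map (antipode h) LinearMap.id (comul h a)) = algebraMap k (H x) (counit a)
  /-- `m_x ∘ (id ⊗ S_{x⁻¹}) ∘ Δ_{x,x⁻¹} = ε 1_x`, with `y = x⁻¹` -/
  antipode_right {x y : G} (h : x * y = 1) (h' : y * x = 1) (a : H 1) :
    LinearMap.mul' k (H x)
      (TensorProduct.map LinearMap.id (antipode h') (comul h a)) = algebraMap k (H x) (counit a)

/-- A pivotal Hopf `G`-coalgebra: a Hopf `G`-coalgebra with a `G`-group-like element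
`g = (g_x)` such that `S_{x⁻¹} (S_x a) = g_x a g_x⁻¹`, where `g_x⁻¹ = S_{x⁻¹} (g_{x⁻¹})`. -/
class PivotalHopfGroupCoalgebra (k : Type u) [Field k] {G : Type v} [Group G] (H : G → Type u)
    [∀ x, Ring (H x)] [∀ x, Algebra k (H x)] extends HopfGroupCoalgebra k H where
  pivot (x : G) : H x
  comul_pivot {x y z : G} (h : x * y = z) : comul h (pivot z) = pivot x ⊗ₜ[k] pivot y
  counit_pivot : counit (pivot 1) = 1
  antipode_antipode {x y : G} (h : x * y = 1) (h' : y * x = 1) (a : H x) :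
    antipode h' (antipode h a) = pivot x * a * antipode h' (pivot y)

variable {k : Type u} [Field k] {G : Type v} [Group G] {H : G → Type u}
  [∀ x, Ring (H x)] [∀ x, Algebra k (H x)]

namespace HopfGroupCoalgebra

section Antipode

variable [HopfGroupCoalgebra k H]

theorem antipode_one {x y : G} (h : x * y = 1) : antipode (k := k) (H := H) h 1 = 1 := by
  have := antipode_left (k := k) (H := H) h 1
  simpa [Algebra.TensorProduct.one_def] using this

theorem antipode_mul {x y : G} (h : x * y = 1) (a b : H x) :
    antipode (k := k) h (a * b) = antipode (k := k) h b * antipode (k := k) h a := by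
  have h' : y * x = 1 := by rw [mul_eq_one_iff_eq_inv] at h ⊢; rw [h, inv_inv]
  set S : H x →ₗ[k] H y := antipode h with hS
  -- the form `(p ⊗ (u ⊗ v), q ⊗ (u' ⊗ v')) ↦ S q * S p * (u * u') * S (v * v')`
  let N : (H y ⊗[k] H x) →ₗ[k] H y := LinearMap.mul' k (H y) ∘ₗ TensorProduct.map LinearMap.id S
  let B : (H y ⊗[k] H x) →ₗ[k] (H y ⊗[k] H x) →ₗ[k] H y :=
    (LinearMap.mul k (H y ⊗[k] H x)).compr₂ N
  have hB : ∀ u u' v v', B (u ⊗ₜ v) (u' ⊗ₜ v') = u * u' * S (v * v') := by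
    intro u u' v v'; simp [B, N]
  -- expression after applying `Δ` to the last two factors
  have key1 : ∀ c d : H 1, B (comul h' c) (comul h' d) = algebraMap k _ (counit c * counit d) := by
    intro c d
    have := antipode_right (k := k) (H := H) h' h (c * d)
    simpa [B, N] using this
  let P : (H x ⊗[k] (H y ⊗[k] H x)) →ₗ[k] (H x ⊗[k] (H y ⊗[k] H x)) →ₗ[k] H y :=
    TensorProduct.lift
      (LinearMap.mk₂ k
        (fun p U => TensorProduct.lift
          (LinearMap.mk₂ k (fun q U' => S q * S p * B U U')
            (by intros; simp [add_mul]) (by intros; simp)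
            (by intros; simp [mul_add]) (by intros; simp)))
        (by intros; ext; simp [add_mul, mul_add]) (by intros; ext; simp)
        (by intros; ext; simp [mul_add]) (by intros; ext; simp))
  have hP : ∀ p q U U', P (p ⊗ₜ U) (q ⊗ₜ U') = S q * S p * B U U' := by
    intros; simp [P]
  -- first evaluation
  have e1 : ∀ t t' : H x ⊗[k] H 1,
      P (TensorProduct.map LinearMap.id (comul h').toLinearMap t)
        (TensorProduct.map LinearMap.id (comul h').toLinearMap t') =
      S (TensorProduct.rid k _ (TensorProduct.map LinearMap.id counit.toLinearMap t')) *
      S (TensorProduct.rid k _ (TensorProduct.map LinearMap.id counit.toLinearMap t)) := by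
    intro t t'
    induction t with
    | zero => simp
    | add t₁ t₂ h₁ h₂ => simp only [map_add, LinearMap.add_apply, h₁, h₂, mul_add]
    | tmul p c =>
      induction t' with
      | zero => simp
      | add t₁ t₂ h₁ h₂ => simp only [map_add, h₁, h₂, add_mul]
      | tmul q d =>
        simp only [TensorProduct.map_tmul, LinearMap.id_coe, id_eq, AlgHom.toLinearMap_apply, hP,
          key1, TensorProduct.rid_tmul, map_smul]
        rw [Algebra.algebraMap_eq_smul_one]
        simp [smul_smul]
  -- second evaluation
  have e2' : ∀ (T T' : H x ⊗[k] H y) (v v' : H x),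
      P (TensorProduct.assoc k _ _ _ (T ⊗ₜ v)) (TensorProduct.assoc k _ _ _ (T' ⊗ₜ v')) =
      TensorProduct.lift (LinearMap.mk₂ k (fun (q : H x) (u' : H y) =>
        S q * LinearMap.mul' k (H y) (TensorProduct.map S LinearMap.id T) * u')
        (by intros; simp [add_mul]) (by intros; simp)
            (by intros; simp [mul_add]) (by intros; simp)) T' * S (v * v') := by
    intro T T' v v'
    induction T with
    | zero =>
      simp only [TensorProduct.zero_tmul, map_zero, LinearMap.zero_apply]
      induction T' with
      | zero => simp
      | add t₁ t₂ h₁ h₂ => rw [map_add, add_mul, ← h₁, ← h₂, add_zero]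
      | tmul q u' => simp
    | add t₁ t₂ h₁ h₂ =>
      simp only [TensorProduct.add_tmul, map_add, LinearMap.add_apply, h₁, h₂]
      rw [← add_mul]
      congr 1
      clear h₁ h₂
      induction T' with
      | zero => simp
      | add s₁ s₂ h₁ h₂ =>
        simp only [map_add, ← h₁, ← h₂]; abel
      | tmul q u' => simp [mul_add, add_mul]
    | tmul p u =>
      induction T' with
      | zero => simp
      | add t₁ t₂ h₁ h₂ => simp only [TensorProduct.add_tmul, map_add, h₁, h₂, add_mul]
      | tmul q u' => simp [hP, hB, mul_assoc]
  have e2 : ∀ t t' : H 1 ⊗[k] H x,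
      P (TensorProduct.assoc k _ _ _ (TensorProduct.map (comul h).toLinearMap LinearMap.id t))
        (TensorProduct.assoc k _ _ _ (TensorProduct.map (comul h).toLinearMap LinearMap.id t')) =
      S (TensorProduct.lid k _ (TensorProduct.map counit.toLinearMap LinearMap.id t) *
        TensorProduct.lid k _ (TensorProduct.map counit.toLinearMap LinearMap.id t')) := by
    intro t t'
    induction t with
    | zero => simp
    | add t₁ t₂ h₁ h₂ => simp only [map_add, LinearMap.add_apply, h₁, h₂, add_mul]
    | tmul c v =>
      induction t' with
      | zero => simp
      | add t₁ t₂ h₁ h₂ => simp only [map_add, h₁, h₂, mul_add]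
      | tmul d v' =>
        simp only [TensorProduct.map_tmul, LinearMap.id_coe, id_eq, AlgHom.toLinearMap_apply, e2']
        have hl := antipode_left (k := k) (H := H) h c
        have hr := antipode_left (k := k) (H := H) h d
        rw [hl]
        have : ∀ T' : H x ⊗[k] H y, TensorProduct.lift (LinearMap.mk₂ k
            (fun (q : H x) (u' : H y) => S q * algebraMap k (H y) (counit c) * u')
            (by intros; simp [add_mul]) (by intros; simp)
            (by intros; simp [mul_add]) (by intros; simp)) T' =
            algebraMap k (H y) (counit c) *
              LinearMap.mul' k (H y) (TensorProduct.map S LinearMap.id T') := by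
          intro T'
          induction T' with
          | zero => simp
          | add t₁ t₂ h₁ h₂ => simp only [map_add, h₁, h₂, mul_add]
          | tmul q u' =>
            simp only [TensorProduct.lift.tmul, LinearMap.mk₂_apply, TensorProduct.map_tmul,
              LinearMap.mul'_apply, LinearMap.id_coe, id_eq]
            rw [← Algebra.commutes (counit c) (S q), mul_assoc]
        rw [this, hr]
        simp only [TensorProduct.lid_tmul, Algebra.algebraMap_eq_smul_one, smul_mul_assoc, one_mul,
          mul_smul_comm, map_smul]
  have c1 := coassoc (k := k) (H := H) h (one_mul x) h' (mul_one x)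
  have := e2 (comul (one_mul x) a) (comul (one_mul x) b)
  rw [c1, c1, e1, counit_right, counit_right, counit_left, counit_left] at this
  exact this.symm

end Antipode

end HopfGroupCoalgebra

open HopfGroupCoalgebra

section Modules

variable (k H) in
/-- A finite-dimensional module over the family of algebras `H x`, `x ∈ G`: a finite direct sum
`V = ⨁ V_x` with `V_x` an `H x`-module. It is encoded by the (non-unital) actions
`act x : H x → End V` of all the `H x` on the whole space `V` (with `H x` acting by zero on
`V_y` for `y ≠ x`), so that the `act x 1` are orthogonal idempotents, the projections onto the
`V_x`, finitely many of which sum up to the identity. -/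
structure HMod where
  carrier : Type u
  [addCommGroup : AddCommGroup carrier]
  [module : Module k carrier]
  [finiteDimensional : FiniteDimensional k carrier]
  act (x : G) : H x →ₗ[k] Module.End k carrier
  act_mul (x : G) (a b : H x) : act x (a * b) = act x a * act x b
  act_ne {x y : G} (h : x ≠ y) (a : H x) (b : H y) : act x a * act y b = 0
  exists_supp : ∃ s : Finset G, ∑ x ∈ s, act x 1 = 1

namespace HMod

instance : CoeSort (HMod k H) (Type u) := ⟨HMod.carrier⟩

attribute [instance] addCommGroup module finiteDimensional

section Basic

variable (V W : HMod k H)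

/-- A finite set of degrees outside of which `V` vanishes. -/
def supp : Finset G := V.exists_supp.choose

theorem sum_supp : ∑ x ∈ V.supp, V.act x 1 = 1 := V.exists_supp.choose_spec

/-- `v ∈ V_x`. -/
def Homog (x : G) (v : V) : Prop := V.act x 1 v = v

variable {V W}

theorem homog_act (x : G) (a : H x) (v : V) : V.Homog x (V.act x a v) := by
  rw [Homog, ← Module.End.mul_apply, ← V.act_mul, one_mul]

theorem Homog.act_of_ne {x y : G} {v : V} (hv : V.Homog x v) (h : y ≠ x) (a : H y) :
    V.act y a v = 0 := by
  rw [← hv, ← Module.End.mul_apply, V.act_ne h, LinearMap.zero_apply]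

theorem sum_act_one (v : V) : ∑ x ∈ V.supp, V.act x 1 v = v := by
  have := congrArg (fun f : Module.End k V => f v) V.sum_supp
  simpa using this

theorem Homog.eq_zero {x : G} {v : V} (hv : V.Homog x v) (h : x ∉ V.supp) : v = 0 := by
  rw [← sum_act_one v]
  exact Finset.sum_eq_zero fun y hy => hv.act_of_ne (fun e => h (e ▸ hy)) 1

theorem act_one_mul (x : G) (a : H x) : V.act x 1 * V.act x a = V.act x a := by
  rw [← V.act_mul, one_mul]

theorem act_eq_zero {x : G} (h : x ∉ V.supp) (a : H x) : V.act x a = 0 := by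
  ext v
  exact (homog_act x a v).eq_zero h

theorem ext_homog {M : Type*} [AddCommGroup M] [Module k M] {f g : V →ₗ[k] M}
    (h : ∀ x v, V.Homog x v → f v = g v) : f = g := by
  ext v
  rw [← sum_act_one v, map_sum, map_sum]
  exact Finset.sum_congr rfl fun x _ => h x _ (homog_act x 1 v)

theorem ext_homog₂ {M : Type*} [AddCommGroup M] [Module k M] {f g : V ⊗[k] W →ₗ[k] M}
    (h : ∀ x y v w, V.Homog x v → W.Homog y w → f (v ⊗ₜ w) = g (v ⊗ₜ w)) : f = g := by
  apply TensorProduct.ext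
  refine ext_homog fun x v hv => ?_
  refine ext_homog fun y w hw => ?_
  exact h x y v w hv hw

variable (V W)

/-- The orbit map `a ↦ a · v`. -/
abbrev orb (x : G) (v : V) : H x →ₗ[k] V := (V.act x).flip v

/-- The action of `H x ⊗ H y` on `V ⊗ W`. -/
def act₂ (x y : G) : H x ⊗[k] H y →ₗ[k] Module.End k (V ⊗[k] W) :=
  TensorProduct.homTensorHomMap (RingHom.id k) V W V W ∘ₗ TensorProduct.map (V.act x) (W.act y)

end Basic

/-- Morphisms of `H`-modules: linear maps commuting with the actions of all the `H x`. -/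
@[ext]
structure Hom (V W : HMod k H) where
  hom : V →ₗ[k] W
  comm (x : G) (a : H x) (v : V) : hom (V.act x a v) = W.act x a (hom v)

instance : Category (HMod k H) where
  Hom := Hom
  id V := ⟨LinearMap.id, fun _ _ _ => rfl⟩
  comp f g := ⟨g.hom ∘ₗ f.hom, fun x a v => by simp [f.comm, g.comm]⟩

theorem hom_ext {V W : HMod k H} {f g : V ⟶ W} (h : Hom.hom f = Hom.hom g) : f = g :=
  Hom.ext h

@[simp] theorem id_hom (V : HMod k H) : Hom.hom (𝟙 V) = LinearMap.id := rfl

@[simp] theorem comp_hom {U V W : HMod k H} (f : U ⟶ V) (g : V ⟶ W) :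
    Hom.hom (f ≫ g) = Hom.hom g ∘ₗ Hom.hom f := rfl

section Linear

variable {V W : HMod k H}

instance : Add (V ⟶ W) := ⟨fun f g => ⟨Hom.hom f + Hom.hom g, fun x a v => by simp [Hom.comm]⟩⟩

instance : Zero (V ⟶ W) := ⟨⟨0, fun x a v => by simp⟩⟩

instance : Neg (V ⟶ W) := ⟨fun f => ⟨-Hom.hom f, fun x a v => by simp [Hom.comm]⟩⟩

instance : AddCommGroup (V ⟶ W) where
  add_assoc _ _ _ := hom_ext (add_assoc _ _ _)
  zero_add _ := hom_ext (zero_add _)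
  add_zero _ := hom_ext (add_zero _)
  add_comm _ _ := hom_ext (add_comm _ _)
  neg_add_cancel _ := hom_ext (neg_add_cancel _)
  nsmul := nsmulRec
  zsmul := zsmulRec

@[simp] theorem add_hom (f g : V ⟶ W) : Hom.hom (f + g) = Hom.hom f + Hom.hom g := rfl

@[simp] theorem zero_hom : Hom.hom (0 : V ⟶ W) = 0 := rfl

instance : Module k (V ⟶ W) where
  smul c f := ⟨c • Hom.hom f, fun x a v => by simp [Hom.comm]⟩
  one_smul _ := hom_ext (one_smul _ _)
  mul_smul _ _ _ := hom_ext (mul_smul _ _ _)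
  smul_zero _ := hom_ext (smul_zero _)
  smul_add _ _ _ := hom_ext (smul_add _ _ _)
  add_smul _ _ _ := hom_ext (add_smul _ _ _)
  zero_smul _ := hom_ext (zero_smul _ _)

@[simp] theorem smul_hom (c : k) (f : V ⟶ W) : Hom.hom (c • f) = c • Hom.hom f := rfl

instance : Preadditive (HMod k H) where
  add_comp _ _ _ _ _ _ := hom_ext (LinearMap.comp_add _ _ _)
  comp_add _ _ _ _ _ _ := hom_ext (LinearMap.add_comp _ _ _)

instance : Linear k (HMod k H) where
  smul_comp _ _ _ _ _ _ := hom_ext (LinearMap.comp_smul _ _ _)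
  comp_smul _ _ _ _ _ _ := hom_ext (LinearMap.smul_comp _ _ _)

/-- An isomorphism from a bijective morphism. -/
def isoOfEquiv {V W : HMod k H} (e : V ≃ₗ[k] W)
    (h : ∀ (x : G) (a : H x) (v : V), e (V.act x a v) = W.act x a (e v)) : V ≅ W where
  hom := ⟨e.toLinearMap, h⟩
  inv := ⟨e.symm.toLinearMap, fun x a w => by
    apply e.injective
    simp [h]⟩
  hom_inv_id := hom_ext (by ext; simp)
  inv_hom_id := hom_ext (by ext; simp)

end Linear

section Tensor

variable (V W : HMod k H)

variable {V W} in
theorem act₂_apply (x y : G) (t : H x ⊗[k] H y) (v : V) (w : W) :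
    act₂ V W x y t (v ⊗ₜ w) = TensorProduct.map (V.orb x v) (W.orb y w) t := by
  induction t with
  | zero => simp
  | add t₁ t₂ h₁ h₂ => simp only [map_add, LinearMap.add_apply, h₁, h₂]
  | tmul a b => simp [act₂]

theorem act₂_mul (x y : G) (t t' : H x ⊗[k] H y) :
    act₂ V W x y (t * t') = act₂ V W x y t * act₂ V W x y t' := by
  induction t with
  | zero => simp
  | add t₁ t₂ h₁ h₂ => simp only [add_mul, map_add, h₁, h₂]
  | tmul a b =>
    induction t' with
    | zero => simp
    | add t₁ t₂ h₁ h₂ => simp only [mul_add, map_add, h₁, h₂]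
    | tmul c d =>
      simp only [Algebra.TensorProduct.tmul_mul_tmul, act₂, LinearMap.comp_apply,
        TensorProduct.map_tmul, act_mul]
      ext; simp

theorem act₂_ne {x y x' y' : G} (h : ¬ (x = x' ∧ y = y')) (t : H x ⊗[k] H y)
    (t' : H x' ⊗[k] H y') : act₂ V W x y t * act₂ V W x' y' t' = 0 := by
  induction t with
  | zero => simp
  | add t₁ t₂ h₁ h₂ => simp only [add_mul, map_add, h₁, h₂, add_zero]
  | tmul a b =>
    induction t' with
    | zero => simp
    | add t₁ t₂ h₁ h₂ => simp only [mul_add, map_add, h₁, h₂, add_zero]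
    | tmul c d =>
      apply TensorProduct.ext'
      intro v w
      have e1 : V.act x a (V.act x' c v) = (V.act x a * V.act x' c) v := rfl
      have e2 : W.act y b (W.act y' d w) = (W.act y b * W.act y' d) w := rfl
      simp only [act₂, LinearMap.comp_apply, TensorProduct.map_tmul,
        TensorProduct.homTensorHomMap_apply, Module.End.mul_apply, LinearMap.zero_apply,
        TensorProduct.map_tmul]
      rw [e1, e2]
      by_cases hx : x = x'
      · rw [W.act_ne (fun hy => h ⟨hx, hy⟩)]; simp
      · rw [V.act_ne hx]; simp

variable [HopfGroupCoalgebra k H]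

/-- The action of `H z` on `V ⊗ W`, through `Δ_{x,y} : H z → H x ⊗ H y` on the summands
`V_x ⊗ W_y` with `x * y = z`. -/
def tensorAct (z : G) : H z →ₗ[k] Module.End k (V ⊗[k] W) :=
  ∑ x ∈ V.supp, act₂ V W x (x⁻¹ * z) ∘ₗ (comul (mul_inv_cancel_left x z)).toLinearMap

theorem tensorAct_apply (z : G) (a : H z) : tensorAct V W z a =
    ∑ x ∈ V.supp, act₂ V W x (x⁻¹ * z) (comul (mul_inv_cancel_left x z) a) := by
  simp [tensorAct]

variable {V W}

theorem tensorAct_of_eq {x y z : G} (h : x * y = z) {v : V} {w : W} (hv : V.Homog x v)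
    (a : H z) : tensorAct V W z a (v ⊗ₜ w) =
      TensorProduct.map (V.orb x v) (W.orb y w) (comul h a) := by
  obtain rfl : y = x⁻¹ * z := by rw [← h, inv_mul_cancel_left]
  rw [tensorAct_apply, LinearMap.sum_apply]
  by_cases hx : x ∈ V.supp
  · rw [Finset.sum_eq_single x _ (fun h => absurd hx h), act₂_apply]
    intro x' _ hne
    have : V.orb x' v = 0 := by ext b; exact hv.act_of_ne hne b
    rw [act₂_apply, this, TensorProduct.map_zero_left, LinearMap.zero_apply]
  · obtain rfl := hv.eq_zero hx
    simp

theorem tensorAct_of_ne {x y z : G} (h : x * y ≠ z) {v : V} {w : W} (hv : V.Homog x v)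
    (hw : W.Homog y w) (a : H z) : tensorAct V W z a (v ⊗ₜ w) = 0 := by
  rw [tensorAct_of_eq (mul_inv_cancel_left x z) hv a]
  have : W.orb (x⁻¹ * z) w = 0 := by
    ext b
    exact hw.act_of_ne (fun e => h (by rw [← e, mul_inv_cancel_left])) b
  rw [this, TensorProduct.map_zero_right, LinearMap.zero_apply]

variable (V W)

open Classical in
/-- The tensor product of `H`-modules. -/
abbrev tensor : HMod k H where
  carrier := V ⊗[k] W
  act := tensorAct V W
  act_mul z a b := by
    simp only [tensorAct_apply, map_mul, act₂_mul, Finset.sum_mul_sum]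
    refine Finset.sum_congr rfl fun x hx => ?_
    rw [Finset.sum_eq_single x _ (fun h => absurd hx h)]
    intro x' _ hne
    exact act₂_ne V W (fun e => hne e.1.symm) _ _
  act_ne {z z'} hne a b := by
    simp only [tensorAct_apply, Finset.sum_mul_sum]
    refine Finset.sum_eq_zero fun x _ => Finset.sum_eq_zero fun x' _ => ?_
    refine act₂_ne V W (fun e => hne ?_) _ _
    obtain ⟨rfl, e⟩ := e
    exact mul_left_cancel e
  exists_supp := by
    refine ⟨(V.supp ×ˢ W.supp).image fun p => p.1 * p.2, ?_⟩
    refine ext_homog₂ fun x y v w hv hw => ?_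
    rw [LinearMap.sum_apply, Module.End.one_apply]
    by_cases hx : x ∈ V.supp
    · by_cases hy : y ∈ W.supp
      · rw [Finset.sum_eq_single (x * y)]
        · rw [tensorAct_of_eq rfl hv, map_one, Algebra.TensorProduct.one_def,
            TensorProduct.map_tmul]
          change V.act x 1 v ⊗ₜ W.act y 1 w = _
          rw [hv, hw]
        · intro z _ hz
          exact tensorAct_of_ne hz.symm hv hw 1
        · intro h
          exact absurd (Finset.mem_image.2 ⟨(x, y), Finset.mem_product.2 ⟨hx, hy⟩, rfl⟩) h
      · rw [hw.eq_zero hy]; simp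
    · rw [hv.eq_zero hx]; simp

open Classical in
variable (k H) in
/-- The action of `H x` on the trivial module: by `ε` if `x = 1`, and zero otherwise. -/
def unitAct (x : G) : H x →ₗ[k] Module.End k k :=
  if h : x = 1 then
    (Algebra.lmul k k).toLinearMap ∘ₗ
      (h.symm ▸ (counit : H 1 →ₐ[k] k) : H x →ₐ[k] k).toLinearMap
  else 0

theorem unitAct_one (a : H 1) (c : k) : unitAct k H 1 a c = counit a * c := by
  rw [unitAct, dif_pos rfl]
  rfl

theorem unitAct_ne {x : G} (h : x ≠ 1) (a : H x) : unitAct k H x a = 0 := by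
  rw [unitAct, dif_neg h, LinearMap.zero_apply]

variable (k H) in
/-- The trivial module `k`, in degree `1`, with action `ε`. -/
abbrev unit : HMod k H where
  carrier := k
  act := unitAct k H
  act_mul x a b := by
    by_cases h : x = 1
    · subst h
      ext
      simp [unitAct_one]
    · simp [unitAct_ne h]
  act_ne {x y} hxy a b := by
    by_cases h : x = 1
    · have : y ≠ 1 := fun e => hxy (h.trans e.symm)
      simp [unitAct_ne this]
    · simp [unitAct_ne h]
  exists_supp := ⟨{1}, by ext; simp [unitAct_one]⟩

theorem unit_homog (c : k) : (unit k H).Homog 1 c := by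
  change unitAct k H 1 1 c = c
  rw [unitAct_one, map_one, one_mul]

variable {V W}

theorem Homog.tmul {x y : G} {v : V} {w : W} (hv : V.Homog x v) (hw : W.Homog y w) :
    (tensor V W).Homog (x * y) (v ⊗ₜ[k] w) := by
  change tensorAct V W (x * y) 1 (v ⊗ₜ w) = _
  rw [tensorAct_of_eq rfl hv, map_one, Algebra.TensorProduct.one_def, TensorProduct.map_tmul]
  change V.act x 1 v ⊗ₜ W.act y 1 w = _
  rw [hv, hw]

/-- To be a morphism can be checked on homogeneous elements. -/
def mkHom (f : V →ₗ[k] W)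
    (h : ∀ (x : G) (v : V), V.Homog x v → ∀ a : H x, f (V.act x a v) = W.act x a (f v)) :
    V ⟶ W where
  hom := f
  comm z a v := by
    have key : f ∘ₗ V.act z a = W.act z a ∘ₗ f := by
      refine ext_homog fun x v hv => ?_
      by_cases hx : z = x
      · subst hx; exact h z v hv a
      · have : W.Homog x (f v) := by rw [Homog, ← h x v hv, hv]
        rw [LinearMap.comp_apply, LinearMap.comp_apply, hv.act_of_ne hx, this.act_of_ne hx, map_zero]
    exact LinearMap.congr_fun key v

end Tensor

section Monoidal

variable [HopfGroupCoalgebra k H]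

theorem ext_homog₃ {U V W : HMod k H} {M : Type*} [AddCommGroup M] [Module k M]
    {f g : (U ⊗[k] V) ⊗[k] W →ₗ[k] M}
    (h : ∀ x y z u v w, U.Homog x u → V.Homog y v → W.Homog z w →
      f ((u ⊗ₜ v) ⊗ₜ w) = g ((u ⊗ₜ v) ⊗ₜ w)) : f = g := by
  apply TensorProduct.ext
  refine ext_homog₂ fun x y u v hu hv => ?_
  refine ext_homog fun z w hw => ?_
  exact h x y z u v w hu hv hw

theorem orb_tmul {V W : HMod k H} {x y z : G} (h : x * y = z) {v : V} {w : W}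
    (hv : V.Homog x v) : (tensor V W).orb z (v ⊗ₜ[k] w) =
      TensorProduct.map (V.orb x v) (W.orb y w) ∘ₗ (comul h).toLinearMap := by
  ext a
  exact tensorAct_of_eq h hv a

theorem assoc_comm (U V W : HMod k H) (z : G) (a : H z) (t : (U ⊗[k] V) ⊗[k] W) :
    TensorProduct.assoc k U V W ((tensor (tensor U V) W).act z a t) =
      (tensor U (tensor V W)).act z a (TensorProduct.assoc k U V W t) := by
  have key : (TensorProduct.assoc k U V W).toLinearMap ∘ₗ tensorAct (tensor U V) W z a =
      tensorAct U (tensor V W) z a ∘ₗ (TensorProduct.assoc k U V W).toLinearMap := by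
    refine ext_homog₃ fun p q r u v w hu hv hw => ?_
    simp only [LinearMap.comp_apply, LinearEquiv.coe_coe, TensorProduct.assoc_tmul]
    by_cases h : p * q * r = z
    · have h' : p * (q * r) = z := by rw [← mul_assoc, h]
      rw [tensorAct_of_eq (V := tensor U V) h (hu.tmul hv)]
      erw [tensorAct_of_eq (W := tensor V W) h' hu]
      rw [orb_tmul rfl hu]
      erw [orb_tmul rfl hv]
      have c := coassoc (k := k) (H := H) (rfl : p * q = p * q) h (rfl : q * r = q * r) h' a
      have e1 : TensorProduct.map
          (TensorProduct.map (U.orb p u) (V.orb q v) ∘ₗ (comul (rfl : p * q = p * q)).toLinearMap)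
          (W.orb r w) (comul h a) = TensorProduct.map
            (TensorProduct.map (U.orb p u) (V.orb q v)) (W.orb r w)
            (TensorProduct.map (comul (rfl : p * q = p * q)).toLinearMap LinearMap.id
              (comul h a)) := by
        rw [← LinearMap.comp_apply, ← TensorProduct.map_comp, LinearMap.comp_id]
      have e2 : TensorProduct.map (U.orb p u)
          (TensorProduct.map (V.orb q v) (W.orb r w) ∘ₗ
            (comul (rfl : q * r = q * r)).toLinearMap) (comul h' a) =
          TensorProduct.map (U.orb p u) (TensorProduct.map (V.orb q v) (W.orb r w))
            (TensorProduct.map LinearMap.id (comul (rfl : q * r = q * r)).toLinearMap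
              (comul h' a)) := by
        rw [← LinearMap.comp_apply, ← TensorProduct.map_comp, LinearMap.comp_id]
      have e3 : ∀ s : (H p ⊗[k] H q) ⊗[k] H r, TensorProduct.assoc k U V W
          (TensorProduct.map (TensorProduct.map (U.orb p u) (V.orb q v)) (W.orb r w) s) =
          TensorProduct.map (U.orb p u) (TensorProduct.map (V.orb q v) (W.orb r w))
            (TensorProduct.assoc k _ _ _ s) := by
        intro s
        rw [← LinearEquiv.coe_coe, ← LinearEquiv.coe_coe, ← LinearMap.comp_apply,
          ← LinearMap.comp_apply, TensorProduct.map_map_comp_assoc_eq]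
      exact (congrArg _ e1).trans ((e3 _).trans ((congrArg _ c).trans e2.symm))
    · rw [tensorAct_of_ne (V := tensor U V) h (hu.tmul hv) hw, map_zero]
      exact (tensorAct_of_ne (W := tensor V W) (fun e => h (by rw [mul_assoc, e])) hu
        (hv.tmul hw) a).symm
  exact LinearMap.congr_fun key t

theorem lid_comm (V : HMod k H) (z : G) (a : H z) (t : k ⊗[k] V) :
    TensorProduct.lid k V ((tensor (unit k H) V).act z a t) =
      V.act z a (TensorProduct.lid k V t) := by
  have key : (TensorProduct.lid k V).toLinearMap ∘ₗ tensorAct (unit k H) V z a =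
      V.act z a ∘ₗ (TensorProduct.lid k V).toLinearMap := by
    apply TensorProduct.ext'
    intro c v
    have e : TensorProduct.map ((unit k H).orb 1 c) (V.orb z v) (comul (one_mul z) a) =
        c ⊗ₜ[k] V.act z a v := by
      have e1 : ∀ s : H 1 ⊗[k] H z, TensorProduct.lid k V
          (TensorProduct.map ((unit k H).orb 1 c) (V.orb z v) s) = c • V.act z (TensorProduct.lid k _
          (TensorProduct.map (counit (k := k) (H := H)).toLinearMap LinearMap.id s)) v := by
        intro s
        induction s with
        | zero => simp
        | add s₁ s₂ h₁ h₂ => simp only [map_add, h₁, h₂, LinearMap.add_apply, smul_add]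
        | tmul b d =>
          change unitAct k H 1 b c • V.act z d v = _
          simp [unitAct_one, mul_smul, smul_comm c]
      apply (TensorProduct.lid k V).injective
      refine (e1 _).trans ?_
      rw [counit_left, TensorProduct.lid_tmul]
    have := tensorAct_of_eq (V := unit k H) (W := V) (one_mul z) (unit_homog c) (w := v) a
    simp only [LinearMap.comp_apply, LinearEquiv.coe_coe, TensorProduct.lid_tmul, map_smul]
    refine (congrArg _ (this.trans e)).trans ?_
    simp
  exact LinearMap.congr_fun key t

theorem rid_comm (V : HMod k H) (z : G) (a : H z) (t : V ⊗[k] k) :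
    TensorProduct.rid k V ((tensor V (unit k H)).act z a t) =
      V.act z a (TensorProduct.rid k V t) := by
  have key : (TensorProduct.rid k V).toLinearMap ∘ₗ tensorAct V (unit k H) z a =
      V.act z a ∘ₗ (TensorProduct.rid k V).toLinearMap := by
    apply TensorProduct.ext
    refine ext_homog fun x v hv => ?_
    apply LinearMap.ext
    intro c
    change TensorProduct.rid k V (tensorAct V (unit k H) z a (v ⊗ₜ c)) =
      V.act z a (TensorProduct.rid k V (v ⊗ₜ c))
    rw [TensorProduct.rid_tmul, map_smul]
    by_cases hx : x = z
    · subst hx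
      have e1 : ∀ s : H x ⊗[k] H 1, TensorProduct.rid k V
          (TensorProduct.map (V.orb x v) ((unit k H).orb 1 c) s) = c • V.act x (TensorProduct.rid k _
          (TensorProduct.map LinearMap.id (counit (k := k) (H := H)).toLinearMap s)) v := by
        intro s
        induction s with
        | zero => simp
        | add s₁ s₂ h₁ h₂ => simp only [map_add, h₁, h₂, LinearMap.add_apply, smul_add]
        | tmul b d =>
          change unitAct k H 1 d c • V.act x b v = _
          simp [unitAct_one, mul_smul, smul_comm c]
      have := tensorAct_of_eq (V := V) (W := unit k H) (mul_one x) hv (w := c) a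
      refine (congrArg _ this).trans ((e1 _).trans ?_)
      rw [counit_right]
    · have : tensorAct V (unit k H) z a (v ⊗ₜ[k] c) = 0 :=
        tensorAct_of_ne (V := V) (W := unit k H) (by rwa [mul_one]) hv (unit_homog c) a
      refine (congrArg _ this).trans ?_
      rw [hv.act_of_ne (Ne.symm hx), map_zero, smul_zero]
  exact LinearMap.congr_fun key t

/-- The tensor product of morphisms. -/
def tensorMap {V V' W W' : HMod k H} (f : V ⟶ V') (g : W ⟶ W') : tensor V W ⟶ tensor V' W' where
  hom := TensorProduct.map (Hom.hom f) (Hom.hom g)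
  comm z a t := by
    have key : TensorProduct.map (Hom.hom f) (Hom.hom g) ∘ₗ tensorAct V W z a =
        tensorAct V' W' z a ∘ₗ TensorProduct.map (Hom.hom f) (Hom.hom g) := by
      refine ext_homog₂ fun x y v w hv hw => ?_
      have hv' : V'.Homog x (Hom.hom f v) := by rw [Homog, ← Hom.comm f, hv]
      simp only [LinearMap.comp_apply, TensorProduct.map_tmul]
      rw [tensorAct_of_eq (mul_inv_cancel_left x z) hv,
        tensorAct_of_eq (mul_inv_cancel_left x z) hv', ← LinearMap.comp_apply,
        ← TensorProduct.map_comp]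
      congr 2
      · ext b; exact Hom.comm f _ _ _
      · ext b; exact Hom.comm g _ _ _
    exact LinearMap.congr_fun key t

def associatorIso (U V W : HMod k H) : tensor (tensor U V) W ≅ tensor U (tensor V W) :=
  isoOfEquiv (TensorProduct.assoc k U V W) (assoc_comm U V W)

def leftUnitorIso (V : HMod k H) : tensor (unit k H) V ≅ V :=
  isoOfEquiv (TensorProduct.lid k V) (lid_comm V)

def rightUnitorIso (V : HMod k H) : tensor V (unit k H) ≅ V :=
  isoOfEquiv (V := tensor V (unit k H)) (TensorProduct.rid k V) (rid_comm V)

/-- The monoidal structure of the category of `H`-modules. -/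
instance : MonoidalCategoryStruct (HMod k H) where
  tensorObj V W := tensor V W
  tensorUnit := unit k H
  tensorHom := tensorMap
  whiskerLeft V _ _ g := tensorMap (𝟙 V) g
  whiskerRight f W := tensorMap f (𝟙 W)
  associator U V W := associatorIso U V W
  leftUnitor V := leftUnitorIso V
  rightUnitor := by exact fun V => rightUnitorIso V

instance : MonoidalCategory (HMod k H) where
  tensorHom_def _ _ := hom_ext (TensorProduct.ext' fun _ _ => rfl)
  id_tensorHom_id _ _ := hom_ext (TensorProduct.ext' fun _ _ => rfl)
  tensorHom_comp_tensorHom _ _ _ _ := hom_ext (TensorProduct.ext' fun _ _ => rfl)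
  whiskerLeft_id _ _ := hom_ext (TensorProduct.ext' fun _ _ => rfl)
  id_whiskerRight _ _ := hom_ext (TensorProduct.ext' fun _ _ => rfl)
  associator_naturality _ _ _ := hom_ext (TensorProduct.ext_threefold fun _ _ _ => rfl)
  leftUnitor_naturality {V W} f := hom_ext (TensorProduct.ext' fun c v =>
    ((Hom.hom f).map_smul c v).symm)
  rightUnitor_naturality {V W} f := hom_ext (TensorProduct.ext' fun v c =>
    ((Hom.hom f).map_smul c v).symm)
  pentagon U V W X := by
    apply hom_ext
    change _ = (_ : (((U ⊗[k] V) ⊗[k] W) ⊗[k] X) →ₗ[k] U ⊗[k] (V ⊗[k] (W ⊗[k] X)))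
    exact TensorProduct.ext_fourfold fun _ _ _ _ => rfl
  triangle V W := by
    apply hom_ext
    change _ = (_ : ((V ⊗[k] k) ⊗[k] W) →ₗ[k] V ⊗[k] W)
    refine TensorProduct.ext_threefold fun v c w => ?_
    exact (TensorProduct.smul_tmul c v w).symm

end Monoidal

section Dual

variable [HopfGroupCoalgebra k H]

/-- The action on the dual space: `(a · f) v = f (S_x a · v)` for `a ∈ H x`. -/
def dualAct (V : HMod k H) (x : G) : H x →ₗ[k] Module.End k (Module.Dual k V) :=
  Module.Dual.transpose (R := k) ∘ₗ V.act x⁻¹ ∘ₗ antipode (k := k) (mul_inv_cancel x)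

theorem dualAct_apply (V : HMod k H) {x y : G} (h : x * y = 1) (a : H x) (f : Module.Dual k V) :
    dualAct V x a f = f ∘ₗ V.act y (antipode (k := k) h a) := by
  obtain rfl : y = x⁻¹ := eq_inv_of_mul_eq_one_right h
  rfl

open Classical in
/-- The dual `V* = Hom_k(V, k)` of an `H`-module; the dual of a module of degree `x` has
degree `x⁻¹`. -/
abbrev dual (V : HMod k H) : HMod k H where
  carrier := Module.Dual k V
  act := dualAct V
  act_mul x a b := by
    ext f v
    simp only [Module.End.mul_apply, dualAct_apply V (mul_inv_cancel x), antipode_mul, act_mul]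
    rfl
  act_ne {x y} hxy a b := by
    ext f v
    simp only [Module.End.mul_apply, dualAct_apply V (mul_inv_cancel x),
      dualAct_apply V (mul_inv_cancel y), LinearMap.comp_apply, LinearMap.zero_apply]
    rw [← Module.End.mul_apply, V.act_ne fun e => hxy (inv_injective e).symm]
    simp
  exists_supp := by
    refine ⟨V.supp.image fun x => x⁻¹, ?_⟩
    ext f v
    rw [Finset.sum_image fun _ _ _ _ e => inv_injective e]
    simp only [LinearMap.sum_apply, dualAct_apply V (inv_mul_cancel _), antipode_one,
      LinearMap.comp_apply, Module.End.one_apply]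
    rw [← map_sum, sum_act_one]

theorem Homog.dual_apply {V : HMod k H} {x y : G} {f : Module.Dual k V} {v : V}
    (hf : (dual V).Homog x f) (hv : V.Homog y v) (h : x * y ≠ 1) : f v = 0 := by
  have h' : dualAct V x 1 f = f := hf
  rw [dualAct_apply V (mul_inv_cancel x)] at h'
  rw [← h', LinearMap.comp_apply, hv.act_of_ne, map_zero]
  rintro rfl
  exact h (mul_inv_cancel x)

/-- The evaluation `V* ⊗ V → k`, `f ⊗ v ↦ f v`. -/
def evHom (V : HMod k H) : tensor (dual V) V ⟶ unit k H where
  hom := contractLeft k V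
  comm z a t := by
    have key : contractLeft k V ∘ₗ tensorAct (dual V) V z a =
        unitAct k H z a ∘ₗ contractLeft k V := by
      refine ext_homog₂ fun p q f v hf hv => ?_
      simp only [LinearMap.comp_apply, contractLeft_apply]
      by_cases hpq : p * q = 1
      · by_cases hz : z = 1
        · subst hz
          rw [tensorAct_of_eq hpq hf, unitAct_one]
          have e : ∀ s : H p ⊗[k] H q, contractLeft k V
              (TensorProduct.map ((dual V).orb p f) (V.orb q v) s) =
              f (V.act q (LinearMap.mul' k (H q)
                (TensorProduct.map (antipode (k := k) hpq) LinearMap.id s)) v) := by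
            intro s
            induction s with
            | zero => simp
            | add s₁ s₂ h₁ h₂ => simp only [map_add, h₁, h₂, LinearMap.add_apply]
            | tmul b c =>
              change dualAct V p b f (V.act q c v) = _
              rw [dualAct_apply V hpq]
              simp [act_mul]
          rw [e, antipode_left, Algebra.algebraMap_eq_smul_one, map_smul, LinearMap.smul_apply,
            hv, map_smul, smul_eq_mul]
        · rw [tensorAct_of_ne (fun e => hz (by rw [← e, hpq])) hf hv, unitAct_ne hz]
          simp
      · rw [hf.dual_apply hv hpq, map_zero]
        by_cases hz : p * q = z
        · rw [tensorAct_of_eq hz hf]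
          generalize comul (k := k) hz a = s
          induction s with
          | zero => simp
          | add s₁ s₂ h₁ h₂ => simp only [map_add, h₁, h₂, add_zero]
          | tmul b c =>
            change dualAct V p b f (V.act q c v) = _
            exact ((dual V).homog_act p b f).dual_apply (homog_act q c v) hpq
        · rw [tensorAct_of_ne hz hf hv, map_zero]
    exact LinearMap.congr_fun key t

theorem map_transpose_coevaluation (V : HMod k H) (A B : Module.End k V) :
    TensorProduct.map A (Module.Dual.transpose (R := k) B) (coevaluation k V 1) =
      TensorProduct.map (A * B) LinearMap.id (coevaluation k V 1) := by
  have h : TensorProduct.map LinearMap.id (Module.Dual.transpose (R := k) B)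
      (coevaluation k V 1) = TensorProduct.map B LinearMap.id (coevaluation k V 1) := by
    rw [coevaluation_apply_one]
    set b := Module.Basis.ofVectorSpace k V
    simp only [map_sum, TensorProduct.map_tmul, LinearMap.id_apply]
    have e1 : ∀ i, Module.Dual.transpose (R := k) B (b.coord i) =
        ∑ j, b.coord i (B (b j)) • b.coord j := by
      intro i
      refine b.ext fun l => ?_
      classical
      simp [Module.Dual.transpose_apply, Finsupp.single_apply]
    have e2 : ∀ j, B (b j) = ∑ i, b.coord i (B (b j)) • b i := by
      intro j
      simp [b.sum_repr]
    simp only [e1, TensorProduct.tmul_sum, TensorProduct.tmul_smul]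
    rw [Finset.sum_comm]
    refine Finset.sum_congr rfl fun j _ => ?_
    conv_rhs => rw [e2 j, TensorProduct.sum_tmul]
    rfl
  have h1 : TensorProduct.map A (Module.Dual.transpose (R := k) B) =
      TensorProduct.map A LinearMap.id ∘ₗ
        TensorProduct.map LinearMap.id (Module.Dual.transpose (R := k) B) := by
    rw [← TensorProduct.map_comp, LinearMap.comp_id, LinearMap.id_comp]
  rw [h1, LinearMap.comp_apply, h, ← LinearMap.comp_apply, ← TensorProduct.map_comp]
  rfl

/-- The coevaluation `k → V ⊗ V*`, `1 ↦ ∑ v_i ⊗ v_i*`. -/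
def coevHom (V : HMod k H) : unit k H ⟶ tensor V (dual V) where
  hom := coevaluation k V
  comm z a c := by
    have key : coevaluation k V ∘ₗ unitAct k H z a =
        tensorAct V (dual V) z a ∘ₗ coevaluation k V := by
      apply LinearMap.ext_ring
      simp only [LinearMap.comp_apply]
      by_cases hz : z = 1
      · subst hz
        rw [unitAct_one, mul_one, tensorAct_apply, LinearMap.sum_apply]
        have e : ∀ x y (h : x * y = 1) (h' : y * x = 1) (s : H x ⊗[k] H y),
            act₂ V (dual V) x y s (coevaluation k V 1) = TensorProduct.map
              (V.act x (LinearMap.mul' k (H x) (TensorProduct.map LinearMap.id (antipode (k := k) h') s)))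
              LinearMap.id (coevaluation k V 1) := by
          intro x y h h' s
          induction s with
          | zero => simp
          | add s₁ s₂ h₁ h₂ =>
            simp only [map_add, h₁, h₂, LinearMap.add_apply, TensorProduct.map_add_left]
          | tmul b c =>
            have hc : dualAct V y c = Module.Dual.transpose (R := k) (V.act x (antipode (k := k) h' c)) := by
              ext f : 1
              exact dualAct_apply V h' c f
            simp only [TensorProduct.map_tmul, LinearMap.mul'_apply, LinearMap.id_apply, act_mul]
            rw [← map_transpose_coevaluation, ← hc]
            rfl
        have e' : ∀ x, act₂ V (dual V) x (x⁻¹ * 1) (comul (mul_inv_cancel_left x 1) a)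
            (coevaluation k V 1) = counit (k := k) a • TensorProduct.map (V.act x 1) LinearMap.id
              (coevaluation k V 1) := by
          intro x
          rw [e x (x⁻¹ * 1) (mul_inv_cancel_left x 1) (by simp), antipode_right,
            Algebra.algebraMap_eq_smul_one, map_smul, TensorProduct.map_smul_left,
            LinearMap.smul_apply]
        simp only [e', ← Finset.smul_sum]
        have e3 : ∑ x ∈ V.supp, TensorProduct.map (V.act x 1)
            (LinearMap.id : Module.Dual k V →ₗ[k] _) = LinearMap.id := by
          apply TensorProduct.ext'
          intro v f
          simp only [LinearMap.sum_apply, TensorProduct.map_tmul, LinearMap.id_apply]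
          rw [← TensorProduct.sum_tmul, sum_act_one]
        have e4 := LinearMap.congr_fun e3 (coevaluation k V 1)
        rw [LinearMap.sum_apply] at e4
        rw [e4, LinearMap.id_apply, ← map_smul, smul_eq_mul, mul_one]
      · rw [unitAct_ne hz, LinearMap.zero_apply, map_zero, tensorAct_apply, LinearMap.sum_apply]
        refine (Finset.sum_eq_zero fun x _ => ?_).symm
        generalize comul (k := k) (mul_inv_cancel_left x z) a = s
        induction s with
        | zero => simp
        | add s₁ s₂ h₁ h₂ => simp only [map_add, h₁, h₂, LinearMap.add_apply, add_zero]
        | tmul b c =>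
          refine (map_transpose_coevaluation V (V.act x b)
            (V.act (x⁻¹ * z)⁻¹ (antipode (k := k) (mul_inv_cancel _) c))).trans ?_
          rw [V.act_ne, TensorProduct.map_zero_left, LinearMap.zero_apply]
          intro e
          apply hz
          rw [mul_inv_rev, inv_inv] at e
          have : z⁻¹ * x = 1 * x := by rw [one_mul, ← e]
          simpa using mul_right_cancel this
    exact LinearMap.congr_fun key c

/-- `V*` is a right dual of `V`, by the usual evaluation and coevaluation. -/
@[reducible] def exactPairing (V : HMod k H) : ExactPairing V (dual V) where
  coevaluation' := coevHom V
  evaluation' := evHom V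
  coevaluation_evaluation' := hom_ext (contractLeft_assoc_coevaluation k V)
  evaluation_coevaluation' := hom_ext (contractLeft_assoc_coevaluation' k V)

end Dual

section Pivotal

variable [PivotalHopfGroupCoalgebra k H]

open PivotalHopfGroupCoalgebra

theorem pivot_mul_inv {x y : G} (h : x * y = 1) (h' : y * x = 1) :
    (pivot k x : H x) * antipode (k := k) h' (pivot k y) = 1 := by
  have := antipode_right (k := k) (H := H) h h' (pivot k 1)
  simpa [comul_pivot, counit_pivot] using this

theorem inv_mul_pivot {x y : G} (h' : y * x = 1) :
    antipode (k := k) h' (pivot k y) * (pivot k x : H x) = 1 := by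
  have := antipode_left (k := k) (H := H) h' (pivot k 1)
  simpa [comul_pivot, counit_pivot] using this

/-- The action of the pivot on `V`: by `g_x` on `V_x`. -/
def pivotAct (V : HMod k H) : Module.End k V := ∑ x ∈ V.supp, V.act x (pivot k x)

/-- The action of the inverse of the pivot on `V`: by `g_x⁻¹ = S_{x⁻¹} (g_{x⁻¹})` on `V_x`. -/
def pivotInvAct (V : HMod k H) : Module.End k V :=
  ∑ x ∈ V.supp, V.act x (antipode (k := k) (inv_mul_cancel x) (pivot k x⁻¹))

theorem sum_act_homog {V : HMod k H} (a : ∀ x, H x) {x : G} {v : V} (hv : V.Homog x v) :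
    (∑ x ∈ V.supp, V.act x (a x)) v = V.act x (a x) v := by
  rw [LinearMap.sum_apply]
  by_cases hx : x ∈ V.supp
  · exact Finset.sum_eq_single x (fun y _ hy => hv.act_of_ne hy _) (fun h => absurd hx h)
  · rw [hv.eq_zero hx]; simp

theorem pivotAct_homog {V : HMod k H} {x : G} {v : V} (hv : V.Homog x v) :
    pivotAct V v = V.act x (pivot k x) v := sum_act_homog (fun x => pivot k x) hv

theorem pivotInvAct_homog {V : HMod k H} {x : G} {v : V} (hv : V.Homog x v) :
    pivotInvAct V v = V.act x (antipode (k := k) (inv_mul_cancel x) (pivot k x⁻¹)) v :=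
  sum_act_homog (fun x => antipode (k := k) (inv_mul_cancel x) (pivot k x⁻¹)) hv

theorem pivotAct_pivotInvAct (V : HMod k H) : pivotAct V * pivotInvAct V = 1 := by
  refine ext_homog fun x v hv => ?_
  rw [Module.End.mul_apply, pivotInvAct_homog hv, pivotAct_homog (homog_act x _ v),
    ← Module.End.mul_apply, ← act_mul, pivot_mul_inv (mul_inv_cancel x), hv,
    Module.End.one_apply]

theorem pivotInvAct_pivotAct (V : HMod k H) : pivotInvAct V * pivotAct V = 1 := by
  refine ext_homog fun x v hv => ?_
  rw [Module.End.mul_apply, pivotAct_homog hv, pivotInvAct_homog (homog_act x _ v),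
    ← Module.End.mul_apply, ← act_mul, inv_mul_pivot, hv, Module.End.one_apply]

def pivotEquiv (V : HMod k H) : V ≃ₗ[k] V :=
  LinearEquiv.ofLinearMap (pivotAct V) (pivotInvAct V) (pivotAct_pivotInvAct V)
    (pivotInvAct_pivotAct V)

/-- The pivotal structure `V ≅ V**`, sending `v` to the functional `f ↦ f (g · v)`. -/
def pivotalIso (V : HMod k H) : V ≅ dual (dual V) :=
  isoOfEquiv (W := dual (dual V)) (pivotEquiv V ≪≫ₗ Module.evalEquiv k V) (by
    intro z a v
    have key : (Module.evalEquiv k V).toLinearMap ∘ₗ pivotAct V ∘ₗ V.act z a =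
        dualAct (dual V) z a ∘ₗ (Module.evalEquiv k V).toLinearMap ∘ₗ pivotAct V := by
      ext v f
      have h1 : z⁻¹ * z = 1 := inv_mul_cancel z
      have h2 : z * z⁻¹ = 1 := mul_inv_cancel z
      simp only [LinearMap.comp_apply, LinearEquiv.coe_coe, Module.evalEquiv_apply,
        Module.Dual.eval_apply]
      rw [dualAct_apply (dual V) h2, LinearMap.comp_apply, Module.Dual.eval_apply]
      change _ = dualAct V z⁻¹ (antipode (k := k) h2 a) f (pivotAct V v)
      rw [dualAct_apply V h1, antipode_antipode (k := k) h2 h1, LinearMap.comp_apply]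
      congr 1
      rw [pivotAct_homog (homog_act z a v), ← Module.End.mul_apply, ← act_mul, ← Module.End.mul_apply]
      have : V.act z (pivot k z * a * antipode (k := k) h1 (pivot k z⁻¹)) * pivotAct V =
          V.act z (pivot k z * a) := by
        refine ext_homog fun x v hv => ?_
        rw [Module.End.mul_apply, pivotAct_homog hv]
        by_cases hx : z = x
        · subst hx
          rw [← Module.End.mul_apply, ← act_mul, mul_assoc _ _ (pivot k z), inv_mul_pivot,
            mul_one]
        · rw [hv.act_of_ne hx, (homog_act x _ v).act_of_ne hx]
      rw [this]
    exact LinearMap.congr_fun key v)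

/-- The pivotal duality of the category of `H`-modules. The first pairing consists of the usual
`ev` and `coev`; the second one, `tev : V ⊗ V* → k` and `tcoev : k → V* ⊗ V`, is obtained from
the first one for `V*` through `V ≅ V**`, so that `tev (v ⊗ f) = f (g · v)` and
`tcoev 1 = ∑ v_i* ⊗ g⁻¹ · v_i` (see `tev_apply` and `tcoev_apply`). -/
instance twoSidedDuals : TwoSidedDuals (HMod k H) where
  dual := dual
  pairing V := exactPairing V
  pairing' V :=
    letI := exactPairing (dual V)
    exactPairingCongrRight (X := dual V) (pivotalIso V)

theorem ev_apply (V : HMod k H) (f : Module.Dual k V) (v : V) :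
    Hom.hom (TwoSidedDuals.ev V) (f ⊗ₜ[k] v) = f v :=
  contractLeft_apply f v

theorem coev_apply (V : HMod k H) : Hom.hom (TwoSidedDuals.coev V) (1 : k) =
    ∑ i, Module.Basis.ofVectorSpace k V i ⊗ₜ[k] (Module.Basis.ofVectorSpace k V).coord i :=
  coevaluation_apply_one k V

theorem tev_apply (V : HMod k H) (v : V) (f : Module.Dual k V) :
    Hom.hom (TwoSidedDuals.tev V) (v ⊗ₜ[k] f) = f (pivotAct V v) :=
  rfl

theorem coevaluation_eq_sum {W : Type u} [AddCommGroup W] [Module k W] [FiniteDimensional k W]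
    {ι : Type*} [Fintype ι] (c : Module.Basis ι k W) :
    coevaluation k W 1 = ∑ i, c i ⊗ₜ[k] c.coord i := by
  rw [coevaluation_apply_one]
  set b := Module.Basis.ofVectorSpace k W
  have e1 : ∀ j, b j = ∑ i, c.coord i (b j) • c i := by
    intro j
    simp [c.sum_repr]
  have e2 : ∀ i, c.coord i = ∑ j, c.coord i (b j) • b.coord j := by
    intro i
    refine b.ext fun l => ?_
    classical
    simp [Finsupp.single_apply]
  have e3 : ∀ i, c i ⊗ₜ[k] c.coord i = ∑ j, c.coord i (b j) • (c i ⊗ₜ[k] b.coord j) := by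
    intro i
    conv_lhs => rw [e2 i, TensorProduct.tmul_sum]
    simp only [TensorProduct.tmul_smul]
  have e4 : ∀ j, b j ⊗ₜ[k] b.coord j = ∑ i, c.coord i (b j) • (c i ⊗ₜ[k] b.coord j) := by
    intro j
    conv_lhs => rw [e1 j, TensorProduct.sum_tmul]
    rfl
  simp only [e3, e4]
  exact Finset.sum_comm

theorem tcoev_apply (V : HMod k H) : Hom.hom (TwoSidedDuals.tcoev V) (1 : k) =
    ∑ i, (Module.Basis.ofVectorSpace k V).coord i ⊗ₜ[k]
      pivotInvAct V (Module.Basis.ofVectorSpace k V i) := by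
  classical
  set b := Module.Basis.ofVectorSpace k V
  have h0 : Hom.hom (TwoSidedDuals.tcoev V) (1 : k) =
      TensorProduct.map LinearMap.id (Hom.hom (pivotalIso V).inv)
        (coevaluation k (Module.Dual k V) 1) := rfl
  rw [h0, coevaluation_eq_sum b.dualBasis, map_sum]
  refine Finset.sum_congr rfl fun i _ => ?_
  rw [TensorProduct.map_tmul, LinearMap.id_apply, Module.Basis.coe_dualBasis]
  congr 1
  have h1 : b.dualBasis.coord i = Module.evalEquiv k V (b i) := by
    refine b.dualBasis.ext fun j => ?_
    simp [Finsupp.single_apply]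
  rw [h1]
  change pivotInvAct V ((Module.evalEquiv k V).symm (Module.evalEquiv k V (b i))) = _
  rw [LinearEquiv.symm_apply_apply]

end Pivotal

section Hooks

variable [HopfGroupCoalgebra k H]

/-- The right hook action of a group-like `ν ∈ H_1*`, i.e. an algebra map `ν : H 1 → k`:
`R(ν) (a) = (ν ⊗ id) (Δ_{1,x} a)`. -/
def rightHook (ν : H 1 →ₐ[k] k) (x : G) : H x →ₐ[k] H x :=
  (Algebra.TensorProduct.lid k (H x)).toAlgHom.comp
    ((Algebra.TensorProduct.map ν (AlgHom.id k (H x))).comp (comul (one_mul x)))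

/-- The left hook action of `ν`: `L(ν) (a) = (id ⊗ ν) (Δ_{x,1} a)`. -/
def leftHook (ν : H 1 →ₐ[k] k) (x : G) : H x →ₐ[k] H x :=
  (Algebra.TensorProduct.rid k k (H x)).toAlgHom.comp
    ((Algebra.TensorProduct.map (AlgHom.id k (H x)) ν).comp (comul (mul_one x)))

theorem rightHook_apply (ν : H 1 →ₐ[k] k) (x : G) (a : H x) : rightHook ν x a =
    TensorProduct.lid k (H x)
      (TensorProduct.map ν.toLinearMap LinearMap.id (comul (one_mul x) a)) := rfl

theorem leftHook_apply (ν : H 1 →ₐ[k] k) (x : G) (a : H x) : leftHook ν x a =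
    TensorProduct.rid k (H x)
      (TensorProduct.map LinearMap.id ν.toLinearMap (comul (mul_one x) a)) := rfl

theorem comul_rightHook (ν : H 1 →ₐ[k] k) {x y z : G} (h : x * y = z) (a : H z) :
    comul h (rightHook ν z a) =
      TensorProduct.map (rightHook ν x).toLinearMap LinearMap.id (comul (k := k) h a) := by
  have c := coassoc (k := k) (H := H) (one_mul x) h h (one_mul z) a
  have e1 : ∀ s : H 1 ⊗[k] H z, comul h (TensorProduct.lid k (H z)
      (TensorProduct.map ν.toLinearMap LinearMap.id s)) = TensorProduct.lid k _
        (TensorProduct.map ν.toLinearMap LinearMap.id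
          (TensorProduct.map LinearMap.id (comul (k := k) h).toLinearMap s)) := by
    intro s
    induction s with
    | zero => simp
    | add s₁ s₂ h₁ h₂ => simp only [map_add, h₁, h₂]
    | tmul b d => simp
  have e2 : ∀ s : H x ⊗[k] H y, TensorProduct.map (rightHook ν x).toLinearMap LinearMap.id s =
      TensorProduct.lid k _ (TensorProduct.map ν.toLinearMap LinearMap.id
        (TensorProduct.assoc k _ _ _ (TensorProduct.map (comul (one_mul x)).toLinearMap
          LinearMap.id s))) := by
    intro s
    induction s with
    | zero => simp
    | add s₁ s₂ h₁ h₂ => simp only [map_add, h₁, h₂]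
    | tmul b d =>
      simp only [TensorProduct.map_tmul, AlgHom.toLinearMap_apply, LinearMap.id_apply,
        rightHook_apply]
      generalize comul (k := k) (one_mul x) b = r
      induction r with
      | zero => simp
      | add r₁ r₂ h₁ h₂ => simp only [map_add, TensorProduct.add_tmul, h₁, h₂]
      | tmul b b' => simp [TensorProduct.smul_tmul']
  rw [rightHook_apply, e1, e2, c]

theorem comul_leftHook (ν : H 1 →ₐ[k] k) {x y z : G} (h : x * y = z) (a : H z) :
    comul h (leftHook ν z a) =
      TensorProduct.map LinearMap.id (leftHook ν y).toLinearMap (comul (k := k) h a) := by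
  have c := coassoc (k := k) (H := H) h (mul_one z) (mul_one y) h a
  have e1 : ∀ s : H z ⊗[k] H 1, comul h (TensorProduct.rid k (H z)
      (TensorProduct.map LinearMap.id ν.toLinearMap s)) = TensorProduct.map LinearMap.id
        (TensorProduct.rid k (H y) ∘ₗ TensorProduct.map LinearMap.id ν.toLinearMap)
        (TensorProduct.assoc k _ _ _
          (TensorProduct.map (comul (k := k) h).toLinearMap LinearMap.id s)) := by
    intro s
    induction s with
    | zero => simp
    | add s₁ s₂ h₁ h₂ => simp only [map_add, h₁, h₂]
    | tmul b d =>
      simp only [TensorProduct.map_tmul, AlgHom.toLinearMap_apply, LinearMap.id_apply,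
        TensorProduct.rid_tmul, map_smul]
      generalize comul (k := k) h b = r
      induction r with
      | zero => simp
      | add r₁ r₂ h₁ h₂ => simp only [map_add, smul_add, TensorProduct.add_tmul, h₁, h₂]
      | tmul b b' => simp
  have e2 : ∀ s : H x ⊗[k] H y, TensorProduct.map LinearMap.id (leftHook ν y).toLinearMap s =
      TensorProduct.map LinearMap.id
        (TensorProduct.rid k (H y) ∘ₗ TensorProduct.map LinearMap.id ν.toLinearMap)
        (TensorProduct.map LinearMap.id (comul (k := k) (mul_one y)).toLinearMap s) := by
    intro s
    induction s with
    | zero => simp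
    | add s₁ s₂ h₁ h₂ => simp only [map_add, h₁, h₂]
    | tmul b d => simp [leftHook_apply]
  rw [leftHook_apply, e1, e2, c]

/-- The convolution inverse `ν ∘ S_1` of `ν`. -/
def hookInv (ν : H 1 →ₐ[k] k) : H 1 →ₐ[k] k :=
  AlgHom.ofLinearMap (ν.toLinearMap ∘ₗ antipode (one_mul 1)) (by simp [antipode_one])
    (by intro a b; simp [antipode_mul, mul_comm])

theorem hookInv_apply (ν : H 1 →ₐ[k] k) (a : H 1) :
    hookInv ν a = ν (antipode (k := k) (one_mul 1) a) := rfl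

theorem conv_hookInv_left (ν : H 1 →ₐ[k] k) (a : H 1) :
    ν (rightHook (hookInv ν) 1 a) = counit a := by
  have e : ∀ s : H 1 ⊗[k] H 1, ν (TensorProduct.lid k _
      (TensorProduct.map (hookInv ν).toLinearMap LinearMap.id s)) =
      ν (LinearMap.mul' k _ (TensorProduct.map (antipode (k := k) (one_mul 1))
        LinearMap.id s)) := by
    intro s
    induction s with
    | zero => simp
    | add s₁ s₂ h₁ h₂ => simp only [map_add, h₁, h₂]
    | tmul b d => simp [hookInv_apply]
  rw [rightHook_apply, e, antipode_left]
  simp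

theorem conv_hookInv_right (ν : H 1 →ₐ[k] k) (a : H 1) :
    hookInv ν (rightHook ν 1 a) = counit a := by
  have e : ∀ s : H 1 ⊗[k] H 1, hookInv ν (TensorProduct.lid k _
      (TensorProduct.map ν.toLinearMap LinearMap.id s)) =
      ν (LinearMap.mul' k _ (TensorProduct.map LinearMap.id (antipode (k := k) (one_mul 1))
         s)) := by
    intro s
    induction s with
    | zero => simp
    | add s₁ s₂ h₁ h₂ => simp only [map_add, h₁, h₂]
    | tmul b d => simp [hookInv_apply]
  rw [rightHook_apply, e, antipode_right]
  simp

theorem leftHook_one (ν ν' : H 1 →ₐ[k] k) (a : H 1) :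
    ν (leftHook ν' 1 a) = ν' (rightHook ν 1 a) := by
  rw [leftHook_apply, rightHook_apply]
  generalize comul (k := k) (H := H) (mul_one 1) a = s
  induction s with
  | zero => simp
  | add s₁ s₂ h₁ h₂ => simp only [map_add, h₁, h₂]
  | tmul b d => simp [mul_comm]

theorem rightHook_rightHook {ν ν' : H 1 →ₐ[k] k} (h : ∀ a, ν (rightHook ν' 1 a) = counit a)
    (x : G) (a : H x) : rightHook ν x (rightHook ν' x a) = a := by
  have e : ν.toLinearMap ∘ₗ (rightHook ν' 1).toLinearMap = (counit (k := k)).toLinearMap :=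
    LinearMap.ext h
  rw [rightHook_apply ν, comul_rightHook, ← LinearMap.comp_apply, ← TensorProduct.map_comp, e,
    LinearMap.id_comp, counit_left]

theorem leftHook_leftHook {ν ν' : H 1 →ₐ[k] k} (h : ∀ a, ν' (rightHook ν 1 a) = counit a)
    (x : G) (a : H x) : leftHook ν x (leftHook ν' x a) = a := by
  have e : ν.toLinearMap ∘ₗ (leftHook ν' 1).toLinearMap = (counit (k := k)).toLinearMap :=
    LinearMap.ext fun b => (leftHook_one ν ν' b).trans (h b)
  rw [leftHook_apply ν, comul_leftHook, ← LinearMap.comp_apply, ← TensorProduct.map_comp, e,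
    LinearMap.id_comp, counit_right]

end Hooks

section Twist

/-- The module `φ_* V`: the vector space `V` with the action `a ·_φ v = φ(a) · v`. -/
abbrev twistObj (φ : ∀ x, H x →ₐ[k] H x) (V : HMod k H) : HMod k H where
  carrier := V
  act x := V.act x ∘ₗ (φ x).toLinearMap
  act_mul x a b := by simp [act_mul]
  act_ne h a b := V.act_ne h _ _
  exists_supp := ⟨V.supp, by simpa using V.sum_supp⟩

theorem twistObj_homog (φ : ∀ x, H x →ₐ[k] H x) {V : HMod k H} {x : G} {v : V}
    (hv : V.Homog x v) : (twistObj φ V).Homog x v := by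
  change V.act x (φ x 1) v = v
  rw [map_one, hv]

/-- The twist functor `φ_*`, the identity on morphisms. -/
def twist (φ : ∀ x, H x →ₐ[k] H x) : HMod k H ⥤ HMod k H where
  obj V := twistObj φ V
  map {V W} f := ⟨Hom.hom (V := V) (W := W) f,
    fun x a v => Hom.comm (V := V) (W := W) f x (φ x a) v⟩

/-- Twisting by an automorphism is an equivalence. -/
def twistEquivalence (φ ψ : ∀ x, H x →ₐ[k] H x) (h : ∀ x a, φ x (ψ x a) = a)
    (h' : ∀ x a, ψ x (φ x a) = a) : HMod k H ≌ HMod k H :=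
  CategoryTheory.Equivalence.mk (twist φ) (twist ψ)
    (NatIso.ofComponents (fun V => isoOfEquiv (W := twistObj ψ (twistObj φ V))
      (LinearEquiv.refl k V) (fun x a v => by simp [h])) (fun _ => rfl))
    (NatIso.ofComponents (fun V => isoOfEquiv (V := twistObj φ (twistObj ψ V))
      (LinearEquiv.refl k V) (fun x a v => by simp [h'])) (fun _ => rfl))

theorem projective_twist (φ ψ : ∀ x, H x →ₐ[k] H x) (h : ∀ x a, φ x (ψ x a) = a)
    (h' : ∀ x a, ψ x (φ x a) = a) {P : HMod k H} (hP : Projective P) :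
    Projective ((twist φ).obj P) :=
  ((twistEquivalence φ ψ h h').map_projective_iff P).2 hP

end Twist

section ModuleFunctors

variable [PivotalHopfGroupCoalgebra k H]

/-- The endofunctor `R(ν)_*` of the category of projective `H`-modules. -/
def rightTwist (ν : H 1 →ₐ[k] k) : Proj (HMod k H) ⥤ Proj (HMod k H) :=
  ObjectProperty.lift _ ((isProjective _).ι ⋙ twist (rightHook ν)) fun P =>
    projective_twist (rightHook ν) (rightHook (hookInv ν))
      (rightHook_rightHook (conv_hookInv_left ν)) (rightHook_rightHook (conv_hookInv_right ν))
      P.property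

/-- The endofunctor `L(ν)_*` of the category of projective `H`-modules. -/
def leftTwist (ν : H 1 →ₐ[k] k) : Proj (HMod k H) ⥤ Proj (HMod k H) :=
  ObjectProperty.lift _ ((isProjective _).ι ⋙ twist (leftHook ν)) fun P =>
    projective_twist (leftHook ν) (leftHook (hookInv ν))
      (leftHook_leftHook (conv_hookInv_right ν)) (leftHook_leftHook (conv_hookInv_left ν))
      P.property

theorem rightTwist_tensor (ν : H 1 →ₐ[k] k) (P V : HMod k H) (z : G) (a : H z) :
    tensorAct P V z (rightHook ν z a) = tensorAct (twistObj (rightHook ν) P) V z a := by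
  refine ext_homog₂ fun x y v w hv _ => ?_
  rw [tensorAct_of_eq (mul_inv_cancel_left x z) hv]
  refine Eq.trans ?_ (tensorAct_of_eq (V := twistObj (rightHook ν) P)
    (mul_inv_cancel_left x z) (twistObj_homog _ hv) a).symm
  rw [comul_rightHook, ← LinearMap.comp_apply, ← TensorProduct.map_comp]
  rfl

theorem leftTwist_tensor (ν : H 1 →ₐ[k] k) (V P : HMod k H) (z : G) (a : H z) :
    tensorAct V P z (leftHook ν z a) = tensorAct V (twistObj (leftHook ν) P) z a := by
  refine ext_homog₂ fun x y v w hv _ => ?_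
  rw [tensorAct_of_eq (mul_inv_cancel_left x z) hv]
  refine Eq.trans ?_ (tensorAct_of_eq (W := twistObj (leftHook ν) P)
    (mul_inv_cancel_left x z) hv a).symm
  rw [comul_leftHook, ← LinearMap.comp_apply, ← TensorProduct.map_comp]
  rfl

/-- `R(ν)_* (P ⊗ V) = R(ν)_* P ⊗ V`, by the identity map. -/
def rightTwistIso (ν : H 1 →ₐ[k] k) (P V : HMod k H) :
    twistObj (rightHook ν) (tensor P V) ≅ tensor (twistObj (rightHook ν) P) V :=
  isoOfEquiv (LinearEquiv.refl k (P ⊗[k] V)) fun z a t =>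
    LinearMap.congr_fun (rightTwist_tensor ν P V z a) t

/-- `L(ν)_* (V ⊗ P) = V ⊗ L(ν)_* P`, by the identity map. -/
def leftTwistIso (ν : H 1 →ₐ[k] k) (V P : HMod k H) :
    twistObj (leftHook ν) (tensor V P) ≅ tensor V (twistObj (leftHook ν) P) :=
  isoOfEquiv (LinearEquiv.refl k (V ⊗[k] P)) fun z a t =>
    LinearMap.congr_fun (leftTwist_tensor ν V P z a) t

open MonoidalLeftAction MonoidalRightAction

instance rightTwistLinear (ν : H 1 →ₐ[k] k) : (rightTwist ν).RightLinear (HMod k H) where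
  μᵣ P V := ObjectProperty.homMk (rightTwistIso ν P.obj V).inv
  δᵣ P V := ObjectProperty.homMk (rightTwistIso ν P.obj V).hom
  μᵣ_naturality_right _ _ _ _ := ObjectProperty.hom_ext _ (hom_ext rfl)
  μᵣ_naturality_left _ _ := ObjectProperty.hom_ext _ (hom_ext rfl)
  μᵣ_associativity _ _ _ := ObjectProperty.hom_ext _ (hom_ext
    (TensorProduct.ext (LinearMap.ext fun _ => TensorProduct.ext' fun _ _ => rfl)))
  μᵣ_unitality _ := ObjectProperty.hom_ext _ (hom_ext rfl)
  δᵣ_naturality_right _ _ _ _ := ObjectProperty.hom_ext _ (hom_ext rfl)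
  δᵣ_naturality_left _ _ := ObjectProperty.hom_ext _ (hom_ext rfl)
  δᵣ_associativity _ _ _ := ObjectProperty.hom_ext _ (hom_ext
    (TensorProduct.ext (LinearMap.ext fun _ => TensorProduct.ext' fun _ _ => rfl)))
  δᵣ_unitality_inv _ := ObjectProperty.hom_ext _ (hom_ext rfl)
  μᵣ_comp_δᵣ _ _ := ObjectProperty.hom_ext _ (hom_ext rfl)
  δᵣ_comp_μᵣ _ _ := ObjectProperty.hom_ext _ (hom_ext rfl)

instance leftTwistLinear (ν : H 1 →ₐ[k] k) : (leftTwist ν).LeftLinear (HMod k H) where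
  μₗ V P := ObjectProperty.homMk (leftTwistIso ν V P.obj).inv
  δₗ V P := ObjectProperty.homMk (leftTwistIso ν V P.obj).hom
  μₗ_naturality_left _ _ := ObjectProperty.hom_ext _ (hom_ext rfl)
  μₗ_naturality_right _ _ _ _ := ObjectProperty.hom_ext _ (hom_ext rfl)
  μₗ_associativity _ _ _ := ObjectProperty.hom_ext _ (hom_ext
    (TensorProduct.ext_threefold fun _ _ _ => rfl))
  μₗ_unitality _ := ObjectProperty.hom_ext _ (hom_ext rfl)
  δₗ_naturality_left _ _ := ObjectProperty.hom_ext _ (hom_ext rfl)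
  δₗ_naturality_right _ _ _ _ := ObjectProperty.hom_ext _ (hom_ext rfl)
  δₗ_associativity _ _ _ := ObjectProperty.hom_ext _ (hom_ext
    (TensorProduct.ext_threefold fun _ _ _ => rfl))
  δₗ_unitality_inv _ := ObjectProperty.hom_ext _ (hom_ext rfl)
  μₗ_comp_δₗ _ _ := ObjectProperty.hom_ext _ (hom_ext rfl)
  δₗ_comp_μₗ _ _ := ObjectProperty.hom_ext _ (hom_ext rfl)

end ModuleFunctors

end HMod

end Modules

section Modulus

variable [HopfGroupCoalgebra k H]

variable (k) in
/-- A left cointegral in `H_1`: an element `c` with `a c = ε(a) c` for all `a`. -/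
def IsLeftCointegral (c : H 1) : Prop := ∀ a : H 1, a * c = counit (k := k) a • c

/-- `α` is the modulus of `H_1`: `c a = α(a) c` for all left cointegrals `c` in `H_1`. (The
modulus is determined by any non-zero left cointegral, which is asked to exist.) -/
def IsModulus (α : H 1 →ₐ[k] k) : Prop :=
  (∃ c : H 1, IsLeftCointegral k c ∧ c ≠ 0) ∧
    ∀ c : H 1, IsLeftCointegral k c → ∀ a : H 1, c * a = α a • c

theorem IsModulus.unique {α β : H 1 →ₐ[k] k} (hα : IsModulus α) (hβ : IsModulus β) : α = β := by
  obtain ⟨c, hc, hne⟩ := hα.1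
  ext a
  have h := (hα.2 c hc a).symm.trans (hβ.2 c hc a)
  exact smul_left_injective k hne h

variable (k H) in
/-- `H_1` is unimodular: its modulus is the counit. -/
def IsUnimodular : Prop := IsModulus (counit : H 1 →ₐ[k] k)

end Modulus

end Hopf

end ModTrace

end

open CategoryTheory ModTrace ModTrace.HMod

noncomputable section

namespace ModTrace

open HopfGroupCoalgebra

namespace HMod

variable {k : Type u} [Field k] {G : Type v} [Group G] {H : G → Type u}
  [∀ x, Ring (H x)] [∀ x, Algebra k (H x)]

/-! ### Epimorphisms of `H`-modules are the surjective ones -/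

section Epi

variable {V W : HMod k H}

/-! Write Σ for R(ν)_* or L(ν)_*, and ν⁻¹ for `hookInv ν`. On H_1 both ν⁻¹ ∘ R(ν) and ν⁻¹ ∘ L(ν)
equal ε, so a morphism 1 → ΣP is the same as a semiinvariant of P: a vector r ∈ P_1 with a r =
ν⁻¹(a) r. Two facts about semiinvariants carry the proof. In H_1 they form a line spanned by h =
R(ν)(c), with c a non-zero left cointegral, and h is a right cointegral exactly when ν = α
(`exists_semiinvariant_generator`). In a projective P, splitting H_1 ⊗ P → P and untwisting H_1 ⊗
P_1 into a free module shows that a non-zero semiinvariant survives under some morphism P → H_1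
(`IsSemiinvariant.exists_hom_ne_zero`) and that each semiinvariant has the form h p
(`IsSemiinvariant.exists_eq_act`). The first of these, applied to the invariant coev(1) of the
projective module H_1 ⊗ H_1*, also yields a non-zero left cointegral.

Necessity of ν = α, and non-degeneracy: the partial trace property, read backwards, turns t_P(f ∘ g)
for g : P → Q, f : Q → ΣP into the trace of a composite R → 1 → ΣR with R = P ⊗ Q* (Q* ⊗ P on the
left), and f and g correspond bijectively to the two factors (`ReducesToUnit`). For such a composite
with semiinvariant r, lift R → 1 through ε : H_1 → 1 to g' : R → H_1. By cyclicity its trace is z τ,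
where g'(r) = z h and τ is the trace of H_1 → 1 → ΣH_1 with semiinvariant h (`tracePairing_lift`).
Hence t ≠ 0 forces τ ≠ 0. Taking right multiplication by b for g' gives h b = ε(b) h, so ν = α. The
detection property and the semiinvariants h p provide a partner for every non-zero f or g.

Existence for ν = α: a morphism f : P → ΣP is a semiinvariant of P ⊗ P*, hence equals h x for some
x, and t_P(f) is defined as tev(x). This does not depend on x: if γ : P ⊗ P* → H_1 lifts tev, then
γ(h x) = h γ(x) = tev(x) h because h is a right cointegral (`scaling_act`). Since h x is carried to
h y when a module morphism carries x to y, cyclicity and the partial trace property reduce to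
identities between evaluations. The left trace uses P* ⊗ P and ev instead. The unimodular statements
are the case ν = ε, where Σ is isomorphic to the identity compatibly with the module structure. -/

theorem Hom.comm_apply (f : V ⟶ W) (x : G) (a : H x) (v : V) :
    Hom.hom f (V.act x a v) = W.act x a (Hom.hom f v) := Hom.comm f x a v

theorem hom_congr {f g : V ⟶ W} (h : f = g) (v : V) : Hom.hom f v = Hom.hom g v := by rw [h]

theorem epi_of_surjective (f : V ⟶ W) (hf : Function.Surjective (Hom.hom f)) : Epi f := by
  refine ⟨fun g h e => hom_ext (LinearMap.ext fun w => ?_)⟩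
  obtain ⟨v, rfl⟩ := hf w
  exact hom_congr e v

theorem range_le_comap_act (f : V ⟶ W) (x : G) (a : H x) :
    LinearMap.range (Hom.hom f) ≤ (LinearMap.range (Hom.hom f)).comap (W.act x a) := by
  rintro _ ⟨v, rfl⟩
  exact ⟨V.act x a v, Hom.comm f x a v⟩

/-- The cokernel of a morphism. -/
def coker (f : V ⟶ W) : HMod k H where
  carrier := W ⧸ LinearMap.range (Hom.hom f)
  act x :=
    { toFun := fun a => (LinearMap.range (Hom.hom f)).mapQ _ (W.act x a) (range_le_comap_act f x a)
      map_add' := fun a b => by ext w; simp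
      map_smul' := fun c a => by ext w; simp }
  act_mul x a b := by ext w; simp [act_mul]
  act_ne {x y} h a b := by
    ext w
    have := LinearMap.congr_fun (W.act_ne h a b) w
    rw [Module.End.mul_apply, LinearMap.zero_apply] at this
    simp [this]
  exists_supp := by
    refine ⟨W.supp, ?_⟩
    ext w
    simp only [LinearMap.coe_mk, AddHom.coe_mk, LinearMap.comp_apply, LinearMap.sum_apply,
      Submodule.mkQ_apply, Submodule.mapQ_apply, Module.End.one_apply]
    conv_rhs => rw [← sum_act_one w]
    exact (map_sum (Submodule.mkQ _) _ _).symm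

/-- The projection onto the cokernel. -/
def cokerProj (f : V ⟶ W) : W ⟶ coker f where
  hom := Submodule.mkQ _
  comm _ _ _ := rfl

/-- The vector space cokernel is again an `H`-module, and its projection composed with f is zero; an
epimorphism therefore has zero cokernel. -/
theorem surjective_of_epi (f : V ⟶ W) [Epi f] : Function.Surjective (Hom.hom f) := by
  have e : cokerProj f = 0 := by
    rw [← cancel_epi f]
    apply hom_ext
    ext v
    exact (Submodule.Quotient.mk_eq_zero _).2 ⟨v, rfl⟩
  intro w
  exact (Submodule.Quotient.mk_eq_zero (LinearMap.range (Hom.hom f))).1 (hom_congr e w)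

end Epi

/-! ### The regular module of H_1 and the counit as a morphism to the unit -/

section Regular

open Classical in
variable (k H) in
/-- The action of `H x` on `H 1`: the multiplication if `x = 1`, and zero otherwise. -/
def regularAct (x : G) : H x →ₗ[k] Module.End k (H 1) :=
  if h : x = 1 then
    (h.symm ▸ (Algebra.lmul k (H 1)).toLinearMap : H x →ₗ[k] Module.End k (H 1))
  else 0

theorem regularAct_one (a b : H 1) : regularAct k H 1 a b = a * b := by
  rw [regularAct, dif_pos rfl]
  rfl

theorem regularAct_ne {x : G} (h : x ≠ 1) (a : H x) : regularAct k H x a = 0 := by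
  rw [regularAct, dif_neg h, LinearMap.zero_apply]

variable [∀ x, Module.Finite k (H x)]

variable (k H) in
/-- The regular `H 1`-module, in degree `1`. -/
abbrev regular : HMod k H where
  carrier := H 1
  act := regularAct k H
  act_mul x a b := by
    by_cases h : x = 1
    · subst h
      ext
      simp [regularAct_one, mul_assoc]
    · simp [regularAct_ne h]
  act_ne {x y} hxy a b := by
    by_cases h : x = 1
    · have : y ≠ 1 := fun e => hxy (h.trans e.symm)
      simp [regularAct_ne this]
    · simp [regularAct_ne h]
  exists_supp := ⟨{1}, by ext; simp [regularAct_one]⟩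

theorem regular_homog (a : H 1) : (regular k H).Homog 1 a := by
  change regularAct k H 1 1 a = a
  rw [regularAct_one, one_mul]

/-- The morphism `a ↦ a · v` from the regular module. -/
def orbHom (V : HMod k H) (v : V) : regular k H ⟶ V where
  hom := V.orb 1 v
  comm x a b := by
    by_cases h : x = 1
    · subst h
      change V.act 1 (regularAct k H 1 a b) v = V.act 1 a (V.act 1 b v)
      rw [regularAct_one, act_mul, Module.End.mul_apply]
    · change V.act 1 (regularAct k H x a b) v = V.act x a (V.act 1 b v)
      rw [regularAct_ne h, LinearMap.zero_apply, map_zero, LinearMap.zero_apply,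
        ← Module.End.mul_apply, V.act_ne h, LinearMap.zero_apply]

theorem hom_regular_apply {V : HMod k H} (f : regular k H ⟶ V) (a : H 1) :
    Hom.hom f a = V.act 1 a (Hom.hom f (1 : H 1)) := by
  rw [← Hom.comm_apply]
  change _ = Hom.hom f (regularAct k H 1 a 1)
  rw [regularAct_one, mul_one]

/-- H_1 is free on 1 in degree 1, so a morphism out of it is lifted by lifting the image of 1. -/
theorem projective_regular : Projective (regular k H) where
  factors {E X} f e _ := by
    obtain ⟨v, hv⟩ := surjective_of_epi e (Hom.hom f (1 : H 1))
    refine ⟨orbHom E v, hom_ext (LinearMap.ext fun a => ?_)⟩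
    change Hom.hom e (E.act 1 a v) = Hom.hom f a
    rw [hom_regular_apply f, Hom.comm_apply, hv]

variable [HopfGroupCoalgebra k H]

variable (k H) in
/-- The counit as a morphism from the regular module to the unit object. -/
def counitHom : regular k H ⟶ unit k H where
  hom := (counit (k := k)).toLinearMap
  comm x a b := by
    by_cases h : x = 1
    · subst h
      change counit (regularAct k H 1 a b) = unitAct k H 1 a (counit b)
      rw [regularAct_one, unitAct_one, map_mul]
    · change counit (regularAct k H x a b) = unitAct k H x a (counit b)
      rw [regularAct_ne h, unitAct_ne h, LinearMap.zero_apply, LinearMap.zero_apply, map_zero]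

theorem counitHom_apply (a : H 1) : Hom.hom (counitHom k H) a = counit (k := k) a := rfl

theorem exists_lift_counitHom {P : HMod k H} (hP : Projective P) (g : P ⟶ unit k H) :
    ∃ g' : P ⟶ regular k H, g' ≫ counitHom k H = g := by
  have : Epi (counitHom k H) := epi_of_surjective _ fun c =>
    ⟨algebraMap k (H 1) c, by rw [counitHom_apply]; exact AlgHom.commutes _ c⟩
  exact ⟨Projective.factorThru g (counitHom k H), Projective.factorThru_comp g _⟩

end Regular

/-! ### Untwisting the diagonal action on H_1 ⊗ V -/

section Untwist

variable [HopfGroupCoalgebra k H]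

/-- The endomorphism `a ⊗ v ↦ a₁ ⊗ B(a₂) v` of `H 1 ⊗ V`. -/
def coactEnd {V : Type u} [AddCommGroup V] [Module k V] (B : H 1 →ₗ[k] Module.End k V) :
    H 1 ⊗[k] V →ₗ[k] H 1 ⊗[k] V :=
  TensorProduct.map LinearMap.id (TensorProduct.lift B) ∘ₗ
    (TensorProduct.assoc k (H 1) (H 1) V).toLinearMap ∘ₗ
      TensorProduct.map (comul (mul_one 1)).toLinearMap LinearMap.id

theorem coactEnd_tmul {V : Type u} [AddCommGroup V] [Module k V]
    (B : H 1 →ₗ[k] Module.End k V) (a : H 1) (v : V) :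
    coactEnd B (a ⊗ₜ v) = TensorProduct.map LinearMap.id (B.flip v) (comul (mul_one 1) a) := by
  simp only [coactEnd, LinearMap.comp_apply, TensorProduct.map_tmul, AlgHom.toLinearMap_apply,
    LinearMap.id_apply]
  generalize comul (k := k) (mul_one 1) a = s
  induction s with
  | zero => simp
  | add s₁ s₂ h₁ h₂ => simp only [map_add, TensorProduct.add_tmul, h₁, h₂]
  | tmul b c => simp

/-- By coassociativity the composite sends a ⊗ v to a₁ ⊗ (B * C)(a₂) v with the convolution product
B * C. The hypothesis says that this product is ε X, and the counit axiom removes ε. -/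
theorem coactEnd_coactEnd {V : Type u} [AddCommGroup V] [Module k V]
    (B C : H 1 →ₗ[k] Module.End k V) (X : Module.End k V)
    (h : ∀ a : H 1, LinearMap.mul' k _ (TensorProduct.map B C (comul (mul_one 1) a)) =
      counit (k := k) a • X) (s : H 1 ⊗[k] V) :
    coactEnd B (coactEnd C s) = TensorProduct.map LinearMap.id X s := by
  induction s with
  | zero => simp
  | add s₁ s₂ h₁ h₂ => simp only [map_add, h₁, h₂]
  | tmul a v =>
    rw [coactEnd_tmul]
    have e1 : ∀ s : H 1 ⊗[k] H 1, coactEnd B (TensorProduct.map LinearMap.id (C.flip v) s) =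
        TensorProduct.map LinearMap.id (LinearMap.applyₗ v ∘ₗ LinearMap.mul' k _ ∘ₗ
          TensorProduct.map B C) (TensorProduct.assoc k _ _ _
            (TensorProduct.map (comul (mul_one 1)).toLinearMap LinearMap.id s)) := by
      intro s
      induction s with
      | zero => simp
      | add s₁ s₂ h₁ h₂ => simp only [map_add, h₁, h₂]
      | tmul b c =>
        simp only [TensorProduct.map_tmul, LinearMap.id_apply, coactEnd_tmul,
          AlgHom.toLinearMap_apply]
        generalize comul (k := k) (mul_one 1) b = s
        induction s with
        | zero => simp
        | add s₁ s₂ h₁ h₂ => simp only [map_add, TensorProduct.add_tmul, h₁, h₂]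
        | tmul b c => simp
    have e2 : ∀ s : H 1 ⊗[k] H 1, TensorProduct.map LinearMap.id (LinearMap.applyₗ v ∘ₗ
        LinearMap.mul' k _ ∘ₗ TensorProduct.map B C)
          (TensorProduct.map LinearMap.id (comul (mul_one 1)).toLinearMap s) =
        TensorProduct.rid k _ (TensorProduct.map LinearMap.id (counit (k := k)).toLinearMap s)
          ⊗ₜ X v := by
      intro s
      induction s with
      | zero => simp
      | add s₁ s₂ h₁ h₂ => simp only [map_add, TensorProduct.add_tmul, h₁, h₂]
      | tmul b c => simp [h, TensorProduct.smul_tmul]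
    rw [e1, coassoc (mul_one 1) (mul_one 1) (mul_one 1) (mul_one 1), e2, counit_right]
    simp

/-- The endomorphism `a ⊗ v ↦ a₁ ⊗ a₂ v` of `H 1 ⊗ V`. -/
def twistMap (V : HMod k H) : H 1 ⊗[k] V →ₗ[k] H 1 ⊗[k] V := coactEnd (V.act 1)

/-- The endomorphism `a ⊗ v ↦ a₁ ⊗ S(a₂) v` of `H 1 ⊗ V`. -/
def untwistMap (V : HMod k H) : H 1 ⊗[k] V →ₗ[k] H 1 ⊗[k] V :=
  coactEnd (V.act 1 ∘ₗ antipode (k := k) (one_mul 1))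

/-- The convolution of the action with its composite with S is ε. The composite is a projection
rather than the identity because H_1 acts by zero on V_x for x ≠ 1: twisting is invertible only on
H_1 ⊗ V_1. -/
theorem twistMap_untwistMap (V : HMod k H) (s : H 1 ⊗[k] V) :
    twistMap V (untwistMap V s) = TensorProduct.map LinearMap.id (V.act 1 1) s := by
  refine coactEnd_coactEnd _ _ _ (fun a => ?_) s
  have e : ∀ s : H 1 ⊗[k] H 1, LinearMap.mul' k _ (TensorProduct.map (V.act 1)
      (V.act 1 ∘ₗ antipode (k := k) (one_mul 1)) s) = V.act 1 (LinearMap.mul' k _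
        (TensorProduct.map LinearMap.id (antipode (k := k) (one_mul 1)) s)) := by
    intro s
    induction s with
    | zero => simp
    | add s₁ s₂ h₁ h₂ => simp only [map_add, h₁, h₂]
    | tmul b c => simp [act_mul]
  rw [e, antipode_right, Algebra.algebraMap_eq_smul_one, map_smul]

theorem untwistMap_twistMap (V : HMod k H) (s : H 1 ⊗[k] V) :
    untwistMap V (twistMap V s) = TensorProduct.map LinearMap.id (V.act 1 1) s := by
  refine coactEnd_coactEnd _ _ _ (fun a => ?_) s
  have e : ∀ s : H 1 ⊗[k] H 1, LinearMap.mul' k _ (TensorProduct.map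
      (V.act 1 ∘ₗ antipode (k := k) (one_mul 1)) (V.act 1) s) = V.act 1 (LinearMap.mul' k _
        (TensorProduct.map (antipode (k := k) (one_mul 1)) LinearMap.id s)) := by
    intro s
    induction s with
    | zero => simp
    | add s₁ s₂ h₁ h₂ => simp only [map_add, h₁, h₂]
    | tmul b c => simp [act_mul]
  rw [e, antipode_left, Algebra.algebraMap_eq_smul_one, map_smul]

theorem map_act_one_untwistMap (V : HMod k H) (s : H 1 ⊗[k] V) :
    TensorProduct.map LinearMap.id (V.act 1 1) (untwistMap V s) = untwistMap V s := by
  induction s with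
  | zero => simp
  | add s₁ s₂ h₁ h₂ => simp only [map_add, h₁, h₂]
  | tmul a v =>
    rw [untwistMap, coactEnd_tmul]
    generalize comul (k := k) (mul_one 1) a = s
    induction s with
    | zero => simp
    | add s₁ s₂ h₁ h₂ => simp only [map_add, h₁, h₂]
    | tmul b c =>
      simp only [TensorProduct.map_tmul, LinearMap.id_apply, LinearMap.flip_apply,
        LinearMap.comp_apply]
      rw [← Module.End.mul_apply, act_one_mul]

variable [∀ x, Module.Finite k (H x)]

theorem tensorAct_regular_one (V : HMod k H) (s : H 1 ⊗[k] V) :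
    tensorAct (regular k H) V 1 1 s = TensorProduct.map LinearMap.id (V.act 1 1) s := by
  induction s with
  | zero => simp
  | add s₁ s₂ h₁ h₂ => simp only [map_add, ← h₁, ← h₂]
  | tmul a v =>
    refine (tensorAct_of_eq (V := regular k H) (mul_one 1) (regular_homog a) 1).trans ?_
    rw [map_one, Algebra.TensorProduct.one_def, TensorProduct.map_tmul]
    change regularAct k H 1 1 a ⊗ₜ _ = _
    rw [regularAct_one, one_mul]
    rfl

theorem twistMap_tmul (V : HMod k H) (a : H 1) (v : V) :
    twistMap V (a ⊗ₜ v) = tensorAct (regular k H) V 1 a ((1 : H 1) ⊗ₜ v) := by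
  refine Eq.trans ?_ (tensorAct_of_eq (V := regular k H) (mul_one 1) (regular_homog 1) a).symm
  have e : (regular k H).orb 1 (1 : H 1) = LinearMap.id := by
    ext b
    exact (regularAct_one b 1).trans (mul_one b)
  rw [e, twistMap, coactEnd_tmul]

/-- Twisting sends a ⊗ v to a · (1 ⊗ v), so it intertwines left multiplication on the first factor
with the diagonal action. -/
theorem twistMap_mul (V : HMod k H) (a : H 1) (s : H 1 ⊗[k] V) :
    twistMap V (TensorProduct.map (LinearMap.mulLeft k a) LinearMap.id s) =
      tensorAct (regular k H) V 1 a (twistMap V s) := by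
  induction s with
  | zero => simp
  | add s₁ s₂ h₁ h₂ => simp only [map_add, h₁, h₂]
  | tmul b v =>
    rw [TensorProduct.map_tmul, twistMap_tmul, twistMap_tmul]
    exact LinearMap.congr_fun ((tensor (regular k H) V).act_mul 1 a b) _

theorem untwistMap_act (V : HMod k H) (a : H 1) (s : H 1 ⊗[k] V) :
    untwistMap V (tensorAct (regular k H) V 1 a s) =
      TensorProduct.map (LinearMap.mulLeft k a) LinearMap.id (untwistMap V s) := by
  have h : tensorAct (regular k H) V 1 a s =
      tensorAct (regular k H) V 1 a (tensorAct (regular k H) V 1 1 s) := by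
    have := (tensor (regular k H) V).act_mul 1 a 1
    rw [mul_one] at this
    exact LinearMap.congr_fun this s
  -- Replacing s by its component in H_1 ⊗ V_1 makes it a value of `twistMap`, so that linearity of
  -- the untwisting follows from linearity of the twisting.
  rw [h, tensorAct_regular_one, ← twistMap_untwistMap, ← twistMap_mul, untwistMap_twistMap,
    ← LinearMap.comp_apply, ← TensorProduct.map_comp, LinearMap.comp_id, LinearMap.id_comp]
  conv_rhs => rw [← map_act_one_untwistMap, ← LinearMap.comp_apply, ← TensorProduct.map_comp,
    LinearMap.comp_id, LinearMap.id_comp]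

theorem untwistMap_act_ne (V : HMod k H) {x : G} (hx : x ≠ 1) (a : H x) (s : H 1 ⊗[k] V) :
    untwistMap V (tensorAct (regular k H) V x a s) = 0 := by
  -- The untwisting only sees the component of degree 1, on which an element of degree x ≠ 1 has
  -- image zero.
  rw [← map_act_one_untwistMap, ← untwistMap_twistMap, twistMap_untwistMap,
    ← tensorAct_regular_one]
  have := LinearMap.congr_fun ((tensor (regular k H) V).act_ne hx.symm 1 a) s
  erw [this]
  simp

/-- The morphism `a ⊗ v ↦ ξ(S(a₂) v) a₁`. -/
def untwistHom (V : HMod k H) (ξ : Module.Dual k V) : tensor (regular k H) V ⟶ regular k H where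
  hom := (TensorProduct.rid k (H 1)).toLinearMap ∘ₗ TensorProduct.map LinearMap.id ξ ∘ₗ
    untwistMap V
  comm x a s := by
    by_cases h : x = 1
    · subst h
      change TensorProduct.rid k (H 1) (TensorProduct.map LinearMap.id ξ
        (untwistMap V (tensorAct (regular k H) V 1 a s))) = regularAct k H 1 a
          (TensorProduct.rid k (H 1) (TensorProduct.map LinearMap.id ξ (untwistMap V s)))
      rw [untwistMap_act, regularAct_one]
      generalize untwistMap V s = t
      induction t with
      | zero => simp
      | add s₁ s₂ h₁ h₂ => simp only [map_add, h₁, h₂, mul_add]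
      | tmul b c => simp
    · change TensorProduct.rid k (H 1) (TensorProduct.map LinearMap.id ξ
        (untwistMap V (tensorAct (regular k H) V x a s))) = regularAct k H x a
          (TensorProduct.rid k (H 1) (TensorProduct.map LinearMap.id ξ (untwistMap V s)))
      rw [untwistMap_act_ne V h, regularAct_ne h]
      simp

end Untwist

end HMod

/-! ### Tensors as linear maps, and semiinvariant vectors -/

namespace HMod

variable {k : Type u} [Field k] {G : Type v} [Group G] {H : G → Type u}
  [∀ x, Ring (H x)] [∀ x, Algebra k (H x)]

/-- The contraction `P ⊗ Q* → Hom(Q, P)`, sending `p ⊗ ξ` to `q ↦ ξ(q) p`. -/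
def contr (P Q : Type u) [AddCommGroup P] [Module k P] [AddCommGroup Q] [Module k Q] :
    P ⊗[k] Module.Dual k Q →ₗ[k] Q →ₗ[k] P :=
  dualTensorHom k Q P ∘ₗ (TensorProduct.comm k P (Module.Dual k Q)).toLinearMap

section Contr

variable {P Q : Type u} [AddCommGroup P] [Module k P] [AddCommGroup Q] [Module k Q]

@[simp] theorem contr_tmul (p : P) (ξ : Module.Dual k Q) (q : Q) :
    contr P Q (p ⊗ₜ[k] ξ) q = ξ q • p := by
  simp [contr]

theorem contr_injective [FiniteDimensional k Q] :
    Function.Injective (contr (k := k) P Q) := by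
  have h : Function.Injective (dualTensorHom k Q P) := dualTensorHom_bijective.1
  intro s t e
  exact (TensorProduct.comm k P _).injective (h e)

theorem contr_coevaluation [FiniteDimensional k Q] :
    contr Q Q (coevaluation k Q 1) = LinearMap.id := by
  rw [coevaluation_apply_one]
  refine LinearMap.ext fun q => ?_
  rw [map_sum, LinearMap.sum_apply]
  simp only [contr_tmul, Module.Basis.coord_apply]
  exact (Module.Basis.ofVectorSpace k Q).sum_repr q

variable [FiniteDimensional k Q]

/-- The element of `P ⊗ Q*` corresponding to a linear map `Q → P`. -/
def contrSymm : (Q →ₗ[k] P) →ₗ[k] P ⊗[k] Module.Dual k Q where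
  toFun f := TensorProduct.map f LinearMap.id (coevaluation k Q 1)
  map_add' f g := by rw [TensorProduct.map_add_left, LinearMap.add_apply]
  map_smul' z f := by rw [TensorProduct.map_smul_left, LinearMap.smul_apply, RingHom.id_apply]

theorem contrSymm_apply (f : Q →ₗ[k] P) :
    contrSymm f = TensorProduct.map f LinearMap.id (coevaluation k Q 1) := rfl

theorem contr_map {P' : Type u} [AddCommGroup P'] [Module k P'] (f : P →ₗ[k] P')
    (s : P ⊗[k] Module.Dual k Q) :
    contr P' Q (TensorProduct.map f LinearMap.id s) = f ∘ₗ contr P Q s := by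
  induction s with
  | zero => simp
  | add s₁ s₂ h₁ h₂ => simp only [map_add, h₁, h₂, LinearMap.comp_add]
  | tmul p ξ => ext; simp

theorem contr_contrSymm (f : Q →ₗ[k] P) : contr P Q (contrSymm f) = f := by
  rw [contrSymm_apply, contr_map, contr_coevaluation, LinearMap.comp_id]

theorem contrSymm_contr (s : P ⊗[k] Module.Dual k Q) : contrSymm (contr P Q s) = s :=
  contr_injective (contr_contrSymm _)

theorem eq_zero_of_forall_rid {s : P ⊗[k] Q}
    (h : ∀ ξ : Module.Dual k Q, TensorProduct.rid k P (TensorProduct.map LinearMap.id ξ s) = 0) :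
    s = 0 := by
  set b := Module.Basis.ofVectorSpace k Q
  have e : ∀ s : P ⊗[k] Q, s = ∑ i, TensorProduct.rid k P
      (TensorProduct.map LinearMap.id (b.coord i) s) ⊗ₜ b i := by
    intro s
    induction s with
    | zero => simp
    | add s₁ s₂ h₁ h₂ =>
      conv_lhs => rw [h₁, h₂]
      simp only [map_add, TensorProduct.add_tmul, Finset.sum_add_distrib]
    | tmul p q =>
      simp only [TensorProduct.map_tmul, LinearMap.id_apply, TensorProduct.rid_tmul,
        TensorProduct.smul_tmul]
      rw [← TensorProduct.tmul_sum]
      congr 1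
      exact (b.sum_repr q).symm
  rw [e s]
  exact Finset.sum_eq_zero fun i _ => by rw [h, TensorProduct.zero_tmul]

/-- If all coordinates of a tensor, along a basis of the second factor, are multiples of the same p,
then p can be factored out. -/
theorem exists_tmul_of_forall_rid {s : P ⊗[k] Q} {p : P}
    (h : ∀ ξ : Module.Dual k Q, ∃ c : k,
      TensorProduct.rid k P (TensorProduct.map LinearMap.id ξ s) = c • p) :
    ∃ q : Q, s = p ⊗ₜ q := by
  set b := Module.Basis.ofVectorSpace k Q
  choose c hc using h
  refine ⟨∑ i, c (b.coord i) • b i, sub_eq_zero.1 (eq_zero_of_forall_rid fun ξ => ?_)⟩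
  have e : ξ = ∑ i, ξ (b i) • b.coord i := by
    refine b.ext fun j => ?_
    classical
    simp
  have h1 : TensorProduct.rid k P (TensorProduct.map LinearMap.id ξ s) =
      ∑ i, ξ (b i) • c (b.coord i) • p := by
    simp only [← hc]
    conv_lhs => rw [e]
    clear e hc
    induction s with
    | zero => simp
    | add s₁ s₂ h₁ h₂ => simp only [map_add, h₁, h₂, smul_add, Finset.sum_add_distrib]
    | tmul p q =>
      have e2 : ξ q = ∑ i, b.repr q i * ξ (b i) := by
        conv_lhs => rw [← b.sum_repr q, map_sum]
        simp
      simp [e2, Finset.sum_smul, smul_smul, mul_comm]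
  rw [map_sub, map_sub, h1]
  simp [Finset.sum_smul, smul_smul, mul_comm]

end Contr

/-- `r ∈ V_1` and `a · r = β(a) r` for all `a`. -/
def IsSemiinvariant (β : H 1 →ₐ[k] k) (V : HMod k H) (r : V) : Prop :=
  ∀ a : H 1, V.act 1 a r = β a • r

theorem IsSemiinvariant.homog {β : H 1 →ₐ[k] k} {V : HMod k H} {r : V}
    (hr : IsSemiinvariant β V r) : V.Homog 1 r := by
  rw [Homog, hr, map_one, one_smul]

theorem IsSemiinvariant.map {β : H 1 →ₐ[k] k} {V W : HMod k H} {r : V}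
    (hr : IsSemiinvariant β V r) (f : V ⟶ W) : IsSemiinvariant β W (Hom.hom f r) := fun a => by
  rw [← Hom.comm_apply, hr, map_smul]

variable [∀ x, Module.Finite k (H x)]

theorem isSemiinvariant_regular {β : H 1 →ₐ[k] k} {c : H 1} :
    IsSemiinvariant β (regular k H) c ↔ ∀ a, a * c = β a • c :=
  forall_congr' fun a => by
    change regularAct k H 1 a c = _ ↔ _
    rw [regularAct_one]

/-! ### Semiinvariants in projective modules -/

section Projective

variable [HopfGroupCoalgebra k H] {P : HMod k H} {β : H 1 →ₐ[k] k}

/-- Tensoring the surjection ε : H_1 → 1 with P gives a surjection H_1 ⊗ P → P, which splits.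
Properties of H_1 thereby pass to every projective module, of whatever degrees. -/
theorem exists_section (hP : Projective P) : ∃ s : P ⟶ tensor (regular k H) P,
    s ≫ counitHom k H ▷ P ≫ (λ_ P).hom = 𝟙 P := by
  have : Epi (counitHom k H ▷ P ≫ (λ_ P).hom) := epi_of_surjective _ fun p => by
    refine ⟨(1 : H 1) ⊗ₜ[k] p, ?_⟩
    change counit (k := k) (1 : H 1) • p = p
    rw [map_one, one_smul]
  exact ⟨Projective.factorThru (𝟙 P) (counitHom k H ▷ P ≫ (λ_ P).hom),
    Projective.factorThru_comp _ _⟩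

theorem twistMap_untwistMap_of_homog {r : P} (hr : P.Homog 1 r)
    (s : P ⟶ tensor (regular k H) P) :
    twistMap P (untwistMap P (Hom.hom s r)) = Hom.hom s r := by
  rw [twistMap_untwistMap, ← tensorAct_regular_one]
  conv_rhs => rw [← hr]
  exact (Hom.comm_apply s 1 1 r).symm

/-- The vector r lies in degree 1, so its image under the section lies in H_1 ⊗ P_1, where
untwisting is injective. The coordinates of the untwisted tensor are values at r of morphisms to
H_1; if all of them vanished, so would r. -/
theorem IsSemiinvariant.exists_hom_ne_zero {r : P} (hr : IsSemiinvariant β P r)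
    (hP : Projective P) (h0 : r ≠ 0) : ∃ s : P ⟶ regular k H, Hom.hom s r ≠ (0 : H 1) := by
  obtain ⟨s, hs⟩ := exists_section hP
  by_contra! h
  apply h0
  have h1 : untwistMap P (Hom.hom s r) = 0 :=
    eq_zero_of_forall_rid fun ξ => h (s ≫ untwistHom P ξ)
  have h2 : Hom.hom s r = (0 : H 1 ⊗[k] P) := by
    rw [← twistMap_untwistMap_of_homog hr.homog s, h1, map_zero]
  have h3 := hom_congr hs r
  simp only [comp_hom, LinearMap.comp_apply, id_hom, LinearMap.id_apply] at h3
  rw [← h3]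
  erw [h2]
  rw [map_zero, map_zero]

/-- The coordinates of the untwisted image of r under the section are semiinvariants of H_1, hence
multiples of h. The untwisted image is thus h ⊗ p, the image itself is h · (1 ⊗ p), and projecting
back to P gives r = h · p. -/
theorem IsSemiinvariant.exists_eq_act {r : P} (hr : IsSemiinvariant β P r)
    (hP : Projective P) {h : H 1}
    (hh : ∀ c, IsSemiinvariant β (regular k H) c → ∃ z : k, c = z • h) :
    ∃ p : P, r = P.act 1 h p := by
  obtain ⟨s, hs⟩ := exists_section hP
  obtain ⟨p, hp⟩ : ∃ p : P, untwistMap P (Hom.hom s r) = h ⊗ₜ p := by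
    refine exists_tmul_of_forall_rid fun ξ => hh _ (hr.map (s ≫ untwistHom P ξ))
  refine ⟨p, ?_⟩
  have h2 := twistMap_untwistMap_of_homog hr.homog s
  rw [hp, twistMap_tmul] at h2
  have h3 := hom_congr hs r
  simp only [comp_hom, LinearMap.comp_apply, id_hom, LinearMap.id_apply] at h3
  have h4 := Hom.comm_apply (counitHom k H ▷ P ≫ (λ_ P).hom) 1 h ((1 : H 1) ⊗ₜ[k] p)
  have h5 : Hom.hom (counitHom k H ▷ P ≫ (λ_ P).hom) ((1 : H 1) ⊗ₜ[k] p) = p := by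
    change counit (k := k) (1 : H 1) • p = p
    rw [map_one, one_smul]
  rw [h5] at h4
  rw [← h4, ← h3]
  exact congrArg (Hom.hom (counitHom k H ▷ P ≫ (λ_ P).hom)) h2.symm

end Projective

/-! ### Morphisms out of the unit object as invariants -/

section ContrHom

variable [HopfGroupCoalgebra k H] {P Q : HMod k H}

/-- The morphism `Q → P` obtained from `1 → P ⊗ Q*`. -/
def contrHom (f : unit k H ⟶ tensor P (dual Q)) : Q ⟶ P :=
  (λ_ Q).inv ≫ f ▷ Q ≫ (α_ P (dual Q) Q).hom ≫ P ◁ evHom Q ≫ (ρ_ P).hom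

theorem contrHom_apply (f : unit k H ⟶ tensor P (dual Q)) :
    Hom.hom (contrHom f) = contr P Q (Hom.hom f (1 : k)) := by
  refine LinearMap.ext fun q => ?_
  have e : ∀ t : P ⊗[k] Module.Dual k Q, TensorProduct.rid k P (TensorProduct.map LinearMap.id
      (contractLeft k Q) (TensorProduct.assoc k P (Module.Dual k Q) Q (t ⊗ₜ q))) =
        contr P Q t q := by
    intro t
    induction t with
    | zero => simp
    | add s₁ s₂ h₁ h₂ => simp only [map_add, TensorProduct.add_tmul, LinearMap.add_apply, h₁, h₂]
    | tmul p ξ => simp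
  exact e _

/-- The morphism `1 → V` with value `r`. -/
def invHom {V : HMod k H} (r : V) (hr : IsSemiinvariant counit V r) : unit k H ⟶ V :=
  mkHom (V := unit k H) (LinearMap.toSpanSingleton k V r) fun x c hc a => by
    by_cases h : x = 1
    · subst h
      change unitAct k H 1 a c • r = V.act 1 a (c • r)
      rw [unitAct_one, map_smul, hr a, smul_smul, mul_comm]
    · have : c = 0 := by
        change unitAct k H x 1 c = c at hc
        rw [unitAct_ne h] at hc
        exact hc.symm
      subst this
      exact (congrArg _ (map_zero (unitAct k H x a))).trans (by simp)

theorem invHom_one {V : HMod k H} (r : V) (hr : IsSemiinvariant counit V r) :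
    Hom.hom (invHom r hr) (1 : k) = r := one_smul k r

theorem isSemiinvariant_hom_one {V : HMod k H} (f : unit k H ⟶ V) :
    IsSemiinvariant counit V (Hom.hom f (1 : k)) := fun a => by
  rw [← Hom.comm_apply]
  change Hom.hom f (unitAct k H 1 a 1) = _
  rw [unitAct_one, ← smul_eq_mul, map_smul]

theorem unit_hom_ext {V : HMod k H} {f g : unit k H ⟶ V}
    (h : Hom.hom f (1 : k) = Hom.hom g (1 : k)) : f = g :=
  hom_ext (LinearMap.ext_ring h)

end ContrHom

/-! ### Left cointegrals of H_1 and the modulus -/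

section Cointegral

theorem isLeftCointegral_iff [HopfGroupCoalgebra k H] {c : H 1} :
    IsLeftCointegral k c ↔ IsSemiinvariant counit (regular k H) c :=
  isSemiinvariant_regular.symm

/-- A dimension count. For a left cointegral c and ξ ∈ H_1*, the tensor c · (1 ⊗ ξ) is an invariant
of H_1 ⊗ H_1*, that is, an endomorphism of the regular module, determined by its value at 1. For two
cointegrals c and d the pairs (ξ, η) form a space of twice the dimension of H_1, so some non-zero
pair gives the zero endomorphism. Untwisting then yields c ⊗ ξ + d ⊗ η = 0. -/
theorem _root_.ModTrace.IsLeftCointegral.exists_eq_smul [HopfGroupCoalgebra k H] {c d : H 1}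
    (hc : IsLeftCointegral k c) (hd : IsLeftCointegral k d) (h0 : c ≠ 0) :
    ∃ z : k, d = z • c := by
  let R := regular k H
  let D := dual R
  let θ (c : H 1) : Module.Dual k (H 1) →ₗ[k] H 1 →ₗ[k] H 1 :=
    contr (H 1) (H 1) ∘ₗ twistMap D ∘ₗ TensorProduct.mk k (H 1) (Module.Dual k (H 1)) c
  have hθ : ∀ c, IsLeftCointegral k c → ∀ ξ x, θ c ξ x = x * θ c ξ 1 := by
    intro c hc ξ x
    have hinv : IsSemiinvariant counit (tensor R D) (twistMap D (c ⊗ₜ ξ)) := fun a => by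
      rw [← map_smul, TensorProduct.smul_tmul', ← hc a]
      exact (twistMap_mul D a (c ⊗ₜ ξ)).symm
    -- An invariant of R ⊗ R* is a module endomorphism of R, hence a right multiplication.
    have h1 := hom_regular_apply (contrHom (P := R) (Q := R) (invHom _ hinv)) x
    rw [contrHom_apply, invHom_one] at h1
    exact h1.trans (regularAct_one x _)
  let Φ : Module.Dual k (H 1) × Module.Dual k (H 1) →ₗ[k] H 1 :=
    LinearMap.coprod ((θ c).flip 1) ((θ d).flip 1)
  have hlt : Module.finrank k (H 1) <
      Module.finrank k (Module.Dual k (H 1) × Module.Dual k (H 1)) := by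
    have : Nontrivial (H 1) := ⟨c, 0, h0⟩
    have := Module.finrank_pos (R := k) (M := H 1)
    rw [Module.finrank_prod, Subspace.dual_finrank_eq]
    omega
  obtain ⟨⟨ξ, η⟩, hker, hne⟩ := (Submodule.ne_bot_iff _).1 (LinearMap.ker_ne_bot_of_finrank_lt hlt
    (f := Φ))
  have h1 : θ c ξ + θ d η = 0 := by
    refine LinearMap.ext fun x => ?_
    have h2 : θ c ξ 1 + θ d η 1 = 0 := hker
    rw [LinearMap.add_apply, hθ c hc, hθ d hd, ← mul_add, h2, mul_zero, LinearMap.zero_apply]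
  have h2 : twistMap D (c ⊗ₜ ξ + d ⊗ₜ η) = 0 := by
    apply contr_injective (k := k) (P := H 1) (Q := H 1)
    rw [map_zero, map_add, map_add]
    exact h1
  -- Twisting is injective here because the dual of the regular module is concentrated in degree 1.
  have h3 : TensorProduct.map LinearMap.id (D.act 1 1) (c ⊗ₜ ξ + d ⊗ₜ η) = 0 := by
    rw [← untwistMap_twistMap, h2, map_zero]
  have hD : ∀ ξ : Module.Dual k (H 1), D.act 1 1 ξ = ξ := fun ξ => by
    have := dualAct_apply R (one_mul 1) 1 ξ
    rw [antipode_one] at this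
    refine this.trans (LinearMap.ext fun x => ?_)
    exact congrArg ξ (regular_homog x)
  rw [map_add, TensorProduct.map_tmul, TensorProduct.map_tmul, hD, hD] at h3
  have h4 : ∀ x, ξ x • c + η x • d = 0 := fun x => by
    have := congrArg (fun t => contr (k := k) (H 1) (H 1) t x) h3
    simp only [LinearMap.id_apply, map_add, map_zero, LinearMap.zero_apply, LinearMap.add_apply] at this
    exact this
  -- If η were zero, then ξ ≠ 0 and c ⊗ ξ = 0 with c ≠ 0, a contradiction. So d can be solved for.
  have hη : η ≠ 0 := by
    rintro rfl
    have hξ : ξ ≠ 0 := fun e => hne (by rw [e]; rfl)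
    obtain ⟨x, hx⟩ := DFunLike.ne_iff.1 hξ
    have := h4 x
    rw [LinearMap.zero_apply, zero_smul, add_zero] at this
    exact (smul_ne_zero hx h0) this
  obtain ⟨x, hx⟩ := DFunLike.ne_iff.1 hη
  refine ⟨-(η x)⁻¹ * ξ x, ?_⟩
  have := eq_neg_of_add_eq_zero_right (h4 x)
  rw [mul_smul, neg_smul, ← smul_neg, ← this, smul_smul, inv_mul_cancel₀ hx, one_smul]

variable [PivotalHopfGroupCoalgebra k H]

variable (k H) in
-- The module H_1 ⊗ H_1* is projective and contains the invariant coev(1), non-zero because it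
-- contracts to the identity of H_1. A morphism to H_1 that does not kill it sends it to a non-zero
-- left cointegral.
theorem exists_leftCointegral : ∃ c : H 1, IsLeftCointegral k c ∧ c ≠ 0 := by
  let R := regular k H
  have hP : Projective (tensor R (dual R)) :=
    projective_tensor_right R (dual R) projective_regular
  have hinv := isSemiinvariant_hom_one (coevHom R)
  obtain ⟨s, hs⟩ := hinv.exists_hom_ne_zero hP fun e => by
    have h := contr_coevaluation (k := k) (Q := H 1)
    have e' : coevaluation k (H 1) 1 = 0 := e
    rw [e', map_zero] at h
    have : (1 : H 1) = 0 := (LinearMap.congr_fun h (1 : H 1)).symm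
    have h2 := congrArg (counit (k := k) (H := H)) this
    simp at h2
  exact ⟨_, isLeftCointegral_iff.2 (hinv.map s), hs⟩

theorem _root_.ModTrace.IsLeftCointegral.mul_right {c : H 1} (hc : IsLeftCointegral k c) (b : H 1) :
    IsLeftCointegral k (c * b) := fun a => by
  rw [← mul_assoc, hc a, smul_mul_assoc]

variable (k H) in
-- For a left cointegral c, the product c b is again a left cointegral, hence equals α(b) c.
-- Cancelling c ≠ 0 shows that α is an algebra map.
theorem exists_isModulus : ∃ α : H 1 →ₐ[k] k, IsModulus α := by
  obtain ⟨c, hc, h0⟩ := exists_leftCointegral k H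
  have hinj : Function.Injective fun z : k => z • c := smul_left_injective k h0
  choose α hα using fun b => hc.exists_eq_smul (hc.mul_right b) h0
  let α' : H 1 →ₐ[k] k := AlgHom.ofLinearMap
    { toFun := α
      map_add' := fun a b => hinj (by simp only [add_smul, ← hα, mul_add])
      map_smul' := fun z a => hinj (by
        simp only [RingHom.id_apply, smul_eq_mul, mul_smul, ← hα, mul_smul_comm]) }
    (hinj (by change α 1 • c = (1 : k) • c; rw [← hα, mul_one, one_smul]))
    (fun a b => hinj (by
      change α (a * b) • c = (α a * α b) • c
      rw [← hα, mul_smul, smul_comm, ← hα, ← mul_assoc, hα a, smul_mul_assoc, hα b, smul_comm]))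
  refine ⟨α', ⟨c, hc, h0⟩, fun d hd b => ?_⟩
  obtain ⟨z, rfl⟩ := hc.exists_eq_smul hd h0
  rw [smul_mul_assoc, hα, smul_comm]
  rfl

end Cointegral

/-! ### Semiinvariants of weight ν⁻¹ in H_1 -/

section SemiinvariantGenerator

variable [PivotalHopfGroupCoalgebra k H]

theorem counit_rightHook (ν : H 1 →ₐ[k] k) (a : H 1) :
    counit (k := k) (rightHook ν 1 a) = ν a := by
  have e : ∀ s : H 1 ⊗[k] H 1, counit (k := k) (TensorProduct.lid k (H 1)
      (TensorProduct.map ν.toLinearMap LinearMap.id s)) = ν (TensorProduct.rid k (H 1)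
        (TensorProduct.map LinearMap.id (counit (k := k)).toLinearMap s)) := by
    intro s
    induction s with
    | zero => simp
    | add s₁ s₂ h₁ h₂ => simp only [map_add, h₁, h₂]
    | tmul b d => simp [mul_comm]
  rw [rightHook_apply, e, counit_right]

theorem rightHook_injective (ν : H 1 →ₐ[k] k) : Function.Injective (rightHook ν 1) :=
  Function.LeftInverse.injective (rightHook_rightHook (conv_hookInv_right ν) 1)

/-- The space of semiinvariants of weight `ν⁻¹` in `H 1` is one-dimensional; it consists of
right cointegrals if and only if `ν` is the modulus. -/
theorem exists_semiinvariant_generator {α : H 1 →ₐ[k] k} (hα : IsModulus α) (ν : H 1 →ₐ[k] k) :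
    ∃ h : H 1, h ≠ 0 ∧ IsSemiinvariant (hookInv ν) (regular k H) h ∧
      (∀ c, IsSemiinvariant (hookInv ν) (regular k H) c → ∃ z : k, c = z • h) ∧
      ((∀ b, h * b = counit (k := k) b • h) ↔ ν = α) := by
  obtain ⟨c, hc, h0⟩ := hα.1
  have r1 := rightHook_rightHook (conv_hookInv_left ν) 1
  have r2 := rightHook_rightHook (conv_hookInv_right ν) 1
  -- The generator is R(ν)(c). The algebra automorphism R(ν), with inverse R(ν⁻¹), transports the
  -- left weight ε to ε ∘ R(ν⁻¹) = ν⁻¹ and the right weight α to α ∘ R(ν⁻¹), the convolution ν⁻¹ *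
  -- α; the latter is ε exactly when ν = α.
  have hmul : ∀ b, rightHook ν 1 c * b = α (rightHook (hookInv ν) 1 b) • rightHook ν 1 c := by
    intro b
    conv_lhs => rw [← r1 b]
    rw [← map_mul, hα.2 c hc, map_smul]
  have hne : rightHook ν 1 c ≠ 0 := fun e => h0 (rightHook_injective ν (e.trans (map_zero _).symm))
  refine ⟨rightHook ν 1 c, hne, ?_, ?_, ?_⟩
  · rw [isSemiinvariant_regular]
    intro a
    conv_lhs => rw [← r1 a]
    rw [← map_mul, hc, map_smul, ← conv_hookInv_right ν, r1]
  · intro d hd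
    rw [isSemiinvariant_regular] at hd
    have hd' : IsLeftCointegral k (rightHook (hookInv ν) 1 d) := fun a => by
      conv_lhs => rw [← r2 a]
      rw [← map_mul, hd, map_smul, conv_hookInv_right]
    obtain ⟨z, hz⟩ := hc.exists_eq_smul hd' h0
    exact ⟨z, by rw [← map_smul, ← hz, r1]⟩
  · constructor
    · intro h
      ext b
      have := smul_left_injective k hne ((h (rightHook ν 1 b)).symm.trans (hmul _))
      rw [r2] at this
      rw [← this, counit_rightHook]
    · rintro rfl b
      rw [hmul, conv_hookInv_left]

end SemiinvariantGenerator

end HMod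

namespace HMod

variable {k : Type u} [Field k] {G : Type v} [Group G] {H : G → Type u}
  [∀ x, Ring (H x)] [∀ x, Algebra k (H x)]

/-! ### Traces for a twist φ_*, reduced to one scalar on the regular module -/

section TwistTrace

/-- The endofunctor `φ_*` of the category of projective modules. -/
def projTwist (φ : ∀ x, H x →ₐ[k] H x)
    (hφ : ∀ P : Proj (HMod k H), Projective ((twist φ).obj P.obj)) :
    Proj (HMod k H) ⥤ Proj (HMod k H) :=
  ObjectProperty.lift _ ((isProjective _).ι ⋙ twist φ) hφ

variable {φ : ∀ x, H x →ₐ[k] H x}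
  {hφ : ∀ P : Proj (HMod k H), Projective ((twist φ).obj P.obj)}

/-- The functor `φ_*` on a morphism. -/
def twistHom (φ : ∀ x, H x →ₐ[k] H x) {V W : HMod k H} (u : V ⟶ W) :
    twistObj φ V ⟶ twistObj φ W := (twist φ).map u

/-- The value of a trace on a composition `V → W → φ_* V`. -/
def tracePairing (t : TraceMap k (projTwist φ hφ)) {V : HMod k H} (hV : Projective V)
    {W : HMod k H} (g : V ⟶ W) (f : W ⟶ twistObj φ V) : k :=
  t.tr ⟨V, hV⟩ (ObjectProperty.homMk (g ≫ f : V ⟶ twistObj φ V))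

section

variable (t : TraceMap k (projTwist φ hφ)) {V R W : HMod k H} (hV : Projective V)
  (hR : Projective R)

theorem tracePairing_comp (u : V ⟶ R) (g : R ⟶ W) (f : W ⟶ twistObj φ V) :
    tracePairing t hV (u ≫ g) f = tracePairing t hR g (f ≫ twistHom φ u) :=
  t.cyclic (P := ⟨V, hV⟩) (Q := ⟨R, hR⟩) (ObjectProperty.homMk u)
    (ObjectProperty.homMk (g ≫ f : R ⟶ twistObj φ V))

theorem tracePairing_smul_left (z : k) (g : V ⟶ W) (f : W ⟶ twistObj φ V) :
    tracePairing t hV (z • g) f = z * tracePairing t hV g f :=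
  (congrArg (t.tr ⟨V, hV⟩) (ObjectProperty.hom_ext _ (Linear.smul_comp _ _ _ z g f))).trans
    ((t.tr ⟨V, hV⟩).map_smul z (ObjectProperty.homMk (g ≫ f : V ⟶ twistObj φ V)))

theorem tracePairing_smul_right (z : k) (g : V ⟶ W) (f : W ⟶ twistObj φ V) :
    tracePairing t hV g (z • f) = z * tracePairing t hV g f :=
  (congrArg (t.tr ⟨V, hV⟩) (ObjectProperty.hom_ext _ (Linear.comp_smul _ _ _ g z f))).trans
    ((t.tr ⟨V, hV⟩).map_smul z (ObjectProperty.homMk (g ≫ f : V ⟶ twistObj φ V)))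

end

variable [HopfGroupCoalgebra k H]

/-- All the pairings of a trace are equivalent to pairings
`Hom(R, 1) × Hom(1, φ_* R) → k`. -/
def ReducesToUnit (t : TraceMap k (projTwist φ hφ)) : Prop :=
  ∀ P Q : Proj (HMod k H), ∃ (R : HMod k H) (hR : Projective R) (gb : (P ⟶ Q) → (R ⟶ unit k H))
    (fb : (Q ⟶ (projTwist φ hφ).obj P) → (unit k H ⟶ twistObj φ R)),
    Function.Surjective gb ∧ Function.Surjective fb ∧ (∀ g, gb g = 0 → g = 0) ∧
      (∀ f, fb f = 0 → f = 0) ∧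
        ∀ g f, t.tr P (g ≫ f) = tracePairing t hR (gb g) (fb f)

variable {β : H 1 →ₐ[k] k}

/-- Invariants of φ_* V and semiinvariants of weight β in V agree: β ∘ φ_1 = ε gives one direction,
surjectivity of φ_1 the other. -/
theorem isSemiinvariant_of_twist (hβ : ∀ a, β (φ 1 a) = counit a)
    (hs : Function.Surjective (φ 1)) {V : HMod k H} {r : V}
    (hr : IsSemiinvariant counit (twistObj φ V) r) : IsSemiinvariant β V r := fun a => by
  obtain ⟨b, rfl⟩ := hs a
  rw [hβ]
  exact hr b

theorem IsSemiinvariant.twist (hβ : ∀ a, β (φ 1 a) = counit a) {V : HMod k H} {r : V}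
    (hr : IsSemiinvariant β V r) : IsSemiinvariant counit (twistObj φ V) r := fun a => by
  rw [← hβ]
  exact hr _

variable [∀ x, Module.Finite k (H x)]

variable {h : H 1}

/-- Cyclicity moves g to the other side, from P to the regular module, where the invariant f becomes
g(f(1)) = z h. All pairings with the unit object are thus multiples of a single scalar τ, the
pairing of ε with h. -/
theorem tracePairing_lift (hβ : ∀ a, β (φ 1 a) = counit a)
    (t : TraceMap k (projTwist φ hφ)) {P : HMod k H} (hP : Projective P)
    (hh : IsSemiinvariant β (regular k H) h)
    (g : P ⟶ regular k H) (f : unit k H ⟶ twistObj φ P) {z : k}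
    (hz : Hom.hom g (Hom.hom f (1 : k)) = z • h) :
    tracePairing t hP (g ≫ counitHom k H) f = z * tracePairing t projective_regular
      (counitHom k H) (invHom (V := twistObj φ (regular k H)) h (hh.twist hβ)) := by
  rw [← tracePairing_smul_right]
  refine (tracePairing_comp t hP projective_regular g _ f).trans ?_
  congr 1
  apply unit_hom_ext
  refine Eq.trans hz ?_
  rw [smul_hom, LinearMap.smul_apply, invHom_one]

/-- Right multiplication by b sends h to some z h and composes with ε to ε(b) ε. Evaluating the same
pairing in both ways gives ε(b) τ = z τ, and τ can be cancelled. -/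
theorem mul_eq_counit_smul_of_tracePairing_ne_zero (hβ : ∀ a, β (φ 1 a) = counit a)
    (t : TraceMap k (projTwist φ hφ)) (hh : IsSemiinvariant β (regular k H) h)
    (hspan : ∀ c, IsSemiinvariant β (regular k H) c → ∃ z : k, c = z • h)
    (hne : tracePairing t projective_regular
      (counitHom k H) (invHom (V := twistObj φ (regular k H)) h (hh.twist hβ)) ≠ 0) (b : H 1) :
    h * b = counit (k := k) b • h := by
  have e1 : ∀ a, Hom.hom (orbHom (regular k H) b) a = (a * b : H 1) := fun a => regularAct_one a b
  obtain ⟨z, hz⟩ := hspan _ (hh.map (orbHom (regular k H) b))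
  have h1 := tracePairing_lift hβ t projective_regular hh (orbHom (regular k H) b)
    (invHom (V := twistObj φ (regular k H)) h (hh.twist hβ)) (z := z) (by rw [invHom_one]; exact hz)
  have e2 : orbHom (regular k H) b ≫ counitHom k H = counit (k := k) b • counitHom k H := by
    apply hom_ext
    ext a
    change counit (k := k) (Hom.hom (orbHom (regular k H) b) a) = counit (k := k) b * counit a
    rw [e1, map_mul, mul_comm]
  rw [e2] at h1
  have h2 := mul_right_cancel₀ hne ((tracePairing_smul_left t _ _ _ _).symm.trans h1)
  rw [h2, ← e1]
  exact hz

theorem tracePairing_eq_zero (hβ : ∀ a, β (φ 1 a) = counit a)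
    (hs : Function.Surjective (φ 1))
    (t : TraceMap k (projTwist φ hφ)) (hh : IsSemiinvariant β (regular k H) h)
    (hspan : ∀ c, IsSemiinvariant β (regular k H) c → ∃ z : k, c = z • h)
    (h0 : tracePairing t projective_regular
      (counitHom k H) (invHom (V := twistObj φ (regular k H)) h (hh.twist hβ)) = 0)
    {P : HMod k H} (hP : Projective P) (g : P ⟶ unit k H) (f : unit k H ⟶ twistObj φ P) :
    tracePairing t hP g f = 0 := by
  obtain ⟨g', rfl⟩ := exists_lift_counitHom hP g
  obtain ⟨z, hz⟩ := hspan _ ((isSemiinvariant_of_twist hβ hs (isSemiinvariant_hom_one f)).map g')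
  rw [tracePairing_lift hβ t hP hh g' f hz, h0, mul_zero]

/-- Some morphism s : P → H_1 does not kill f(1) and sends it to z h with z ≠ 0; the partner ε ∘ s
pairs with f to z τ. -/
theorem exists_tracePairing_ne_zero_left (hβ : ∀ a, β (φ 1 a) = counit a)
    (hs : Function.Surjective (φ 1))
    (t : TraceMap k (projTwist φ hφ)) (hh : IsSemiinvariant β (regular k H) h)
    (hspan : ∀ c, IsSemiinvariant β (regular k H) c → ∃ z : k, c = z • h)
    (hne : tracePairing t projective_regular
      (counitHom k H) (invHom (V := twistObj φ (regular k H)) h (hh.twist hβ)) ≠ 0)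
    {P : HMod k H} (hP : Projective P) (f : unit k H ⟶ twistObj φ P) (hf : f ≠ 0) :
    ∃ g : P ⟶ unit k H, tracePairing t hP g f ≠ 0 := by
  have hr := isSemiinvariant_of_twist hβ hs (isSemiinvariant_hom_one f)
  obtain ⟨s, hs0⟩ := hr.exists_hom_ne_zero hP fun e => hf (unit_hom_ext e)
  obtain ⟨z, hz⟩ := hspan _ (hr.map s)
  refine ⟨s ≫ counitHom k H, ?_⟩
  rw [tracePairing_lift hβ t hP hh s f hz]
  refine mul_ne_zero (fun e => hs0 ?_) hne
  rw [hz, e, zero_smul]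

/-- If g(p) ≠ 0, the partner is the invariant h · p of φ_* P, which pairs with g to g(p) τ. -/
theorem exists_tracePairing_ne_zero_right (hβ : ∀ a, β (φ 1 a) = counit a)
    (t : TraceMap k (projTwist φ hφ)) (hh : IsSemiinvariant β (regular k H) h)
    (hne : tracePairing t projective_regular
      (counitHom k H) (invHom (V := twistObj φ (regular k H)) h (hh.twist hβ)) ≠ 0)
    {P : HMod k H} (hP : Projective P) (g : P ⟶ unit k H) (hg : g ≠ 0) :
    ∃ f : unit k H ⟶ twistObj φ P, tracePairing t hP g f ≠ 0 := by
  obtain ⟨p, hp⟩ : ∃ p, Hom.hom g p ≠ (0 : k) := by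
    by_contra! e
    exact hg (hom_ext (LinearMap.ext e))
  let f₀ := invHom (V := twistObj φ (regular k H)) h (hh.twist hβ)
  refine ⟨f₀ ≫ twistHom φ (orbHom P p), ?_⟩
  have e : orbHom P p ≫ g = (Hom.hom g p : k) • counitHom k H := by
    apply hom_ext
    ext a
    change Hom.hom g (P.act 1 a p) = (Hom.hom g p : k) * counit a
    rw [Hom.comm_apply, mul_comm]
    exact unitAct_one a _
  rw [← tracePairing_comp t projective_regular hP (orbHom P p) g f₀, e,
    tracePairing_smul_left]
  exact mul_ne_zero hp hne

theorem ReducesToUnit.tracePairing_ne_zero (hβ : ∀ a, β (φ 1 a) = counit a)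
    (hs : Function.Surjective (φ 1))
    {t : TraceMap k (projTwist φ hφ)} (ht : ReducesToUnit t) (h0 : t.IsNonzero)
    (hh : IsSemiinvariant β (regular k H) h)
    (hspan : ∀ c, IsSemiinvariant β (regular k H) c → ∃ z : k, c = z • h) :
    tracePairing t projective_regular
      (counitHom k H) (invHom (V := twistObj φ (regular k H)) h (hh.twist hβ)) ≠ 0 := by
  intro e
  obtain ⟨P, f, hf⟩ := h0
  obtain ⟨R, hR, gb, fb, -, -, -, -, H⟩ := ht P P
  apply hf
  -- With g the identity, every value t_P(f) is a pairing with the unit object, so all of them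
  -- vanish once τ = 0.
  have := H (𝟙 P) f
  rw [Category.id_comp] at this
  rw [this, tracePairing_eq_zero hβ hs t hh hspan e]

theorem ReducesToUnit.nondegenerate (hβ : ∀ a, β (φ 1 a) = counit a)
    (hs : Function.Surjective (φ 1))
    {t : TraceMap k (projTwist φ hφ)} (ht : ReducesToUnit t) (h0 : t.IsNonzero)
    (hh : IsSemiinvariant β (regular k H) h)
    (hspan : ∀ c, IsSemiinvariant β (regular k H) c → ∃ z : k, c = z • h) :
    t.Nondegenerate := by
  have hne := ht.tracePairing_ne_zero hβ hs h0 hh hspan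
  intro P Q
  obtain ⟨R, hR, gb, fb, gs, fs, gi, fi, H⟩ := ht P Q
  constructor
  · intro f hf
    by_contra hf0
    obtain ⟨g', hg'⟩ := exists_tracePairing_ne_zero_left hβ hs t hh hspan hne hR (fb f)
      fun e => hf0 (fi f e)
    obtain ⟨g, rfl⟩ := gs g'
    exact hg' ((H g f).symm.trans (hf g))
  · intro g hg
    by_contra hg0
    obtain ⟨f', hf'⟩ := exists_tracePairing_ne_zero_right hβ t hh hne hR (gb g)
      fun e => hg0 (gi g e)
    obtain ⟨f, rfl⟩ := fs f'
    exact hf' ((H g f).symm.trans (hg f))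

end TwistTrace

end HMod

/-! ### The action of the pivot on tensor products and duals -/

namespace HMod

variable {k : Type u} [Field k] {G : Type v} [Group G] {H : G → Type u}
  [∀ x, Ring (H x)] [∀ x, Algebra k (H x)]

open PivotalHopfGroupCoalgebra

section PivotAct

variable [PivotalHopfGroupCoalgebra k H]

theorem pivotInvAct_apply_pivotAct (V : HMod k H) (v : V) : pivotInvAct V (pivotAct V v) = v :=
  LinearMap.congr_fun (pivotInvAct_pivotAct V) v

theorem pivotAct_apply_pivotInvAct (V : HMod k H) (v : V) : pivotAct V (pivotInvAct V v) = v :=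
  LinearMap.congr_fun (pivotAct_pivotInvAct V) v

theorem hom_pivotAct {V W : HMod k H} (f : V ⟶ W) (v : V) :
    Hom.hom f (pivotAct V v) = pivotAct W (Hom.hom f v) := by
  have key : Hom.hom f ∘ₗ pivotAct V = pivotAct W ∘ₗ Hom.hom f := by
    refine ext_homog fun x v hv => ?_
    have hv' : W.Homog x (Hom.hom f v) := by rw [Homog, ← Hom.comm_apply, hv]
    rw [LinearMap.comp_apply, LinearMap.comp_apply, pivotAct_homog hv, pivotAct_homog hv',
      Hom.comm_apply]
  exact LinearMap.congr_fun key v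

/-- This is group-likeness of the pivot, Δ(g_{xy}) = g_x ⊗ g_y, on V_x ⊗ W_y. -/
theorem pivotAct_tensor (V W : HMod k H) :
    pivotAct (tensor V W) = TensorProduct.map (pivotAct V) (pivotAct W) := by
  refine ext_homog₂ fun x y v w hv hw => ?_
  refine (pivotAct_homog (hv.tmul hw)).trans ?_
  refine (tensorAct_of_eq rfl hv _).trans ?_
  rw [comul_pivot, TensorProduct.map_tmul, TensorProduct.map_tmul, pivotAct_homog hv,
    pivotAct_homog hw]
  rfl

/-- The action on the dual is through S, and S(g) = g⁻¹. Off the pairs of opposite degrees both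
sides vanish. -/
theorem pivotAct_dual (V : HMod k H) (ξ : Module.Dual k V) :
    pivotAct (dual V) ξ = ξ ∘ₗ pivotInvAct V := by
  have key : pivotAct (dual V) = Module.Dual.transpose (R := k) (pivotInvAct V) := by
    refine ext_homog fun x ξ hξ => ?_
    refine ext_homog fun y v hv => ?_
    rw [pivotAct_homog hξ, Module.Dual.transpose_apply, LinearMap.comp_apply,
      pivotInvAct_homog hv]
    by_cases h : x * y = 1
    · obtain rfl : x = y⁻¹ := eq_inv_of_mul_eq_one_left h
      exact LinearMap.congr_fun (dualAct_apply V h _ ξ) v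
    · rw [hξ.dual_apply (homog_act y _ v) h]
      exact ((dual V).homog_act x _ ξ).dual_apply hv h
  exact LinearMap.congr_fun key ξ

theorem pivotAct_dual_apply (V : HMod k H) (ξ : Module.Dual k V) (v : V) :
    (pivotAct (dual V) ξ : Module.Dual k V) (pivotAct V v) = ξ v := by
  rw [pivotAct_dual, LinearMap.comp_apply, pivotInvAct_apply_pivotAct]

end PivotAct

section DualMap

variable [HopfGroupCoalgebra k H]

/-- The transpose of a morphism. -/
def dualHom {V W : HMod k H} (f : V ⟶ W) : dual W ⟶ dual V where
  hom := Module.Dual.transpose (R := k) (Hom.hom f)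
  comm x a ξ := by
    change (dualAct W x a ξ) ∘ₗ Hom.hom f = dualAct V x a (ξ ∘ₗ Hom.hom f)
    rw [dualAct_apply W (mul_inv_cancel x), dualAct_apply V (mul_inv_cancel x)]
    ext v
    simp [Hom.comm_apply]

end DualMap

/-! ### Dividing by a two-sided semiinvariant h -/

section Scaling

variable [HopfGroupCoalgebra k H] [∀ x, Module.Finite k (H x)]

/-- A linear form on a projective module `R` that maps `h · p` to `g(p)`, if `κ(h) = 1` and `h`
is a right cointegral. -/
def scaling {R : HMod k H} (hR : Projective R) (g : R ⟶ unit k H) (κ : Module.Dual k (H 1)) :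
    R →ₗ[k] k :=
  κ ∘ₗ Hom.hom (exists_lift_counitHom hR g).choose

/-- A lift γ : R → H_1 of g satisfies γ(h p) = h γ(p) = ε(γ(p)) h = g(p) h, on which κ takes the
value g(p). So g(p) depends on h p only, which makes the modified trace well defined. -/
theorem scaling_act {R : HMod k H} (hR : Projective R) (g : R ⟶ unit k H)
    {κ : Module.Dual k (H 1)} {h : H 1} (hmul : ∀ b, h * b = counit (k := k) b • h)
    (hκ : κ h = 1) (p : R) : scaling hR g κ (R.act 1 h p) = Hom.hom g p := by
  have e := hom_congr (exists_lift_counitHom hR g).choose_spec p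
  rw [← e, scaling, LinearMap.comp_apply, Hom.comm_apply]
  change κ (regularAct k H 1 h _) = counit (k := k) (_ : H 1)
  rw [regularAct_one, hmul, map_smul, hκ, smul_eq_mul, mul_one]

theorem isSemiinvariant_act {β : H 1 →ₐ[k] k} {h : H 1}
    (hh : IsSemiinvariant β (regular k H) h) {V : HMod k H} (v : V) :
    IsSemiinvariant β V (V.act 1 h v) := fun a => by
  rw [← Module.End.mul_apply, ← act_mul, isSemiinvariant_regular.1 hh a, map_smul,
    LinearMap.smul_apply]

end Scaling

/-! ### The right partial trace in coordinates -/

section RightPartialTrace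

variable [PivotalHopfGroupCoalgebra k H]

/-- The right partial trace of an endomorphism of the vector space `P ⊗ V`. -/
def ptrRight (P V : HMod k H) : (P ⊗[k] V →ₗ[k] P ⊗[k] V) →ₗ[k] P →ₗ[k] P :=
  ∑ i, LinearMap.llcomp k P (P ⊗[k] V) P ((TensorProduct.rid k P).toLinearMap ∘ₗ
      TensorProduct.map LinearMap.id ((Module.Basis.ofVectorSpace k V).coord i ∘ₗ pivotAct V)) ∘ₗ
    (LinearMap.llcomp k P (P ⊗[k] V) (P ⊗[k] V)).flip
      ((TensorProduct.mk k P V).flip (Module.Basis.ofVectorSpace k V i))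

theorem ptrRight_apply (P V : HMod k H) (f : P ⊗[k] V →ₗ[k] P ⊗[k] V) (p : P) :
    ptrRight P V f p = ∑ i, TensorProduct.rid k P (TensorProduct.map LinearMap.id
      ((Module.Basis.ofVectorSpace k V).coord i ∘ₗ pivotAct V)
        (f (p ⊗ₜ Module.Basis.ofVectorSpace k V i))) := by
  simp [ptrRight]

/-- The value on rank-one endomorphisms, which span all of them; the pivot comes from tev. -/
theorem ptrRight_contr (P V : HMod k H) (p' : P) (v : V) (θ : Module.Dual k (P ⊗[k] V)) (p : P) :
    ptrRight P V (contr _ _ ((p' ⊗ₜ v) ⊗ₜ θ)) p = θ (p ⊗ₜ pivotAct V v) • p' := by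
  rw [ptrRight_apply]
  conv_rhs => rw [← (Module.Basis.ofVectorSpace k V).sum_repr (pivotAct V v)]
  simp [TensorProduct.tmul_sum, Finset.sum_smul, smul_smul, mul_comm]

theorem rightPartialTrace_apply (ν : H 1 →ₐ[k] k) (P : Proj (HMod k H)) (V : HMod k H)
    (f : tensor P.obj V ⟶ twistObj (rightHook ν) (tensor P.obj V)) (p : P.obj) :
    Hom.hom (rightPartialTrace (rightTwist ν) P V (ObjectProperty.homMk f)).hom p =
      ptrRight P.obj V (Hom.hom f) p := by
  have e : Hom.hom (rightPartialTrace (rightTwist ν) P V (ObjectProperty.homMk f)).hom p =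
      TensorProduct.rid k P.obj (TensorProduct.map LinearMap.id (Hom.hom (TwoSidedDuals.tev V))
        (TensorProduct.assoc k P.obj V (Module.Dual k V) (TensorProduct.map (Hom.hom f)
          LinearMap.id ((TensorProduct.assoc k P.obj V (Module.Dual k V)).symm
            (p ⊗ₜ[k] (Hom.hom (TwoSidedDuals.coev V) (1 : k))))))) := rfl
  have e' : ∀ (s : P.obj ⊗[k] V) (ξ : Module.Dual k V), TensorProduct.rid k P.obj
      (TensorProduct.map LinearMap.id (Hom.hom (TwoSidedDuals.tev V))
        (TensorProduct.assoc k P.obj V (Module.Dual k V) (s ⊗ₜ ξ))) =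
      TensorProduct.rid k P.obj (TensorProduct.map LinearMap.id (ξ ∘ₗ pivotAct V) s) := by
    intro s ξ
    induction s with
    | zero => simp
    | add s₁ s₂ h₁ h₂ => simp only [TensorProduct.add_tmul, map_add, h₁, h₂]
    | tmul p v =>
      simp only [TensorProduct.assoc_tmul, TensorProduct.map_tmul, LinearMap.id_apply,
        LinearMap.comp_apply]
      rw [tev_apply]
  rw [e, coev_apply, ptrRight_apply, TensorProduct.tmul_sum]
  simp only [map_sum]
  refine Finset.sum_congr rfl fun i _ => ?_
  rw [← e']
  rfl

end RightPartialTrace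

/-! ### Reduction of right module traces to the unit object -/

section RightReduction

variable [PivotalHopfGroupCoalgebra k H] [∀ x, Module.Finite k (H x)] {ν : H 1 →ₐ[k] k} {P Q : HMod k H}

/-- The linear map underlying a morphism to a twisted module. -/
def twistLin {φ : ∀ x, H x →ₐ[k] H x} (f : Q ⟶ twistObj φ P) : Q →ₗ[k] P :=
  Hom.hom (V := Q) (W := twistObj φ P) f

/-- The morphism `1 → R(ν)_* (P ⊗ Q*)` corresponding to `Q → R(ν)_* P`. -/
def rightMate (f : Q ⟶ twistObj (rightHook ν) P) :
    unit k H ⟶ twistObj (rightHook ν) (tensor P (dual Q)) :=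
  coevHom Q ≫ tensorMap f (𝟙 (dual Q)) ≫ (rightTwistIso ν P (dual Q)).inv

theorem rightMate_one (f : Q ⟶ twistObj (rightHook ν) P) :
    Hom.hom (rightMate f) (1 : k) = contrSymm (twistLin f) := rfl

theorem rightMate_surjective : Function.Surjective (rightMate (ν := ν) (P := P) (Q := Q)) := by
  intro F
  refine ⟨contrHom (P := twistObj (rightHook ν) P) (F ≫ (rightTwistIso ν P (dual Q)).hom),
    unit_hom_ext ?_⟩
  rw [rightMate_one]
  refine (congrArg contrSymm (contrHom_apply (P := twistObj (rightHook ν) P)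
    (F ≫ (rightTwistIso ν P (dual Q)).hom))).trans ?_
  exact contrSymm_contr _

theorem eq_zero_of_rightMate_eq_zero (f : Q ⟶ twistObj (rightHook ν) P)
    (h : rightMate f = 0) : f = 0 := by
  apply hom_ext
  have e : contrSymm (twistLin f) = 0 := by
    rw [← rightMate_one, h]
    rfl
  refine (contr_contrSymm (twistLin f)).symm.trans ?_
  rw [e]
  exact map_zero _

/-- The morphism `P ⊗ Q* → 1` corresponding to `P → Q`. -/
def rightComate (g : P ⟶ Q) : tensor P (dual Q) ⟶ unit k H :=
  tensorMap g (𝟙 (dual Q)) ≫ TwoSidedDuals.tev Q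

theorem rightComate_apply (g : P ⟶ Q) (p : P) (ξ : Module.Dual k Q) :
    Hom.hom (rightComate g) (p ⊗ₜ[k] ξ) = ξ (pivotAct Q (Hom.hom g p)) := rfl

/-- Up to unitors, this is the tensor-hom adjunction for the duality pairing of Q* and Q given by
tev. -/
theorem rightComate_surjective : Function.Surjective (rightComate (k := k) (P := P) (Q := Q)) := by
  intro G
  let : ExactPairing (dual Q) Q := TwoSidedDuals.pairing' Q
  refine ⟨tensorRightHomEquiv P (dual Q) Q (𝟙_ (HMod k H)) G ≫ (λ_ Q).hom, ?_⟩
  have e : ∀ g : P ⟶ 𝟙_ (HMod k H) ⊗ Q, rightComate (g ≫ (λ_ Q).hom) =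
      (tensorRightHomEquiv P (dual Q) Q (𝟙_ (HMod k H))).symm g := by
    intro g
    change (g ≫ (λ_ Q).hom) ▷ dual Q ≫ ε_ (dual Q) Q = _
    simp [tensorRightHomEquiv, ← unitors_equal]
  rw [e, Equiv.symm_apply_apply]

theorem eq_zero_of_rightComate_eq_zero (g : P ⟶ Q) (h : rightComate g = 0) : g = 0 := by
  apply hom_ext
  ext p
  have e : pivotAct Q (Hom.hom g p) = 0 := by
    refine (Module.forall_dual_apply_eq_zero_iff k _).1 fun ξ => ?_
    rw [← rightComate_apply, h]
    rfl
  rw [← pivotInvAct_apply_pivotAct Q (Hom.hom g p), e, map_zero]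
  rfl

/-- On a simple tensor p' ⊗ η, the pivot from tev on Q and the pivot from the partial trace over Q*
cancel, as (g η)(g q) = η(q). -/
theorem ptrRight_comate_mate (g : P ⟶ Q) (f : Q ⟶ twistObj (rightHook ν) P) (p : P) :
    ptrRight P (dual Q) (Hom.hom (V := tensor P (dual Q))
      (W := twistObj (rightHook ν) (tensor P (dual Q))) (rightComate g ≫ rightMate f)) p =
        Hom.hom f (Hom.hom g p) := by
  have e : ∀ x : P ⊗[k] Module.Dual k Q, ptrRight P (dual Q)
      (contr _ _ (x ⊗ₜ Hom.hom (rightComate g))) p = contr P Q x (Hom.hom g p) := by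
    intro x
    induction x with
    | zero => simp
    | add s₁ s₂ h₁ h₂ => simp only [map_add, TensorProduct.add_tmul, LinearMap.add_apply, h₁, h₂]
    | tmul p' η => rw [ptrRight_contr, rightComate_apply, pivotAct_dual_apply, contr_tmul]
  have e1 : (Hom.hom (V := tensor P (dual Q))
      (W := twistObj (rightHook ν) (tensor P (dual Q))) (rightComate g ≫ rightMate f)) =
      contr (P ⊗[k] Module.Dual k Q) (P ⊗[k] Module.Dual k Q)
        (contrSymm (twistLin f) ⊗ₜ
          Hom.hom (rightComate g)) := by
    refine LinearMap.ext fun s => ?_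
    rw [contr_tmul, ← rightMate_one]
    change Hom.hom (rightMate f) (Hom.hom (rightComate g) s : k) = _
    refine Eq.trans ?_ ((Hom.hom (rightMate f)).map_smul (Hom.hom (rightComate g) s : k) (1 : k))
    rw [smul_eq_mul, mul_one]
  rw [e1]
  refine (e _).trans ?_
  rw [contr_contrSymm]
  rfl

/-- The composite P ⊗ Q* → 1 → Σ(P ⊗ Q*) built from g and f has right partial trace f ∘ g over Q*,
so the module trace property identifies the two traces. -/
theorem reducesToUnit_right (t : TraceMap k (rightTwist (H := H) ν))
    (ht : t.IsRightModuleTrace (HMod k H)) :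
    ReducesToUnit (φ := rightHook ν) (hφ := fun P => ((rightTwist ν).obj P).property) t := by
  intro P Q
  refine ⟨tensor P.obj (dual Q.obj), projective_tensor_right P.obj (dual Q.obj) P.property,
    fun g => rightComate g.hom, fun f => rightMate f.hom, ?_, ?_, ?_, ?_, ?_⟩
  · intro G
    obtain ⟨g, hg⟩ := rightComate_surjective G
    exact ⟨ObjectProperty.homMk g, hg⟩
  · intro F
    obtain ⟨f, hf⟩ := rightMate_surjective F
    exact ⟨ObjectProperty.homMk f, hf⟩
  · exact fun g hg => ObjectProperty.hom_ext _ (eq_zero_of_rightComate_eq_zero g.hom hg)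
  · exact fun f hf => ObjectProperty.hom_ext _ (eq_zero_of_rightMate_eq_zero f.hom hf)
  · intro g f
    refine Eq.trans ?_ (ht P (dual Q.obj) (ObjectProperty.homMk (rightComate g.hom ≫
      rightMate f.hom : _ ⟶ twistObj (rightHook ν) (tensor P.obj (dual Q.obj))))).symm
    congr 1
    refine ObjectProperty.hom_ext _ (hom_ext (LinearMap.ext fun p => ?_))
    exact (ptrRight_comate_mate g.hom f.hom p).symm.trans
      (rightPartialTrace_apply ν P _ _ p).symm

end RightReduction

end HMod

/-! ### Construction of the right module trace -/

namespace HMod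

variable {k : Type u} [Field k] {G : Type v} [Group G] {H : G → Type u}
  [∀ x, Ring (H x)] [∀ x, Algebra k (H x)] [∀ x, Module.Finite k (H x)]
  [PivotalHopfGroupCoalgebra k H]

theorem contr_map_dual {P P' Q : Type u} [AddCommGroup P] [Module k P] [AddCommGroup P']
    [Module k P'] [AddCommGroup Q] [Module k Q] (g : P' →ₗ[k] Q)
    (s : P ⊗[k] Module.Dual k Q) :
    contr P P' (TensorProduct.map LinearMap.id (Module.Dual.transpose (R := k) g) s) =
      contr P Q s ∘ₗ g := by
  induction s with
  | zero => simp
  | add s₁ s₂ h₁ h₂ => simp only [map_add, h₁, h₂, LinearMap.add_comp]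
  | tmul p ξ => ext; simp [Module.Dual.transpose_apply]

variable (ν : H 1 →ₐ[k] k)

theorem rightHook_surjective : Function.Surjective (rightHook ν 1) :=
  Function.RightInverse.surjective (rightHook_rightHook (conv_hookInv_left ν) 1)

section RightPartial

variable (P V : HMod k H)

/-- The morphism `v ⊗ θ ↦ θ(- ⊗ g v)`. -/
def rightPartialEval : tensor V (dual (tensor P V)) ⟶ dual P :=
  (λ_ (V ⊗ dual (tensor P V))).inv ≫ TwoSidedDuals.tcoev P ▷ (V ⊗ dual (tensor P V)) ≫
    (α_ (dual P) P (V ⊗ dual (tensor P V))).hom ≫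
      dual P ◁ ((α_ P V (dual (tensor P V))).inv ≫ TwoSidedDuals.tev (tensor P V)) ≫
        (ρ_ (dual P)).hom

/-- The map is composed of duality morphisms in order to be a morphism of modules. The factor g⁻¹ on
P in tcoev cancels the factor g on P in tev of P ⊗ V, and only the pivot of V remains. -/
theorem rightPartialEval_apply (v : V) (θ : Module.Dual k (P ⊗[k] V)) (p : P) :
    (Hom.hom (rightPartialEval P V) (v ⊗ₜ[k] θ) : Module.Dual k P) p =
      θ (p ⊗ₜ pivotAct V v) := by
  have e : ∀ t : Module.Dual k P ⊗[k] P, TensorProduct.rid k (Module.Dual k P)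
      (TensorProduct.map LinearMap.id (Hom.hom (TwoSidedDuals.tev (tensor P V)) ∘ₗ
        (TensorProduct.assoc k P V (Module.Dual k (P ⊗[k] V))).symm.toLinearMap)
          (TensorProduct.assoc k (Module.Dual k P) P _ (t ⊗ₜ (v ⊗ₜ θ)))) p =
      θ (contr P P (TensorProduct.comm k _ _
        (TensorProduct.map LinearMap.id (pivotAct P) t)) p ⊗ₜ pivotAct V v) := by
    intro t
    induction t with
    | zero => simp
    | add s₁ s₂ h₁ h₂ =>
      simp only [map_add, TensorProduct.add_tmul, LinearMap.add_apply, h₁, h₂]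
    | tmul ξ q =>
      have e2 : Hom.hom (TwoSidedDuals.tev (tensor P V)) ((q ⊗ₜ[k] v) ⊗ₜ[k] θ) =
          θ (pivotAct P q ⊗ₜ pivotAct V v) := by
        rw [tev_apply, pivotAct_tensor, TensorProduct.map_tmul]
      simp only [TensorProduct.assoc_tmul, TensorProduct.map_tmul, LinearMap.comp_apply,
        LinearEquiv.coe_coe, TensorProduct.assoc_symm_tmul, TensorProduct.comm_tmul,
        LinearMap.id_apply, contr_tmul, e2]
      simp [← TensorProduct.smul_tmul', mul_comm]
  refine (e (Hom.hom (TwoSidedDuals.tcoev P) (1 : k))).trans ?_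
  congr 2
  rw [tcoev_apply]
  simp only [map_sum, TensorProduct.map_tmul, TensorProduct.comm_tmul,
    pivotAct_apply_pivotInvAct, LinearMap.id_apply, LinearMap.sum_apply, contr_tmul]
  exact (Module.Basis.ofVectorSpace k P).sum_repr p

/-- The right partial trace as a morphism `(P ⊗ V) ⊗ (P ⊗ V)* → P ⊗ P*`. -/
def rightPartialHom : tensor (tensor P V) (dual (tensor P V)) ⟶ tensor P (dual P) :=
  (associatorIso P V (dual (tensor P V))).hom ≫ tensorMap (𝟙 P) (rightPartialEval P V)

theorem rightPartialHom_apply (p : P) (v : V) (θ : Module.Dual k (P ⊗[k] V)) :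
    Hom.hom (rightPartialHom P V) ((p ⊗ₜ[k] v) ⊗ₜ[k] θ) =
      p ⊗ₜ Hom.hom (rightPartialEval P V) (v ⊗ₜ[k] θ) := rfl

/-- The partial trace of linear endomorphisms is thus induced by a module morphism, so it commutes
with the action of h. -/
theorem contr_rightPartialHom (s : (P ⊗[k] V) ⊗[k] Module.Dual k (P ⊗[k] V)) :
    contr P P (Hom.hom (rightPartialHom P V) s) = ptrRight P V (contr _ _ s) := by
  have key : contr P P ∘ₗ Hom.hom (rightPartialHom P V) = ptrRight P V ∘ₗ contr _ _ := by
    refine TensorProduct.ext_threefold fun p v θ => LinearMap.ext fun q => ?_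
    simp only [LinearMap.comp_apply]
    rw [ptrRight_contr, rightPartialHom_apply, contr_tmul, rightPartialEval_apply]
  exact LinearMap.congr_fun key s

/-- Both sides send (p ⊗ v) ⊗ θ to θ(g p ⊗ g v). This is the module trace property before division
by h. -/
theorem tev_rightPartialHom (s : (P ⊗[k] V) ⊗[k] Module.Dual k (P ⊗[k] V)) :
    Hom.hom (TwoSidedDuals.tev P) (Hom.hom (rightPartialHom P V) s) =
      Hom.hom (TwoSidedDuals.tev (tensor P V)) s := by
  have key : Hom.hom (TwoSidedDuals.tev P) ∘ₗ Hom.hom (rightPartialHom P V) =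
      Hom.hom (TwoSidedDuals.tev (tensor P V)) := by
    refine TensorProduct.ext_threefold fun p v θ => ?_
    rw [LinearMap.comp_apply, rightPartialHom_apply, tev_apply, rightPartialEval_apply,
      tev_apply, pivotAct_tensor, TensorProduct.map_tmul]
  exact LinearMap.congr_fun key s

end RightPartial

variable {ν}

theorem isSemiinvariant_contrSymm {P Q : HMod k H} (f : Q ⟶ twistObj (rightHook ν) P) :
    IsSemiinvariant (hookInv ν) (tensor P (dual Q)) (contrSymm (twistLin f)) :=
  isSemiinvariant_of_twist (conv_hookInv_right ν) (rightHook_surjective ν)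
    (isSemiinvariant_hom_one (rightMate f))

variable {h : H 1} {κ : Module.Dual k (H 1)}

variable (κ) in
/-- The linear form of the right modified trace, on linear endomorphisms. -/
def rightForm {P : HMod k H} (hP : Projective P) : (P →ₗ[k] P) →ₗ[k] k :=
  scaling (projective_tensor_right P (dual P) hP) (TwoSidedDuals.tev P) κ ∘ₗ contrSymm

/-- The form is a linear map chosen through a lift of tev; on endomorphisms of the form h x this
computes it without reference to the lift. -/
theorem rightForm_eq (hmul : ∀ b, h * b = counit (k := k) b • h)
    (hκ : κ h = 1) {P : HMod k H} (hP : Projective P) {f : P →ₗ[k] P}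
    {x : P ⊗[k] Module.Dual k P} (hx : contrSymm f = (tensor P (dual P)).act 1 h x) :
    rightForm κ hP f = Hom.hom (TwoSidedDuals.tev P) x := by
  rw [rightForm, LinearMap.comp_apply, hx]
  exact scaling_act (R := tensor P (dual P)) _ _ hmul hκ x

theorem rightForm_comp (hmul : ∀ b, h * b = counit (k := k) b • h)
    (hspan : ∀ c, IsSemiinvariant (hookInv ν) (regular k H) c → ∃ z : k, c = z • h)
    (hκ : κ h = 1) {P Q : HMod k H} (hP : Projective P) (hQ : Projective Q) (g : P ⟶ Q)
    (f : Q ⟶ twistObj (rightHook ν) P) :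
    rightForm κ hP (twistLin f ∘ₗ Hom.hom g) = rightForm κ hQ (Hom.hom g ∘ₗ twistLin f) := by
  -- One x in P ⊗ Q* serves both sides: f ∘ g and g ∘ f are the images of the tensor of f under id ⊗
  -- g* and g ⊗ id. It remains to compare tev after these two morphisms.
  obtain ⟨x, hx⟩ := (isSemiinvariant_contrSymm f).exists_eq_act
    (projective_tensor_right P (dual Q) hP) hspan
  have e1 : contrSymm (twistLin f ∘ₗ Hom.hom g) = Hom.hom (tensorMap (𝟙 P) (dualHom g))
      (contrSymm (twistLin f)) := by
    apply contr_injective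
    refine (contr_contrSymm _).trans (Eq.trans ?_ (contr_map_dual (Hom.hom g) _).symm)
    rw [contr_contrSymm]
  have e2 : contrSymm (Hom.hom g ∘ₗ twistLin f) = Hom.hom (tensorMap g (𝟙 (dual Q)))
      (contrSymm (twistLin f)) := by
    apply contr_injective
    refine (contr_contrSymm _).trans (Eq.trans ?_ (contr_map (Hom.hom g) _).symm)
    rw [contr_contrSymm]
  rw [hx, Hom.comm_apply] at e1 e2
  rw [rightForm_eq hmul hκ hP e1, rightForm_eq hmul hκ hQ e2]
  have key : Hom.hom (TwoSidedDuals.tev P) ∘ₗ Hom.hom (tensorMap (𝟙 P) (dualHom g)) =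
      Hom.hom (TwoSidedDuals.tev Q) ∘ₗ Hom.hom (tensorMap g (𝟙 (dual Q))) := by
    refine TensorProduct.ext' fun p ξ => ?_
    change (ξ ∘ₗ Hom.hom g) (pivotAct P p) = ξ (pivotAct Q (Hom.hom g p))
    rw [LinearMap.comp_apply, hom_pivotAct]
  exact LinearMap.congr_fun key x

theorem rightForm_ptrRight (hmul : ∀ b, h * b = counit (k := k) b • h)
    (hspan : ∀ c, IsSemiinvariant (hookInv ν) (regular k H) c → ∃ z : k, c = z • h)
    (hκ : κ h = 1) {P V : HMod k H} (hP : Projective P)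
    (f : tensor P V ⟶ twistObj (rightHook ν) (tensor P V)) :
    rightForm κ (projective_tensor_right P V hP) (twistLin f) =
      rightForm κ hP (ptrRight P V (twistLin f)) := by
  obtain ⟨x, hx⟩ := (isSemiinvariant_contrSymm f).exists_eq_act
    (projective_tensor_right _ (dual (tensor P V)) (projective_tensor_right P V hP)) hspan
  -- The tensor of the partial trace is the image of h x under a module morphism, hence h times the
  -- image of x.
  have e : contrSymm (ptrRight P V (twistLin f)) =
      Hom.hom (rightPartialHom P V) (contrSymm (twistLin f)) := by
    apply contr_injective
    rw [contr_contrSymm, contr_rightPartialHom, contr_contrSymm]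
  rw [hx, Hom.comm_apply] at e
  rw [rightForm_eq hmul hκ hP e, rightForm_eq hmul hκ _ hx, tev_rightPartialHom]

/-- The right modified trace. -/
def rightModTrace (hmul : ∀ b, h * b = counit (k := k) b • h)
    (hspan : ∀ c, IsSemiinvariant (hookInv ν) (regular k H) c → ∃ z : k, c = z • h)
    (hκ : κ h = 1) : TraceMap k (rightTwist ν) where
  tr P :=
    { toFun := fun f => rightForm κ P.property (twistLin f.hom)
      map_add' := fun f g =>
        (rightForm κ P.property).map_add (twistLin f.hom) (twistLin g.hom)
      map_smul' := fun z f => (rightForm κ P.property).map_smul z (twistLin f.hom) }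
  cyclic {P Q} g f := rightForm_comp hmul hspan hκ P.property Q.property g.hom f.hom

theorem rightModTrace_isRightModuleTrace (hmul : ∀ b, h * b = counit (k := k) b • h)
    (hspan : ∀ c, IsSemiinvariant (hookInv ν) (regular k H) c → ∃ z : k, c = z • h)
    (hκ : κ h = 1) :
    (rightModTrace hmul hspan hκ).IsRightModuleTrace (HMod k H) := by
  intro P V f
  refine (rightForm_ptrRight hmul hspan hκ P.property f.hom).trans ?_
  refine congrArg (rightForm κ P.property) (LinearMap.ext fun p => ?_)
  exact (rightPartialTrace_apply ν P V f.hom p).symm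

theorem rightModTrace_isNonzero (hmul : ∀ b, h * b = counit (k := k) b • h)
    (hspan : ∀ c, IsSemiinvariant (hookInv ν) (regular k H) c → ∃ z : k, c = z • h)
    (hκ : κ h = 1)
    (hh : IsSemiinvariant (hookInv ν) (regular k H) h) :
    (rightModTrace hmul hspan hκ).IsNonzero := by
  let R := regular k H
  -- The trace of the endomorphism with tensor h · (1 ⊗ ξ) is tev(1 ⊗ ξ) = ξ(g · 1). As g acts
  -- invertibly and 1 ≠ 0 in H_1, some ξ makes it non-zero.
  obtain ⟨ξ, hξ⟩ : ∃ ξ : Module.Dual k (H 1), ξ (pivotAct R (1 : H 1)) ≠ 0 := by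
    by_contra! e
    have e0 : pivotAct R (1 : H 1) = 0 := (Module.forall_dual_apply_eq_zero_iff k _).1 e
    have e1 : (1 : H 1) = 0 := by
      rw [← pivotInvAct_apply_pivotAct R (1 : H 1), e0, map_zero]
    have e2 := congrArg (counit (k := k) (H := H)) e1
    simp at e2
  let x : H 1 ⊗[k] Module.Dual k (H 1) := 1 ⊗ₜ ξ
  have hx := isSemiinvariant_act hh (V := tensor R (dual R)) x
  obtain ⟨f, hf⟩ := rightMate_surjective (ν := ν) (P := R) (Q := R)
    (invHom (V := twistObj (rightHook ν) (tensor R (dual R))) _ (hx.twist (conv_hookInv_right ν)))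
  refine ⟨⟨R, projective_regular⟩, ObjectProperty.homMk f, ?_⟩
  have e : contrSymm (twistLin f) = (tensor R (dual R)).act 1 h x := by
    rw [← rightMate_one, hf]
    exact invHom_one _ _
  have e' := rightForm_eq hmul hκ projective_regular e
  intro h0
  exact hξ (e'.symm.trans h0)

end HMod

/-! ### The left side: contraction of Q* ⊗ P with the pivot -/

namespace HMod

variable {k : Type u} [Field k] {G : Type v} [Group G] {H : G → Type u}
  [∀ x, Ring (H x)] [∀ x, Algebra k (H x)] [∀ x, Module.Finite k (H x)]
  [PivotalHopfGroupCoalgebra k H]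

section LeftContr

theorem pivotInvAct_dual (V : HMod k H) (ξ : Module.Dual k V) :
    pivotInvAct (dual V) ξ = ξ ∘ₗ pivotAct V := by
  have h : pivotAct (dual V) (ξ ∘ₗ pivotAct V : Module.Dual k V) = ξ := by
    rw [pivotAct_dual]
    ext v
    simp [pivotAct_apply_pivotInvAct]
  conv_lhs => rw [← h]
  exact pivotInvAct_apply_pivotAct _ _

/-- The contraction `Q* ⊗ P → Hom(Q, P)`, sending `ξ ⊗ p` to `q ↦ ξ(g q) p`. -/
def leftContr (P Q : HMod k H) : Module.Dual k Q ⊗[k] P →ₗ[k] Q →ₗ[k] P :=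
  LinearMap.lcomp k P (pivotAct Q) ∘ₗ contr P Q ∘ₗ (TensorProduct.comm k _ _).toLinearMap

theorem leftContr_apply {P Q : HMod k H} (s : Module.Dual k Q ⊗[k] P) :
    leftContr P Q s = contr P Q (TensorProduct.comm k _ _ s) ∘ₗ pivotAct Q := rfl

theorem leftContr_tmul {P Q : HMod k H} (ξ : Module.Dual k Q) (p : P) (q : Q) :
    leftContr P Q (ξ ⊗ₜ p) q = ξ (pivotAct Q q) • p := by
  rw [leftContr_apply, LinearMap.comp_apply, TensorProduct.comm_tmul, contr_tmul]

theorem leftContr_injective (P Q : HMod k H) : Function.Injective (leftContr P Q) := by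
  intro s t e
  apply (TensorProduct.comm k _ _).injective
  apply contr_injective
  refine LinearMap.ext fun q => ?_
  have := LinearMap.congr_fun e (pivotInvAct Q q)
  simpa only [leftContr_apply, LinearMap.comp_apply, pivotAct_apply_pivotInvAct] using this

/-- The element of `Q* ⊗ P` corresponding to a linear map `Q → P`. -/
def leftContrSymm {P Q : HMod k H} : (Q →ₗ[k] P) →ₗ[k] Module.Dual k Q ⊗[k] P where
  toFun f := TensorProduct.map LinearMap.id f (Hom.hom (TwoSidedDuals.tcoev Q) (1 : k))
  map_add' f g := by rw [TensorProduct.map_add_right, LinearMap.add_apply]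
  map_smul' z f := by rw [TensorProduct.map_smul_right, LinearMap.smul_apply, RingHom.id_apply]

theorem leftContrSymm_apply {P Q : HMod k H} (f : Q →ₗ[k] P) : leftContrSymm f =
    TensorProduct.map LinearMap.id f (Hom.hom (TwoSidedDuals.tcoev Q) (1 : k)) := rfl

theorem leftContr_map {P P' Q : HMod k H} (f : P →ₗ[k] P') (s : Module.Dual k Q ⊗[k] P) :
    leftContr P' Q (TensorProduct.map LinearMap.id f s) = f ∘ₗ leftContr P Q s := by
  induction s with
  | zero => simp
  | add s₁ s₂ h₁ h₂ => simp only [map_add, h₁, h₂, LinearMap.comp_add]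
  | tmul ξ p => exact LinearMap.ext fun q => by simp [leftContr_tmul]

theorem leftContr_leftContrSymm {P Q : HMod k H} (f : Q →ₗ[k] P) :
    leftContr P Q (leftContrSymm f) = f := by
  -- The pivot in the contraction cancels the inverse pivot in tcoev(1).
  have h : leftContr Q Q (Hom.hom (TwoSidedDuals.tcoev Q) (1 : k)) = LinearMap.id := by
    refine LinearMap.ext fun q => ?_
    rw [tcoev_apply, map_sum, LinearMap.sum_apply]
    simp only [leftContr_tmul, Module.Basis.coord_apply]
    simp only [← map_smul, ← map_sum]
    rw [Module.Basis.sum_repr]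
    exact pivotInvAct_apply_pivotAct Q q
  rw [leftContrSymm_apply, leftContr_map, h, LinearMap.comp_id]

theorem leftContr_map_dual {P P' Q : HMod k H} (g : P' ⟶ Q) (s : Module.Dual k Q ⊗[k] P) :
    leftContr P P' (TensorProduct.map (Module.Dual.transpose (R := k) (Hom.hom g))
      LinearMap.id s) = leftContr P Q s ∘ₗ Hom.hom g := by
  induction s with
  | zero => simp
  | add s₁ s₂ h₁ h₂ => simp only [map_add, h₁, h₂, LinearMap.add_comp]
  | tmul ξ p =>
    refine LinearMap.ext fun q => ?_
    rw [TensorProduct.map_tmul, leftContr_tmul, LinearMap.comp_apply, leftContr_tmul,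
      ← hom_pivotAct]
    rfl

end LeftContr

/-! ### The left partial trace in coordinates -/

section LeftPartialTrace

/-- The left partial trace of an endomorphism of the vector space `V ⊗ P`. -/
def ptrLeft (V P : HMod k H) : (V ⊗[k] P →ₗ[k] V ⊗[k] P) →ₗ[k] P →ₗ[k] P :=
  ∑ i, LinearMap.llcomp k P (V ⊗[k] P) P ((TensorProduct.lid k P).toLinearMap ∘ₗ
      TensorProduct.map ((Module.Basis.ofVectorSpace k V).coord i) LinearMap.id) ∘ₗ
    (LinearMap.llcomp k P (V ⊗[k] P) (V ⊗[k] P)).flip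
      (TensorProduct.mk k V P (pivotInvAct V (Module.Basis.ofVectorSpace k V i)))

theorem ptrLeft_apply (V P : HMod k H) (f : V ⊗[k] P →ₗ[k] V ⊗[k] P) (p : P) :
    ptrLeft V P f p = ∑ i, TensorProduct.lid k P (TensorProduct.map
      ((Module.Basis.ofVectorSpace k V).coord i) LinearMap.id
        (f (pivotInvAct V (Module.Basis.ofVectorSpace k V i) ⊗ₜ p))) := by
  simp [ptrLeft]

theorem ptrLeft_contr (V P : HMod k H) (v : V) (p' : P) (θ : Module.Dual k (V ⊗[k] P)) (p : P) :
    ptrLeft V P (contr _ _ ((v ⊗ₜ p') ⊗ₜ θ)) p = θ (pivotInvAct V v ⊗ₜ p) • p' := by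
  rw [ptrLeft_apply]
  conv_rhs => rw [← (Module.Basis.ofVectorSpace k V).sum_repr v]
  simp [TensorProduct.sum_tmul, Finset.sum_smul, smul_smul, mul_comm, ← TensorProduct.smul_tmul']

theorem leftPartialTrace_apply (ν : H 1 →ₐ[k] k) (V : HMod k H) (P : Proj (HMod k H))
    (f : tensor V P.obj ⟶ twistObj (leftHook ν) (tensor V P.obj)) (p : P.obj) :
    Hom.hom (leftPartialTrace (leftTwist ν) V P (ObjectProperty.homMk f)).hom p =
      ptrLeft V P.obj (Hom.hom f) p := by
  have e : Hom.hom (leftPartialTrace (leftTwist ν) V P (ObjectProperty.homMk f)).hom p =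
      TensorProduct.lid k P.obj (TensorProduct.map (Hom.hom (TwoSidedDuals.ev V)) LinearMap.id
        ((TensorProduct.assoc k (Module.Dual k V) V P.obj).symm (TensorProduct.map LinearMap.id
          (Hom.hom f) (TensorProduct.assoc k (Module.Dual k V) V P.obj
            ((Hom.hom (TwoSidedDuals.tcoev V) (1 : k)) ⊗ₜ[k] p))))) := rfl
  have e' : ∀ (ξ : Module.Dual k V) (s : V ⊗[k] P.obj), TensorProduct.lid k P.obj
      (TensorProduct.map (Hom.hom (TwoSidedDuals.ev V)) LinearMap.id
        ((TensorProduct.assoc k (Module.Dual k V) V P.obj).symm (ξ ⊗ₜ s))) =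
      TensorProduct.lid k P.obj (TensorProduct.map ξ LinearMap.id s) := by
    intro ξ s
    induction s with
    | zero => simp
    | add s₁ s₂ h₁ h₂ => simp only [TensorProduct.tmul_add, map_add, h₁, h₂]
    | tmul v p =>
      simp only [TensorProduct.assoc_symm_tmul, TensorProduct.map_tmul, LinearMap.id_apply]
      rw [ev_apply]
  rw [e, tcoev_apply, ptrLeft_apply, TensorProduct.sum_tmul]
  simp only [map_sum]
  refine Finset.sum_congr rfl fun i _ => ?_
  rw [← e']
  rfl

end LeftPartialTrace

/-! ### Reduction of left module traces to the unit object -/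

section LeftReduction

variable {ν : H 1 →ₐ[k] k} {P Q : HMod k H}

/-- The morphism `1 → L(ν)_* (Q* ⊗ P)` corresponding to `Q → L(ν)_* P`. -/
def leftMate (f : Q ⟶ twistObj (leftHook ν) P) :
    unit k H ⟶ twistObj (leftHook ν) (tensor (dual Q) P) :=
  TwoSidedDuals.tcoev Q ≫ tensorMap (𝟙 (dual Q)) f ≫ (leftTwistIso ν (dual Q) P).inv

theorem leftMate_one (f : Q ⟶ twistObj (leftHook ν) P) :
    Hom.hom (leftMate f) (1 : k) = leftContrSymm (twistLin f) := rfl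

/-- The tensor-hom adjunction for the pairing of Q* and Q, up to unitors; the mates are bijective
because tcoev belongs to a duality. -/
theorem tcoev_whiskerLeft_surjective (R : HMod k H) :
    Function.Surjective fun f : Q ⟶ R => TwoSidedDuals.tcoev Q ≫ dual Q ◁ f := by
  intro F
  let : ExactPairing (dual Q) Q := TwoSidedDuals.pairing' Q
  refine ⟨(ρ_ Q).inv ≫ (tensorLeftHomEquiv (𝟙_ (HMod k H)) (dual Q) Q R).symm F, ?_⟩
  have e : ∀ f : Q ⊗ 𝟙_ (HMod k H) ⟶ R, TwoSidedDuals.tcoev Q ≫ dual Q ◁ ((ρ_ Q).inv ≫ f) =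
      tensorLeftHomEquiv (𝟙_ (HMod k H)) (dual Q) Q R f := by
    intro f
    change η_ (dual Q) Q ≫ dual Q ◁ ((ρ_ Q).inv ≫ f) = _
    simp [tensorLeftHomEquiv, unitors_inv_equal]
  exact (e _).trans (Equiv.apply_symm_apply _ _)

theorem leftMate_surjective : Function.Surjective (leftMate (ν := ν) (P := P) (Q := Q)) := by
  intro F
  obtain ⟨f, hf⟩ := tcoev_whiskerLeft_surjective (Q := Q) (twistObj (leftHook ν) P)
    (F ≫ (leftTwistIso ν (dual Q) P).hom)
  refine ⟨f, ?_⟩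
  have := congrArg (fun u => u ≫ (leftTwistIso ν (dual Q) P).inv) hf
  simp only [Category.assoc, Iso.hom_inv_id, Category.comp_id] at this
  exact this

theorem eq_zero_of_leftMate_eq_zero (f : Q ⟶ twistObj (leftHook ν) P)
    (h : leftMate f = 0) : f = 0 := by
  apply hom_ext
  have e : leftContrSymm (twistLin f) = 0 := by
    rw [← leftMate_one, h]
    rfl
  refine (leftContr_leftContrSymm (twistLin f)).symm.trans ?_
  rw [e]
  exact map_zero _

/-- The morphism `Q* ⊗ P → 1` corresponding to `P → Q`. -/
def leftComate (g : P ⟶ Q) : tensor (dual Q) P ⟶ unit k H :=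
  tensorMap (𝟙 (dual Q)) g ≫ TwoSidedDuals.ev Q

theorem leftComate_apply (g : P ⟶ Q) (ξ : Module.Dual k Q) (p : P) :
    Hom.hom (leftComate g) (ξ ⊗ₜ[k] p) = ξ (Hom.hom g p) :=
  ev_apply Q ξ (Hom.hom g p)

theorem leftComate_surjective : Function.Surjective (leftComate (k := k) (P := P) (Q := Q)) := by
  intro G
  let : ExactPairing Q (dual Q) := TwoSidedDuals.pairing Q
  refine ⟨tensorLeftHomEquiv P Q (dual Q) (𝟙_ (HMod k H)) G ≫ (ρ_ Q).hom, ?_⟩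
  have e : ∀ g : P ⟶ Q ⊗ 𝟙_ (HMod k H), leftComate (g ≫ (ρ_ Q).hom) =
      (tensorLeftHomEquiv P Q (dual Q) (𝟙_ (HMod k H))).symm g := by
    intro g
    change dual Q ◁ (g ≫ (ρ_ Q).hom) ≫ ε_ Q (dual Q) = _
    simp [tensorLeftHomEquiv, unitors_equal]
  rw [e, Equiv.symm_apply_apply]

theorem eq_zero_of_leftComate_eq_zero (g : P ⟶ Q) (h : leftComate g = 0) : g = 0 := by
  apply hom_ext
  ext p
  refine (Module.forall_dual_apply_eq_zero_iff k _).1 fun ξ => ?_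
  rw [← leftComate_apply, h]
  rfl

/-- The partial trace over Q* inserts g⁻¹ acting on η, and g⁻¹ η = η ∘ g; this is the pivot built
into `leftContr`. -/
theorem ptrLeft_comate_mate (g : P ⟶ Q) (f : Q ⟶ twistObj (leftHook ν) P) (p : P) :
    ptrLeft (dual Q) P (Hom.hom (V := tensor (dual Q) P)
      (W := twistObj (leftHook ν) (tensor (dual Q) P)) (leftComate g ≫ leftMate f)) p =
        Hom.hom f (Hom.hom g p) := by
  have e : ∀ x : Module.Dual k Q ⊗[k] P, ptrLeft (dual Q) P
      (contr _ _ (x ⊗ₜ Hom.hom (leftComate g))) p = leftContr P Q x (Hom.hom g p) := by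
    intro x
    induction x with
    | zero => simp
    | add s₁ s₂ h₁ h₂ => simp only [map_add, TensorProduct.add_tmul, LinearMap.add_apply, h₁, h₂]
    | tmul η p' =>
      rw [ptrLeft_contr, leftComate_apply, pivotInvAct_dual, leftContr_tmul]
      rfl
  have e1 : (Hom.hom (V := tensor (dual Q) P)
      (W := twistObj (leftHook ν) (tensor (dual Q) P)) (leftComate g ≫ leftMate f)) =
      contr (Module.Dual k Q ⊗[k] P) (Module.Dual k Q ⊗[k] P)
        (leftContrSymm (twistLin f) ⊗ₜ Hom.hom (leftComate g)) := by
    refine LinearMap.ext fun s => ?_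
    rw [contr_tmul, ← leftMate_one]
    change Hom.hom (leftMate f) (Hom.hom (leftComate g) s : k) = _
    refine Eq.trans ?_ ((Hom.hom (leftMate f)).map_smul (Hom.hom (leftComate g) s : k) (1 : k))
    rw [smul_eq_mul, mul_one]
  rw [e1]
  refine (e _).trans ?_
  rw [leftContr_leftContrSymm]
  rfl

theorem reducesToUnit_left (t : TraceMap k (leftTwist (H := H) ν))
    (ht : t.IsLeftModuleTrace (HMod k H)) :
    ReducesToUnit (φ := leftHook ν) (hφ := fun P => ((leftTwist ν).obj P).property) t := by
  intro P Q
  refine ⟨tensor (dual Q.obj) P.obj, projective_tensor_left (dual Q.obj) P.obj P.property,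
    fun g => leftComate g.hom, fun f => leftMate f.hom, ?_, ?_, ?_, ?_, ?_⟩
  · intro G
    obtain ⟨g, hg⟩ := leftComate_surjective G
    exact ⟨ObjectProperty.homMk g, hg⟩
  · intro F
    obtain ⟨f, hf⟩ := leftMate_surjective F
    exact ⟨ObjectProperty.homMk f, hf⟩
  · exact fun g hg => ObjectProperty.hom_ext _ (eq_zero_of_leftComate_eq_zero g.hom hg)
  · exact fun f hf => ObjectProperty.hom_ext _ (eq_zero_of_leftMate_eq_zero f.hom hf)
  · intro g f
    refine Eq.trans ?_ (ht (dual Q.obj) P (ObjectProperty.homMk (leftComate g.hom ≫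
      leftMate f.hom : _ ⟶ twistObj (leftHook ν) (tensor (dual Q.obj) P.obj)))).symm
    congr 1
    refine ObjectProperty.hom_ext _ (hom_ext (LinearMap.ext fun p => ?_))
    exact (ptrLeft_comate_mate g.hom f.hom p).symm.trans
      (leftPartialTrace_apply ν _ P _ p).symm

end LeftReduction

theorem leftHook_surjective (ν : H 1 →ₐ[k] k) : Function.Surjective (leftHook ν 1) :=
  Function.RightInverse.surjective (leftHook_leftHook (conv_hookInv_right ν) 1)

/-- L(ν) transports ε to the same weight ν⁻¹ as R(ν). The same generator h therefore governs left
and right traces, and both single out the same ν. -/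
theorem hookInv_leftHook (ν : H 1 →ₐ[k] k) (a : H 1) :
    hookInv ν (leftHook ν 1 a) = counit (k := k) a :=
  (leftHook_one _ _ a).trans (conv_hookInv_left ν a)

/-! ### Construction of the left module trace -/

section LeftPartial

variable (V P : HMod k H)

/-- The morphism `θ ⊗ v ↦ θ(v ⊗ -)`. -/
def leftPartialEval : tensor (dual (tensor V P)) V ⟶ dual P :=
  (ρ_ (dual (tensor V P) ⊗ V)).inv ≫ (dual (tensor V P) ⊗ V) ◁ TwoSidedDuals.coev P ≫
    (α_ (dual (tensor V P) ⊗ V) P (dual P)).inv ≫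
      ((α_ (dual (tensor V P)) V P).hom ≫ TwoSidedDuals.ev (tensor V P)) ▷ dual P ≫
        (λ_ (dual P)).hom

theorem leftPartialEval_apply (θ : Module.Dual k (V ⊗[k] P)) (v : V) (p : P) :
    (Hom.hom (leftPartialEval V P) (θ ⊗ₜ[k] v) : Module.Dual k P) p = θ (v ⊗ₜ p) := by
  have e : ∀ t : P ⊗[k] Module.Dual k P, TensorProduct.lid k (Module.Dual k P)
      (TensorProduct.map (Hom.hom (TwoSidedDuals.ev (tensor V P)) ∘ₗ
        (TensorProduct.assoc k (Module.Dual k (V ⊗[k] P)) V P).toLinearMap) LinearMap.id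
          ((TensorProduct.assoc k _ P (Module.Dual k P)).symm ((θ ⊗ₜ v) ⊗ₜ t))) p =
      θ (v ⊗ₜ contr P P t p) := by
    intro t
    induction t with
    | zero => simp
    | add s₁ s₂ h₁ h₂ =>
      simp only [map_add, TensorProduct.tmul_add, LinearMap.add_apply, h₁, h₂]
    | tmul q ξ =>
      have e2 : Hom.hom (TwoSidedDuals.ev (tensor V P)) (θ ⊗ₜ[k] (v ⊗ₜ[k] q)) =
          θ (v ⊗ₜ q) := ev_apply (tensor V P) θ _
      simp only [TensorProduct.assoc_tmul, TensorProduct.map_tmul, LinearMap.comp_apply,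
        LinearEquiv.coe_coe, TensorProduct.assoc_symm_tmul, LinearMap.id_apply, contr_tmul, e2]
      simp [mul_comm]
  refine (e (Hom.hom (TwoSidedDuals.coev P) (1 : k))).trans ?_
  congr 2
  exact LinearMap.congr_fun contr_coevaluation p

/-- The left partial trace as a morphism `(V ⊗ P)* ⊗ (V ⊗ P) → P* ⊗ P`. -/
def leftPartialHom : tensor (dual (tensor V P)) (tensor V P) ⟶ tensor (dual P) P :=
  (associatorIso (dual (tensor V P)) V P).inv ≫ tensorMap (leftPartialEval V P) (𝟙 P)

theorem leftPartialHom_apply (θ : Module.Dual k (V ⊗[k] P)) (v : V) (p : P) :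
    Hom.hom (leftPartialHom V P) (θ ⊗ₜ[k] (v ⊗ₜ[k] p)) =
      Hom.hom (leftPartialEval V P) (θ ⊗ₜ[k] v) ⊗ₜ p := rfl

theorem ext_threefold_right {U V W X : Type u} [AddCommGroup U] [Module k U] [AddCommGroup V]
    [Module k V] [AddCommGroup W] [Module k W] [AddCommGroup X] [Module k X]
    {f g : U ⊗[k] (V ⊗[k] W) →ₗ[k] X}
    (h : ∀ u v w, f (u ⊗ₜ (v ⊗ₜ w)) = g (u ⊗ₜ (v ⊗ₜ w))) : f = g := by
  refine TensorProduct.ext (LinearMap.ext fun u => TensorProduct.ext' fun v w => h u v w)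

/-- On θ ⊗ (v ⊗ p), the contraction puts the pivot of V ⊗ P into θ and the partial trace puts g⁻¹ on
v. By group-likeness only the pivot on P survives, as in the contraction of P* ⊗ P. -/
theorem leftContr_leftPartialHom (s : Module.Dual k (V ⊗[k] P) ⊗[k] (V ⊗[k] P)) :
    leftContr P P (Hom.hom (leftPartialHom V P) s) =
      ptrLeft V P (leftContr (tensor V P) (tensor V P) s) := by
  have key : leftContr P P ∘ₗ Hom.hom (leftPartialHom V P) =
      ptrLeft V P ∘ₗ leftContr (tensor V P) (tensor V P) := by
    refine ext_threefold_right fun θ v p => LinearMap.ext fun q => ?_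
    have e : leftContr (tensor V P) (tensor V P) (θ ⊗ₜ (v ⊗ₜ p)) = contr (V ⊗[k] P) (V ⊗[k] P)
        ((v ⊗ₜ p) ⊗ₜ (θ ∘ₗ pivotAct (tensor V P))) := by
      refine LinearMap.ext fun s => ?_
      rw [leftContr_tmul, contr_tmul]
      rfl
    simp only [LinearMap.comp_apply]
    rw [e, ptrLeft_contr, leftPartialHom_apply, leftContr_tmul, leftPartialEval_apply,
      LinearMap.comp_apply, pivotAct_tensor, TensorProduct.map_tmul, pivotAct_apply_pivotInvAct]
  exact LinearMap.congr_fun key s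

theorem ev_leftPartialHom (s : Module.Dual k (V ⊗[k] P) ⊗[k] (V ⊗[k] P)) :
    Hom.hom (TwoSidedDuals.ev P) (Hom.hom (leftPartialHom V P) s) =
      Hom.hom (TwoSidedDuals.ev (tensor V P)) s := by
  have key : Hom.hom (TwoSidedDuals.ev P) ∘ₗ Hom.hom (leftPartialHom V P) =
      Hom.hom (TwoSidedDuals.ev (tensor V P)) := by
    refine ext_threefold_right fun θ v p => ?_
    rw [LinearMap.comp_apply, leftPartialHom_apply, ev_apply, leftPartialEval_apply]
    exact (ev_apply (tensor V P) θ _).symm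
  exact LinearMap.congr_fun key s

end LeftPartial

section LeftTrace

variable {ν : H 1 →ₐ[k] k} {h : H 1} {κ : Module.Dual k (H 1)}

theorem isSemiinvariant_leftContrSymm {P Q : HMod k H} (f : Q ⟶ twistObj (leftHook ν) P) :
    IsSemiinvariant (hookInv ν) (tensor (dual Q) P) (leftContrSymm (twistLin f)) :=
  isSemiinvariant_of_twist (hookInv_leftHook ν) (leftHook_surjective ν)
    (isSemiinvariant_hom_one (leftMate f))

variable (κ) in
/-- The linear form of the left modified trace, on linear endomorphisms. -/
def leftForm {P : HMod k H} (hP : Projective P) : (P →ₗ[k] P) →ₗ[k] k :=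
  scaling (projective_tensor_left (dual P) P hP) (TwoSidedDuals.ev P) κ ∘ₗ leftContrSymm

theorem leftForm_eq (hmul : ∀ b, h * b = counit (k := k) b • h)
    (hκ : κ h = 1) {P : HMod k H} (hP : Projective P) {f : P →ₗ[k] P}
    {x : Module.Dual k P ⊗[k] P} (hx : leftContrSymm f = (tensor (dual P) P).act 1 h x) :
    leftForm κ hP f = Hom.hom (TwoSidedDuals.ev P) x := by
  rw [leftForm, LinearMap.comp_apply, hx]
  exact scaling_act (R := tensor (dual P) P) _ _ hmul hκ x

theorem leftForm_comp (hmul : ∀ b, h * b = counit (k := k) b • h)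
    (hspan : ∀ c, IsSemiinvariant (hookInv ν) (regular k H) c → ∃ z : k, c = z • h)
    (hκ : κ h = 1) {P Q : HMod k H} (hP : Projective P) (hQ : Projective Q) (g : P ⟶ Q)
    (f : Q ⟶ twistObj (leftHook ν) P) :
    leftForm κ hP (twistLin f ∘ₗ Hom.hom g) = leftForm κ hQ (Hom.hom g ∘ₗ twistLin f) := by
  -- Here x lies in Q* ⊗ P, and the two cyclic composites are its images under g* ⊗ id and id ⊗ g,
  -- multiplied by h.
  obtain ⟨x, hx⟩ := (isSemiinvariant_leftContrSymm f).exists_eq_act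
    (projective_tensor_left (dual Q) P hP) hspan
  have e1 : leftContrSymm (twistLin f ∘ₗ Hom.hom g) = Hom.hom (tensorMap (dualHom g) (𝟙 P))
      (leftContrSymm (twistLin f)) := by
    apply leftContr_injective
    refine (leftContr_leftContrSymm _).trans (Eq.trans ?_ (leftContr_map_dual g _).symm)
    rw [leftContr_leftContrSymm]
  have e2 : leftContrSymm (Hom.hom g ∘ₗ twistLin f) = Hom.hom (tensorMap (𝟙 (dual Q)) g)
      (leftContrSymm (twistLin f)) := by
    apply leftContr_injective
    refine (leftContr_leftContrSymm _).trans (Eq.trans ?_ (leftContr_map (Hom.hom g) _).symm)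
    rw [leftContr_leftContrSymm]
  rw [hx, Hom.comm_apply] at e1 e2
  rw [leftForm_eq hmul hκ hP e1, leftForm_eq hmul hκ hQ e2]
  have key : Hom.hom (TwoSidedDuals.ev P) ∘ₗ Hom.hom (tensorMap (dualHom g) (𝟙 P)) =
      Hom.hom (TwoSidedDuals.ev Q) ∘ₗ Hom.hom (tensorMap (𝟙 (dual Q)) g) := by
    refine TensorProduct.ext' fun ξ p => ?_
    exact (ev_apply P (ξ ∘ₗ Hom.hom g) p).trans (ev_apply Q ξ (Hom.hom g p)).symm
  exact LinearMap.congr_fun key x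

theorem leftForm_ptrLeft (hmul : ∀ b, h * b = counit (k := k) b • h)
    (hspan : ∀ c, IsSemiinvariant (hookInv ν) (regular k H) c → ∃ z : k, c = z • h)
    (hκ : κ h = 1) {V P : HMod k H} (hP : Projective P)
    (f : tensor V P ⟶ twistObj (leftHook ν) (tensor V P)) :
    leftForm κ (projective_tensor_left V P hP) (twistLin f) =
      leftForm κ hP (ptrLeft V P (twistLin f)) := by
  obtain ⟨x, hx⟩ := (isSemiinvariant_leftContrSymm f).exists_eq_act
    (projective_tensor_left (dual (tensor V P)) _ (projective_tensor_left V P hP)) hspan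
  have e : leftContrSymm (ptrLeft V P (twistLin f)) =
      Hom.hom (leftPartialHom V P) (leftContrSymm (twistLin f)) := by
    apply leftContr_injective
    rw [leftContr_leftContrSymm, leftContr_leftPartialHom, leftContr_leftContrSymm]
  rw [hx, Hom.comm_apply] at e
  rw [leftForm_eq hmul hκ hP e, leftForm_eq hmul hκ _ hx, ev_leftPartialHom]

/-- The left modified trace. -/
def leftModTrace (hmul : ∀ b, h * b = counit (k := k) b • h)
    (hspan : ∀ c, IsSemiinvariant (hookInv ν) (regular k H) c → ∃ z : k, c = z • h)
    (hκ : κ h = 1) : TraceMap k (leftTwist ν) where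
  tr P :=
    { toFun := fun f => leftForm κ P.property (twistLin f.hom)
      map_add' := fun f g =>
        (leftForm κ P.property).map_add (twistLin f.hom) (twistLin g.hom)
      map_smul' := fun z f => (leftForm κ P.property).map_smul z (twistLin f.hom) }
  cyclic {P Q} g f := leftForm_comp hmul hspan hκ P.property Q.property g.hom f.hom

theorem leftModTrace_isLeftModuleTrace (hmul : ∀ b, h * b = counit (k := k) b • h)
    (hspan : ∀ c, IsSemiinvariant (hookInv ν) (regular k H) c → ∃ z : k, c = z • h)
    (hκ : κ h = 1) :
    (leftModTrace hmul hspan hκ).IsLeftModuleTrace (HMod k H) := by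
  intro V P f
  refine (leftForm_ptrLeft hmul hspan hκ P.property f.hom).trans ?_
  refine congrArg (leftForm κ P.property) (LinearMap.ext fun p => ?_)
  exact (leftPartialTrace_apply ν V P f.hom p).symm

theorem leftModTrace_isNonzero (hmul : ∀ b, h * b = counit (k := k) b • h)
    (hspan : ∀ c, IsSemiinvariant (hookInv ν) (regular k H) c → ∃ z : k, c = z • h)
    (hκ : κ h = 1) (hh : IsSemiinvariant (hookInv ν) (regular k H) h) :
    (leftModTrace hmul hspan hκ).IsNonzero := by
  let R := regular k H
  -- As ev contains no pivot, the functional ε suffices: ev(ε ⊗ 1) = ε(1) = 1.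
  let x : Module.Dual k (H 1) ⊗[k] H 1 := (counit (k := k) (H := H)).toLinearMap ⊗ₜ 1
  have hx := isSemiinvariant_act hh (V := tensor (dual R) R) x
  obtain ⟨f, hf⟩ := leftMate_surjective (ν := ν) (P := R) (Q := R)
    (invHom (V := twistObj (leftHook ν) (tensor (dual R) R)) _ (hx.twist (hookInv_leftHook ν)))
  refine ⟨⟨R, projective_regular⟩, ObjectProperty.homMk f, ?_⟩
  have e : leftContrSymm (twistLin f) = (tensor (dual R) R).act 1 h x := by
    rw [← leftMate_one, hf]
    exact invHom_one _ _
  have e' := leftForm_eq hmul hκ projective_regular e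
  have e2 : Hom.hom (TwoSidedDuals.ev R) x = (1 : k) :=
    (ev_apply R _ _).trans (map_one (counit (k := k) (H := H)))
  intro h0
  exact one_ne_zero (e2.symm.trans (e'.symm.trans h0))

end LeftTrace

end HMod

/-! ### Partial traces and morphisms of module functors -/

section PartialTraceTransport

open TwoSidedDuals

variable {C : Type u₁} [Category.{v₁} C] [MonoidalCategory C] [TwoSidedDuals C]
  {M : Type u₂} [Category.{v₂} M] {F F' : M ⥤ M}

open MonoidalRightAction in
-- By h, the transformation u passes through the structure map and becomes u_P acted on by V. It
-- then commutes with the associator, with tev by interchange, and with the unitor.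
theorem rightPartialTrace_comp_app [MonoidalRightAction C M] [F.RightLinear C]
    [F'.RightLinear C] (u : F' ⟶ F) (P : M) (V : C)
    (h : u.app (P ⊙ᵣ V) ≫ Functor.OplaxRightLinear.δᵣ F P V =
      Functor.OplaxRightLinear.δᵣ F' P V ≫ u.app P ⊵ᵣ V)
    (f : P ⊙ᵣ V ⟶ F'.obj (P ⊙ᵣ V)) :
    rightPartialTrace F P V (f ≫ u.app _) = rightPartialTrace F' P V f ≫ u.app P := by
  have e : (u.app P ⊵ᵣ V) ⊵ᵣ dual V ≫ (αᵣ (F.obj P) V (dual V)).inv =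
      (αᵣ (F'.obj P) V (dual V)).inv ≫ u.app P ⊵ᵣ (V ⊗ dual V) := by
    rw [actionHomLeft_tensor, Iso.inv_hom_id_assoc]
  simp only [rightPartialTrace, Category.assoc, h, comp_actionHomLeft]
  rw [reassoc_of% e, ← action_exchange_assoc, ← actionUnitIso_hom_naturality]

open MonoidalLeftAction in
theorem leftPartialTrace_comp_app [MonoidalLeftAction C M] [F.LeftLinear C]
    [F'.LeftLinear C] (u : F' ⟶ F) (V : C) (P : M)
    (h : u.app (V ⊙ₗ P) ≫ Functor.OplaxLeftLinear.δₗ F V P =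
      Functor.OplaxLeftLinear.δₗ F' V P ≫ V ⊴ₗ u.app P)
    (f : V ⊙ₗ P ⟶ F'.obj (V ⊙ₗ P)) :
    leftPartialTrace F V P (f ≫ u.app _) = leftPartialTrace F' V P f ≫ u.app P := by
  have e : dual V ⊴ₗ V ⊴ₗ u.app P ≫ (αₗ (dual V) V (F.obj P)).inv =
      (αₗ (dual V) V (F'.obj P)).inv ≫ (dual V ⊗ V) ⊴ₗ u.app P := by
    rw [tensor_actionHomRight, Iso.inv_hom_id_assoc]
  simp only [leftPartialTrace, Category.assoc, h, actionHomRight_comp]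
  rw [reassoc_of% e, action_exchange_assoc, ← actionUnitIso_hom_naturality]

end PartialTraceTransport

/-! ### The case ν = ε: modified traces -/

section Transport

open ModTrace.HMod

/-- Transport of a trace map along an isomorphism of functors. -/
def TraceMap.ofIso {k : Type u} [Field k] {M : Type u₂} [Category.{v₂} M] [Preadditive M]
    [Linear k M] {F F' : M ⥤ M} (e : F ≅ F') (t : TraceMap k F) : TraceMap k F' where
  tr P := t.tr P ∘ₗ Linear.rightComp k P (e.inv.app P)
  cyclic {P Q} g f := by
    have h := t.cyclic g (f ≫ e.inv.app P)
    simp only [LinearMap.comp_apply, Linear.rightComp_apply, Category.assoc] at h ⊢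
    rw [h, e.inv.naturality]

theorem TraceMap.ofIso_apply {k : Type u} [Field k] {M : Type u₂} [Category.{v₂} M]
    [Preadditive M] [Linear k M] {F F' : M ⥤ M} (e : F ≅ F') (t : TraceMap k F) (P : M)
    (f : P ⟶ F'.obj P) : (t.ofIso e).tr P f = t.tr P (f ≫ e.inv.app P) := rfl

theorem TraceMap.IsNonzero.ofIso {k : Type u} [Field k] {M : Type u₂} [Category.{v₂} M]
    [Preadditive M] [Linear k M] {F F' : M ⥤ M} (e : F ≅ F') {t : TraceMap k F}
    (ht : t.IsNonzero) : (t.ofIso e).IsNonzero := by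
  obtain ⟨P, f, hf⟩ := ht
  refine ⟨P, f ≫ e.hom.app P, ?_⟩
  rwa [TraceMap.ofIso_apply, Category.assoc, Iso.hom_inv_id_app, Category.comp_id]

variable {k : Type u} [Field k] {G : Type v} [Group G] {H : G → Type u}
  [∀ x, Ring (H x)] [∀ x, Algebra k (H x)] [PivotalHopfGroupCoalgebra k H]

theorem rightHook_counit (x : G) (a : H x) : rightHook (counit (k := k)) x a = a := by
  rw [rightHook_apply, counit_left]

theorem leftHook_counit (x : G) (a : H x) : leftHook (counit (k := k)) x a = a := by
  rw [leftHook_apply, counit_right]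

/-- A twist by identity maps is isomorphic to the identity. -/
def twistObjIso {φ : ∀ x, H x →ₐ[k] H x} (h : ∀ x a, φ x a = a) (V : HMod k H) :
    twistObj φ V ≅ V :=
  isoOfEquiv (V := twistObj φ V) (LinearEquiv.refl k V) fun x a v => by simp [h]

variable (k H) in
/-- The functor `R(ε)_*` is isomorphic to the identity. -/
def rightTwistCounitIso : rightTwist (counit : H 1 →ₐ[k] k) ≅ 𝟭 (Proj (HMod k H)) :=
  NatIso.ofComponents (fun P => ObjectProperty.isoMk _ (twistObjIso rightHook_counit P.obj))
    fun _ => rfl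

variable (k H) in
/-- The functor `L(ε)_*` is isomorphic to the identity. -/
def leftTwistCounitIso : leftTwist (counit : H 1 →ₐ[k] k) ≅ 𝟭 (Proj (HMod k H)) :=
  NatIso.ofComponents (fun P => ObjectProperty.isoMk _ (twistObjIso leftHook_counit P.obj))
    fun _ => rfl

variable (k H) in
-- R(ε) = id by the counit axiom, so R(ε)_* is isomorphic to the identity functor by identity maps,
-- and traces are transported both ways.
theorem exists_rightModuleTrace_id_iff :
    (∃ t : TraceMap k (𝟭 (Proj (HMod k H))), t.IsRightModuleTrace (HMod k H) ∧ t.IsNonzero) ↔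
      ∃ t : TraceMap k (rightTwist (counit : H 1 →ₐ[k] k)),
        t.IsRightModuleTrace (HMod k H) ∧ t.IsNonzero := by
  constructor
  · rintro ⟨t, ht, h0⟩
    refine ⟨t.ofIso (rightTwistCounitIso k H).symm, fun P V f => ?_, h0.ofIso _⟩
    -- Compatibility with the module structures says id_{P ⊗ V} = id_P ⊗ id_V, all maps involved
    -- being identities on vector spaces.
    exact (ht P V _).trans (congrArg (t.tr P) (rightPartialTrace_comp_app _ P V
      (ObjectProperty.hom_ext _ (hom_ext (TensorProduct.map_id (R := k) (M := P.obj) (N := V)).symm)) f))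
  · rintro ⟨t, ht, h0⟩
    refine ⟨t.ofIso (rightTwistCounitIso k H), fun P V f => ?_, h0.ofIso _⟩
    exact (ht P V _).trans (congrArg (t.tr P) (rightPartialTrace_comp_app _ P V
      (ObjectProperty.hom_ext _ (hom_ext (TensorProduct.map_id (R := k) (M := P.obj) (N := V)).symm)) f))

variable (k H) in
theorem exists_leftModuleTrace_id_iff :
    (∃ t : TraceMap k (𝟭 (Proj (HMod k H))), t.IsLeftModuleTrace (HMod k H) ∧ t.IsNonzero) ↔
      ∃ t : TraceMap k (leftTwist (counit : H 1 →ₐ[k] k)),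
        t.IsLeftModuleTrace (HMod k H) ∧ t.IsNonzero := by
  constructor
  · rintro ⟨t, ht, h0⟩
    refine ⟨t.ofIso (leftTwistCounitIso k H).symm, fun V P f => ?_, h0.ofIso _⟩
    exact (ht V P _).trans (congrArg (t.tr P) (leftPartialTrace_comp_app _ V P
      (ObjectProperty.hom_ext _ (hom_ext (TensorProduct.map_id (R := k) (M := V) (N := P.obj)).symm)) f))
  · rintro ⟨t, ht, h0⟩
    refine ⟨t.ofIso (leftTwistCounitIso k H), fun V P f => ?_, h0.ofIso _⟩
    exact (ht V P _).trans (congrArg (t.tr P) (leftPartialTrace_comp_app _ V P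
      (ObjectProperty.hom_ext _ (hom_ext (TensorProduct.map_id (R := k) (M := V) (N := P.obj)).symm)) f))

end Transport

/-! ### The classification of module traces -/

section Classification

open ModTrace.HMod

variable {k : Type u} [Field k] {G : Type v} [Group G] {H : G → Type u}
  [∀ x, Ring (H x)] [∀ x, Algebra k (H x)] [∀ x, Module.Finite k (H x)]
  [PivotalHopfGroupCoalgebra k H] {α : H 1 →ₐ[k] k}

theorem IsModulus.exists_rightModuleTrace_iff (hα : IsModulus α) (ν : H 1 →ₐ[k] k) :
    (∃ t : TraceMap k (rightTwist ν), t.IsRightModuleTrace (HMod k H) ∧ t.IsNonzero) ↔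
      ν = α := by
  obtain ⟨h, hne, hh, hspan, hiff⟩ := exists_semiinvariant_generator hα ν
  constructor
  · rintro ⟨t, ht, h0⟩
    exact hiff.1 (mul_eq_counit_smul_of_tracePairing_ne_zero (conv_hookInv_right ν) _ hh hspan
      ((reducesToUnit_right t ht).tracePairing_ne_zero (conv_hookInv_right ν)
        (rightHook_surjective ν) h0 hh hspan))
  · intro e
    -- Any linear form with κ(h) = 1 will do: the trace only evaluates κ on multiples of h.
    obtain ⟨κ, hκ⟩ := Module.Projective.exists_dual_eq_one k hne
    exact ⟨_, rightModTrace_isRightModuleTrace (hiff.2 e) hspan hκ,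
      rightModTrace_isNonzero (hiff.2 e) hspan hκ hh⟩

theorem IsModulus.exists_leftModuleTrace_iff (hα : IsModulus α) (ν : H 1 →ₐ[k] k) :
    (∃ t : TraceMap k (leftTwist ν), t.IsLeftModuleTrace (HMod k H) ∧ t.IsNonzero) ↔
      ν = α := by
  obtain ⟨h, hne, hh, hspan, hiff⟩ := exists_semiinvariant_generator hα ν
  constructor
  · rintro ⟨t, ht, h0⟩
    exact hiff.1 (mul_eq_counit_smul_of_tracePairing_ne_zero (hookInv_leftHook ν) _ hh hspan
      ((reducesToUnit_left t ht).tracePairing_ne_zero (hookInv_leftHook ν)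
        (leftHook_surjective ν) h0 hh hspan))
  · intro e
    obtain ⟨κ, hκ⟩ := Module.Projective.exists_dual_eq_one k hne
    exact ⟨_, leftModTrace_isLeftModuleTrace (hiff.2 e) hspan hκ,
      leftModTrace_isNonzero (hiff.2 e) hspan hκ hh⟩

theorem nondegenerate_of_isRightModuleTrace {ν : H 1 →ₐ[k] k} (t : TraceMap k (rightTwist ν))
    (ht : t.IsRightModuleTrace (HMod k H)) (h0 : t.IsNonzero) : t.Nondegenerate := by
  obtain ⟨α, hα⟩ := exists_isModulus k H
  -- Only the one-dimensionality of the space of semiinvariants is needed, so ν = α does not have to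
  -- be derived first.
  obtain ⟨h, -, hh, hspan, -⟩ := exists_semiinvariant_generator hα ν
  exact (reducesToUnit_right t ht).nondegenerate (conv_hookInv_right ν)
    (rightHook_surjective ν) h0 hh hspan

theorem nondegenerate_of_isLeftModuleTrace {ν : H 1 →ₐ[k] k} (t : TraceMap k (leftTwist ν))
    (ht : t.IsLeftModuleTrace (HMod k H)) (h0 : t.IsNonzero) : t.Nondegenerate := by
  obtain ⟨α, hα⟩ := exists_isModulus k H
  obtain ⟨h, -, hh, hspan, -⟩ := exists_semiinvariant_generator hα ν
  exact (reducesToUnit_left t ht).nondegenerate (hookInv_leftHook ν)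
    (leftHook_surjective ν) h0 hh hspan

theorem IsModulus.isUnimodular_iff (hα : IsModulus α) :
    IsUnimodular k H ↔ (counit : H 1 →ₐ[k] k) = α :=
  ⟨fun h => h.unique hα, fun e => by rw [IsUnimodular, e]; exact hα⟩

end Classification

end ModTrace

end

theorem mainTheorem2 {k : Type u} [Field k] {G : Type v} [Group G] (H : G → Type u)
    [∀ x, Ring (H x)] [∀ x, Algebra k (H x)] [∀ x, Module.Finite k (H x)]
    [PivotalHopfGroupCoalgebra k H] :
    ∃ α : H 1 →ₐ[k] k, IsModulus α ∧
      (∀ ν : H 1 →ₐ[k] k,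
        (∃ t : TraceMap k (rightTwist ν), t.IsRightModuleTrace (HMod k H) ∧ t.IsNonzero) ↔
          ν = α) ∧
      (∀ ν : H 1 →ₐ[k] k,
        (∃ t : TraceMap k (leftTwist ν), t.IsLeftModuleTrace (HMod k H) ∧ t.IsNonzero) ↔
          ν = α) ∧
      (∀ (ν : H 1 →ₐ[k] k) (t : TraceMap k (rightTwist ν)),
        t.IsRightModuleTrace (HMod k H) → t.IsNonzero → t.Nondegenerate) ∧
      (∀ (ν : H 1 →ₐ[k] k) (t : TraceMap k (leftTwist ν)),
        t.IsLeftModuleTrace (HMod k H) → t.IsNonzero → t.Nondegenerate) ∧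
      ((∃ t : TraceMap k (𝟭 (Proj (HMod k H))),
        t.IsRightModuleTrace (HMod k H) ∧ t.IsNonzero) ↔ IsUnimodular k H) ∧
      ((∃ t : TraceMap k (𝟭 (Proj (HMod k H))),
        t.IsLeftModuleTrace (HMod k H) ∧ t.IsNonzero) ↔ IsUnimodular k H) := by
  obtain ⟨α, hα⟩ := exists_isModulus k H
  refine ⟨α, hα, hα.exists_rightModuleTrace_iff, hα.exists_leftModuleTrace_iff,
    fun _ t ht h0 => nondegenerate_of_isRightModuleTrace t ht h0,
    fun _ t ht h0 => nondegenerate_of_isLeftModuleTrace t ht h0, ?_, ?_⟩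
  · rw [exists_rightModuleTrace_id_iff, hα.exists_rightModuleTrace_iff, hα.isUnimodular_iff]
  · rw [exists_leftModuleTrace_id_iff, hα.exists_leftModuleTrace_iff, hα.isUnimodular_iff]
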